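/- **Setting.** Let $k$ be a number field with ring of integers $\mathfrak o$, and $\bar k$ an algebraic closure. A *$p$-adic field* $K\supset k$ is a finite extension of some $\mathbf Q_p$ with an embedding of $k$. It has valuation ring $\mathfrak O_K$, maximal ideal $\mathfrak P_K$, $q_K=\#(\mathfrak O_K/\mathfrak P_K)$, normalised valuation $\nu_K$, $|x|_K=q_K^{-\nu_K(x)}$, and $\mu_K$ is the Haar measure on $K^n$ with $\mu_K(\mathfrak O_K^n)=1$. Put $\mathfrak p_K=\mathfrak o\cap\mathfrak P_K$. Write $\mathbf T^n$ for the $n$-dimensional split torus, so that $\mathbf T^n(R)=(R^\times)^n$. A *toric datum* $\mathcal T=(\mathcal C_0;f_1,\dots,f_r)$ consists of a rational half-open cone $\mathcal C_0\subset\mathbf R_{\ge0}^n$ (a set defined by finitely many conditions $\langle\phi,\omega\rangle\ge0$ and $\langle\chi,\omega\rangle>0$ with $\phi,\chi\in\mathbf Z^n$) and $f_1,\dots,f_r\in k[X_1^{\pm1},\dots,X_n^{\pm1}]$. For $\omega\in\mathbf R^n$, $\mathrm{in}_\omega(f)$ is the sum of the terms $c_\alpha X^\alpha$ of $f$ with $\langle\alpha,\omega\rangle$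 minimal. $\mathcal T$ is *balanced* if each $\mathrm{in}_\omega(f_i)$ is constant for $\omega\in\mathcal C_0$; for $\mathcal C_0\ne\emptyset$ the common value is denoted $\mathrm{in}_{\mathcal C_0}(f_i)$. A balanced $\mathcal T$ with $\mathcal C_0\neq\emptyset$ is *regular* if for all $J\subset\{1,\dots,r\}$ and all $u\in\mathbf T^n(\bar k)$ with $\mathrm{in}_{\mathcal C_0}(f_j)(u)=0$ for all $j\in J$, the Jacobian matrix $[\partial\,\mathrm{in}_{\mathcal C_0}(f_j)/\partial X_i(u)]_{i=1,\dots,n;\,j\in J}$ has rank $\#J$. For $\beta\in\mathrm{Mat}_{m\times n}(\mathbf N_0)$ with rows $\beta_1,\dots,\beta_m$ and $\mathrm{Re}(s_l)\ge0$, let $$\mathsf Z^{\mathcal T,\beta}_K(s_1,\dots,s_m)=\int_{\mathcal T_K}|x^{\beta_1}|_K^{s_1}\cdots|x^{\beta_m}|_K^{s_m}\,d\mu_K(x),$$ where $\mathcal T_K=\{x\in\mathbf T^n(K):\nu_K(x)\in\mathcal C_0,\ |f_i(x)|_K\le1\text{ for all }i\}$. **Notation for the formula.** Let $\mathcal T$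 be regular with $\mathcal C_0\ne\emptyset$. * $\tau$ is the unique face of the Newton polytope $\mathcal N$ of $f_1\cdots f_r$ such that every $\omega\in\mathcal C_0$ satisfies $\mathrm{face}_\omega(\mathcal N)=\tau$, where $\mathrm{face}_\omega(\mathcal N)$ is the face on which $\langle\cdot,\omega\rangle$ is minimal. * For $T\subset\{1,\dots,r\}$, $d(T)$ is the dimension of $\sum_{j\in T}\mathrm{Newton}(\mathrm{in}_{\mathcal C_0}(f_j))$. Choose $B_T\in\mathrm{GL}_n(\mathbf Z)$ and non-zero $g_{T,j}\in k[X_1^{\pm1},\dots,X_{d(T)}^{\pm1}]$ for $j\in T$ such that $g_{T,j}^{-1}\,\mathrm{in}_{\mathcal C_0}(f_j)^{B_T}$ is a Laurent monomial $cX^\alpha$ ($c\in k^\times$) for all $j\in T$; here $(X^\alpha)^{B}=X^{\alpha B}$. Let $U_T\subset\mathbf T^{d(T)}_k$ be the closed subvariety defined by $g_{T,j}=0$ for $j\in T$, and $\bar U_T$ its reduction modulo $\mathfrak p_K$, given by reducing the equations $g_{T,j}$. * Choose $\gamma_i\in\mathrm{supp}(\mathrm{in}_{\mathcal C_0}(f_i))$.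 For $J\subset\{1,\dots,r\}$, let $\mathcal C_0^J$ be the set of all $(\xi,o)\in\mathcal C_0\times\mathbf R_{>0}^J$ with $\langle\gamma_i,\xi\rangle\ge0$ for $i\notin J$ and $\langle\gamma_j,\xi\rangle+o_j\ge0$ for $j\in J$. Let $\mathcal Z^{\mathcal C_0^J}$ be the rational function over $\mathbf Q$ in variables $X_1,\dots,X_n$ and $(Z_j)_{j\in J}$ enumerating the lattice points of $\mathcal C_0^J$, i.e. whose power series expansion is $\sum X^\xi Z^o$, the sum over integral $(\xi,o)\in\mathcal C_0^J$. Let $\mathcal Z^{\mathcal C_0^J,A_J(\beta)}(Y_0,\dots,Y_m)$ be obtained from it by substituting $X_i\mapsto Y_0Y_1^{\beta_{1i}}\cdots Y_m^{\beta_{mi}}$ and $Z_j\mapsto Y_0$. Put $$W_J(q,t_1,\dots,t_m)=q^{-n}(q-1)^{n-\dim\tau+\#J}\,\mathcal Z^{\mathcal C_0^J,A_J(\beta)}(q^{-1},t_1,\dots,t_m)\in\mathbf Q(q,t_1,\dots,t_m).$$ **Proposition.** Let $\mathcal T=(\mathcal C_0;f_1,\dots,f_r)$ be a regular toric datum over $k$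 with $\mathcal C_0\neq\emptyset$. The face $\tau$ exists and is unique, and $B_T$, $g_{T,j}$ as above exist for every $T$. For every such choice there is a finite set $S$ of ideals of $\mathfrak o$ such that for all choices of the $\gamma_i$, all $m$, all $\beta\in\mathrm{Mat}_{m\times n}(\mathbf N_0)$ and all $p$-adic fields $K\supset k$ with $\mathfrak p_K\notin S$, the $g_{T,j}$ have $\mathfrak p_K$-integral coefficients and, for all $s_1,\dots,s_m\in\mathbf C$ with $\mathrm{Re}(s_l)\ge0$, the integral $\mathsf Z_K^{\mathcal T,\beta}(s_1,\dots,s_m)$ converges absolutely, each $W_J$ is regular at $(q_K,q_K^{-s_1},\dots,q_K^{-s_m})$, and $$\mathsf Z_K^{\mathcal T,\beta}(s_1,\dots,s_m)=\sum_{J}\Bigl(\sum_{T\supset J}(-1)^{\#J+\#T}\,\#\bar U_T(\mathfrak O_K/\mathfrak P_K)\,(q_K-1)^{\dim\tau-d(T)}\Bigr)W_J(q_K,q_K^{-s_1},\dots,q_K^{-s_m}),$$ where $J$ and $T$ range over subsets of $\{1,\dots,r\}$. -/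

import Mathlib

open scoped Pointwise NumberField ValuativeRel Matrix
open MeasureTheory

noncomputable section

namespace ToricZeta

/-! ### Laurent polynomials, Newton polytopes, initial forms -/

/-- Laurent polynomials in `n` variables over `k`; the monomial with exponent `α` and coefficient `c`
is `AddMonoidAlgebra.single α c`. -/
abbrev Laurent (k : Type*) [CommSemiring k] (n : ℕ) := AddMonoidAlgebra k (Fin n → ℤ)

/-- The standard inner product of an integral vector with a real vector. -/
def pairing {n : ℕ} (α : Fin n → ℤ) (ω : Fin n → ℝ) : ℝ := ∑ i, (α i : ℝ) * ω i

section LaurentPolynomials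

variable {k : Type*} [Field k] {n : ℕ}

/-- The support of a Laurent polynomial. -/
def supp (f : Laurent k n) : Finset (Fin n → ℤ) := f.coeff.support

/-- Evaluation of a Laurent polynomial at `x ∈ Lⁿ` (used only when all `x i ≠ 0`), the coefficients
being transported to the field `L` along `φ`. -/
def laurentEval {L : Type*} [Field L] (φ : k → L) (x : Fin n → L) (f : Laurent k n) : L :=
  f.coeff.sum fun α c => φ c * ∏ i, x i ^ α i

/-- The formal partial derivative `∂f/∂Xᵢ`. -/
def laurentDeriv (i : Fin n) (f : Laurent k n) : Laurent k n :=
  f.coeff.sum fun α c => AddMonoidAlgebra.single (α - Pi.single i 1) ((α i : k) * c)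

open Classical in
/-- The initial form of `f` in direction `ω`: the sum of those terms of `f` whose exponents
minimise `⟨α, ω⟩` over the support of `f`. -/
def initForm (ω : Fin n → ℝ) (f : Laurent k n) : Laurent k n :=
  AddMonoidAlgebra.ofCoeff
    (f.coeff.filter fun α => ∀ α' ∈ supp f, pairing α ω ≤ pairing α' ω)

/-- The Newton polytope of `f`. -/
def newton (f : Laurent k n) : Set (Fin n → ℝ) :=
  convexHull ℝ ((fun (α : Fin n → ℤ) (i : Fin n) => (α i : ℝ)) '' (supp f : Set (Fin n → ℤ)))

/-- The right action of `GL_n(ℤ)` on Laurent polynomials, `(X^α)^A = X^{αA}`. -/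
def glAct (A : GL (Fin n) ℤ) (f : Laurent k n) : Laurent k n :=
  AddMonoidAlgebra.mapDomain (fun α : Fin n → ℤ => α ᵥ* (A : Matrix (Fin n) (Fin n) ℤ)) f

/-- A Laurent polynomial in the first `d` variables regarded as one in `n` variables
(for `d ≤ n`). -/
def extendVars {d : ℕ} (n : ℕ) (g : Laurent k d) : Laurent k n :=
  AddMonoidAlgebra.mapDomain
    (fun (α : Fin d → ℤ) (i : Fin n) => if h : (i : ℕ) < d then α ⟨i, h⟩ else 0) g

end LaurentPolynomials

/-! ### Polytopes and cones -/

/-- The dimension of a polytope, that is, of its affine span. -/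
def polyDim {n : ℕ} (P : Set (Fin n → ℝ)) : ℕ := Module.finrank ℝ (vectorSpan ℝ P)

/-- `face_ω(P)`: the points of `P` at which `⟨·, ω⟩` attains its minimum. -/
def face {n : ℕ} (ω : Fin n → ℝ) (P : Set (Fin n → ℝ)) : Set (Fin n → ℝ) :=
  {x | x ∈ P ∧ ∀ y ∈ P, x ⬝ᵥ ω ≤ y ⬝ᵥ ω}

/-- `τ` is a (non-empty) face of the non-empty polytope `P`. -/
def IsFace {n : ℕ} (τ P : Set (Fin n → ℝ)) : Prop := ∃ ω, face ω P = τ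

/-- The (relatively open) normal cone of the face `τ` of `P`. -/
def normalCone {n : ℕ} (τ P : Set (Fin n → ℝ)) : Set (Fin n → ℝ) := {ω | face ω P = τ}

/-- Rational half-open cones in `ℝⁿ`. -/
def IsRationalHalfOpenCone {n : ℕ} (C : Set (Fin n → ℝ)) : Prop :=
  ∃ (d e : ℕ) (φ : Fin d → Fin n → ℤ) (χ : Fin e → Fin n → ℤ),
    C = {ω | (∀ i, 0 ≤ pairing (φ i) ω) ∧ ∀ j, 0 < pairing (χ j) ω}

/-! ### Toric data -/

/-- A toric datum `(C₀; f₁, …, f_r)` in `n` variables over `k`. -/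
structure ToricDatum (k : Type*) [Field k] (n r : ℕ) where
  cone : Set (Fin n → ℝ)
  f : Fin r → Laurent k n
  isCone : IsRationalHalfOpenCone cone
  nonneg : ∀ ω ∈ cone, ∀ i, 0 ≤ ω i

namespace ToricDatum

variable {k : Type*} [Field k] {n r : ℕ} (T : ToricDatum k n r)

/-- Each `init_ω(f_i)` is constant as `ω` ranges over the cone. -/
def IsBalanced : Prop :=
  ∀ i, ∀ ω ∈ T.cone, ∀ ω' ∈ T.cone, initForm ω (T.f i) = initForm ω' (T.f i)

open Classical in
/-- The common initial form `init_{C₀}(f_i)` of a balanced toric datum with non-empty cone. -/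
def init (i : Fin r) : Laurent k n :=
  if h : T.cone.Nonempty then initForm h.choose (T.f i) else 0

/-- Regularity of a toric datum. -/
def IsRegular : Prop :=
  T.IsBalanced ∧ (T.cone = ∅ ∨
    ∀ (J : Finset (Fin r)) (u : Fin n → AlgebraicClosure k), (∀ i, u i ≠ 0) →
      (∀ j ∈ J, laurentEval (algebraMap k (AlgebraicClosure k)) u (T.init j) = 0) →
      (Matrix.of fun (i : Fin n) (j : J) =>
        laurentEval (algebraMap k (AlgebraicClosure k)) u
          (laurentDeriv i (T.init j))).rank = J.card)

/-- `τ` is a face of the Newton polytope of `f₁ ⋯ f_r` whose normal cone contains the cone of `T`. -/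
def IsConeFace (τ : Set (Fin n → ℝ)) : Prop :=
  IsFace τ (newton (∏ i, T.f i)) ∧ T.cone ⊆ normalCone τ (newton (∏ i, T.f i))

/-- `d(I)`: the dimension of the Minkowski sum of the Newton polytopes of the initial forms
`init_{C₀}(f_j)`, `j ∈ I`. -/
def dimSum (I : Finset (Fin r)) : ℕ := polyDim (∑ j ∈ I, newton (T.init j))

/-- `B ∈ GL_n(ℤ)` and the non-zero Laurent polynomials `g j`, `j ∈ I`, in only `d(I)` variables
split off a torus factor: `g_j⁻¹ init_{C₀}(f_j)^B` is a Laurent monomial for each `j ∈ I`. -/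
def IsSplitting (I : Finset (Fin r)) (B : GL (Fin n) ℤ) (g : Fin r → Laurent k (T.dimSum I)) :
    Prop :=
  ∀ j ∈ I, g j ≠ 0 ∧ ∃ (c : k) (α : Fin n → ℤ), c ≠ 0 ∧
    glAct B (T.init j) = AddMonoidAlgebra.single α c * extendVars n (g j)

/-- The half-open cone `C₀^J ⊆ ℝⁿ × ℝ^J`, for chosen `γ i ∈ supp(init_{C₀}(f_i))`. -/
def coneJ (γ : Fin r → Fin n → ℤ) (J : Finset (Fin r)) : Set (Fin n ⊕ J → ℝ) :=
  {ω | (ω ∘ Sum.inl) ∈ T.cone ∧ (∀ i : Fin n, 0 ≤ ω (Sum.inl i)) ∧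
    (∀ j : J, 0 < ω (Sum.inr j)) ∧
    ∀ i : Fin r, 0 ≤ pairing (γ i) (ω ∘ Sum.inl) +
      ∑ j : J, (if (j : Fin r) = i then 1 else 0) * ω (Sum.inr j)}

end ToricDatum

/-! ### Rational functions and generating functions of cones -/

/-- The field `ℚ(X_i : i ∈ ι)` of rational functions. -/
abbrev RatFun (ι : Type*) := FractionRing (MvPolynomial ι ℚ)

/-- The variable `X_i` as a rational function. -/
def RatFun.var {ι : Type*} (i : ι) : RatFun ι :=
  algebraMap (MvPolynomial ι ℚ) (RatFun ι) (MvPolynomial.X i)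

/-- The rational function `F` is regular at the point `y ∈ L^ι`: the denominator of `F` in lowest
terms does not vanish there. -/
def RatFun.IsRegularAt {ι L : Type*} [Field L] [Algebra ℚ L] (F : RatFun ι) (y : ι → L) : Prop :=
  MvPolynomial.aeval y (IsFractionRing.den (MvPolynomial ι ℚ) F : MvPolynomial ι ℚ) ≠ 0

/-- The value of the rational function `F` at a point `y ∈ L^ι` at which it is regular (written in
lowest terms). For `L` itself a field of rational functions this is substitution. -/
def RatFun.eval {ι L : Type*} [Field L] [Algebra ℚ L] (F : RatFun ι) (y : ι → L) : L :=
  MvPolynomial.aeval y (IsFractionRing.num (MvPolynomial ι ℚ) F) /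
    MvPolynomial.aeval y (IsFractionRing.den (MvPolynomial ι ℚ) F : MvPolynomial ι ℚ)

open Classical in
/-- The power series enumerating the lattice points of `C` with non-negative coordinates. -/
def latticeSeries {ι : Type*} (C : Set (ι → ℝ)) : MvPowerSeries ι ℚ :=
  fun e => if (fun i => (e i : ℝ)) ∈ C then 1 else 0

/-- The power series enumerating the lattice points of `C` is given by the rational function `F`,
as an identity in the field of fractions of `ℚ⟦X⟧`. -/
def IsGenFun {ι : Type*} (C : Set (ι → ℝ)) (F : RatFun ι) : Prop :=
  ∃ P Q : MvPolynomial ι ℚ, Q ≠ 0 ∧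
    F = algebraMap (MvPolynomial ι ℚ) (RatFun ι) P / algebraMap (MvPolynomial ι ℚ) (RatFun ι) Q ∧
    (Q : MvPowerSeries ι ℚ) * latticeSeries C = (P : MvPowerSeries ι ℚ)

open Classical in
/-- The generating function of `C`: the (unique) rational function enumerating its lattice points.
It exists for rational half-open cones inside the non-negative orthant. -/
def genFun {ι : Type*} (C : Set (ι → ℝ)) : RatFun ι :=
  if h : ∃ F, IsGenFun C F then h.choose else 0

/-- The monomial substitution `X^α ↦ Y^{αA}`. -/
def monomialSubst {ι : Type*} {m : ℕ} (A : Matrix ι (Fin (m + 1)) ℕ) (F : RatFun ι) :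
    RatFun (Fin (m + 1)) :=
  F.eval fun i => ∏ l, RatFun.var l ^ A i l

/-- The matrix `A_J(β)` with columns `(1,…,1), (β₁,0), …, (β_m,0)`. -/
def matA {n r m : ℕ} (β : Matrix (Fin m) (Fin n) ℕ) (J : Finset (Fin r)) :
    Matrix (Fin n ⊕ J) (Fin (m + 1)) ℕ :=
  fun a => Fin.cons 1 fun l => Sum.elim (fun i => β l i) (fun _ => 0) a

namespace ToricDatum

variable {k : Type*} [Field k] {n r : ℕ} (T : ToricDatum k n r)

/-- `W_J(q, t₁, …, t_m) = q⁻ⁿ (q-1)^{n - dim τ + #J} Z^{A_J(β)}(q⁻¹, t₁, …, t_m)`, where `Z` is the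
generating function of `C₀^J`. Here `q` is the variable `0` and `t_l` is the variable `l`. -/
def W (τ : Set (Fin n → ℝ)) (γ : Fin r → Fin n → ℤ) {m : ℕ} (β : Matrix (Fin m) (Fin n) ℕ)
    (J : Finset (Fin r)) : RatFun (Fin (m + 1)) :=
  RatFun.var 0 ^ (-(n : ℤ)) * (RatFun.var 0 - 1) ^ ((n : ℤ) - (polyDim τ : ℤ) + (J.card : ℤ)) *
    (monomialSubst (matA β J) (genFun (T.coneJ γ J))).eval
      (Fin.cons (RatFun.var 0)⁻¹ fun l : Fin m => RatFun.var l.succ : Fin (m + 1) →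
        RatFun (Fin (m + 1)))

end ToricDatum

/-! ### `p`-adic fields

A `p`-adic field containing `k` is a nonarchimedean local field `K` with an embedding of the number
field `k`; it has characteristic zero, so these are precisely the finite extensions of the fields
`ℚ_p` containing `k`. -/

section LocalField

variable (k K : Type*) [Field k] [Field K] [ValuativeRel K]

section Below

variable [Algebra k K]

lemma ringOfIntegers_mem_integer (a : 𝓞 k) : algebraMap k K (a : k) ∈ 𝒪[K] := by
  have h : IsIntegral ℤ (algebraMap k K (a : k)) :=
    (NumberField.RingOfIntegers.isIntegral_coe a).algebraMap
  exact (Valuation.integer.integers (ValuativeRel.valuation K)).mem_of_integral h.tower_top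

/-- The inclusion of the ring of integers of `k` into the valuation ring of `K`. -/
def integersHom : 𝓞 k →+* 𝒪[K] :=
  ((algebraMap k K).comp (algebraMap (𝓞 k) k)).codRestrict 𝒪[K] (ringOfIntegers_mem_integer k K)

/-- The prime `𝔭_K = 𝔬 ∩ 𝔓_K` of the ring of integers `𝔬` of `k` below the maximal ideal. -/
def primeBelow : Ideal (𝓞 k) := Ideal.comap (integersHom k K) 𝓂[K]

variable {k}

open Classical in
/-- Reduction modulo `𝔓_K` of those elements of `k` which are integral at `𝔓_K`
(and zero for the others). -/
def reduceCoeff (c : k) : 𝓀[K] :=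
  if h : algebraMap k K c ∈ 𝒪[K] then IsLocalRing.residue 𝒪[K] ⟨algebraMap k K c, h⟩ else 0

/-- The coefficients of `g` are integral at `𝔓_K`, so that `g` can be reduced modulo `𝔓_K`. -/
def HasReduction {d : ℕ} (g : Laurent k d) : Prop := ∀ α, algebraMap k K (g.coeff α) ∈ 𝒪[K]

/-- `#Ū(𝔒_K/𝔓_K)` for the closed subvariety `U` of the `d`-dimensional torus defined by `g j = 0`
for `j ∈ I`: the number of points over the residue field of its reduction. -/
def numPoints {d r : ℕ} (I : Finset (Fin r)) (g : Fin r → Laurent k d) : ℕ :=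
  Nat.card {u : Fin d → 𝓀[K] //
    (∀ i, u i ≠ 0) ∧ ∀ j ∈ I, laurentEval (reduceCoeff K) u (g j) = 0}

end Below

variable [TopologicalSpace K] [IsNonarchimedeanLocalField K]

/-- `q_K`, the cardinality of the residue field. -/
def qK : ℕ := Nat.card 𝓀[K]

variable {K} in
/-- The normalised valuation `ν_K` (on non-zero elements). -/
def nuK (x : K) : ℤ :=
  -WithZero.log
    (IsNonarchimedeanLocalField.valueGroupWithZeroIsoInt K (ValuativeRel.valuation K x))

open Classical in
variable {K} in
/-- The absolute value `|x|_K = q_K^{-ν_K(x)}`, with `|0|_K = 0`. -/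
def absK (x : K) : ℝ := if x = 0 then 0 else (qK K : ℝ) ^ (-nuK x)

lemma isOpen_integer : IsOpen (𝒪[K] : Set K) :=
  Valuation.isOpen_integer

/-- The compact open subgroup `𝔒_Kⁿ` of `Kⁿ`. -/
def unitPolydisc (n : ℕ) : TopologicalSpace.PositiveCompacts (Fin n → K) where
  carrier := Set.univ.pi fun _ => (𝒪[K] : Set K)
  isCompact' := isCompact_univ_pi fun _ => IsNonarchimedeanLocalField.isCompact_closedBall K 1
  interior_nonempty' := by
    rw [(isOpen_set_pi Set.finite_univ fun _ _ => isOpen_integer K).interior_eq]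
    exact ⟨0, fun _ _ => zero_mem _⟩

/-- The Haar measure `μ_K` on `Kⁿ` with `μ_K(𝔒_Kⁿ) = 1`. -/
def haarK (n : ℕ) [MeasurableSpace (Fin n → K)] [BorelSpace (Fin n → K)] : Measure (Fin n → K) :=
  Measure.addHaarMeasure (unitPolydisc K n)

namespace ToricDatum

variable {k} [Algebra k K] {n r : ℕ} (T : ToricDatum k n r)

/-- `T_K`: the points `x` of the torus over `K` with `ν_K(x) ∈ C₀` and all `|f_i(x)|_K ≤ 1`. -/
def points : Set (Fin n → K) :=
  {x | (∀ i, x i ≠ 0) ∧ (fun i => (nuK (x i) : ℝ)) ∈ T.cone ∧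
    ∀ i, absK (laurentEval (algebraMap k K) x (T.f i)) ≤ 1}

end ToricDatum

variable {K} in
/-- The integrand `|x^{β₁}|_K^{s₁} ⋯ |x^{β_m}|_K^{s_m}`. -/
def integrand {n m : ℕ} (β : Matrix (Fin m) (Fin n) ℕ) (s : Fin m → ℂ) (x : Fin n → K) : ℂ :=
  ∏ l, ((absK (∏ i, x i ^ β l i) : ℝ) : ℂ) ^ s l

/-- The zeta function `Z_K^{T,β}(s₁, …, s_m)`. -/
def zetaK {k : Type*} [Field k] [Algebra k K] {n r m : ℕ} (T : ToricDatum k n r)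
    (β : Matrix (Fin m) (Fin n) ℕ) (s : Fin m → ℂ)
    [MeasurableSpace (Fin n → K)] [BorelSpace (Fin n → K)] : ℂ :=
  ∫ x in T.points K, integrand β s x ∂(haarK K n)

/-- The point `(q_K, q_K^{-s₁}, …, q_K^{-s_m})`. -/
def qPoint {m : ℕ} (s : Fin m → ℂ) : Fin (m + 1) → ℂ :=
  Fin.cons (qK K : ℂ) fun l => (qK K : ℂ) ^ (-s l)

end LocalField

end ToricZeta

end

open ToricZeta

/-!
The integral is computed by cutting the domain of integration into pieces. A point of the torus
over `K` is `x = ϖ^ξ w` with `ξ ∈ ℤⁿ` and `w` a tuple of units, and the piece attached to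
`ξ ∈ C₀ ∩ ℕⁿ` and to a point `v` of the torus over the residue field consists of the `x` with this `ξ` for
which `w` reduces to `v` (`torusPiece`). On it the integrand is constant (`integrand_eq`). Since
the datum is balanced, `f_i(ϖ^ξ X) = ϖ^{⟨γ_i, ξ⟩} G_i(X)`, where `G_i` has integral coefficients
and reduces to the reduction of the initial form of `f_i` (`laurentEval_eq_tilt`, `residue_tilt`).
Let `J` be the set of those `j` for which this reduction vanishes at `v`. For `i ∉ J` the
condition `|f_i(x)| ≤ 1` says that `⟨γ_i, ξ⟩ ≥ 0`; for `j ∈ J` it says that `G_j(w) ≡ 0` modulo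
`𝔓^{-⟨γ_j, ξ⟩}`.

For all but finitely many primes the Jacobian condition survives reduction. Indeed, by the
Nullstellensatz it says that the initial forms indexed by `J` and their Jacobian minors generate
the unit ideal, and the finitely many coefficients of a certificate for this are integral at
almost all primes (`span_jacobianMinor_eq_top`, `exists_finset_minor`). So the `G_j`, `j ∈ J`, are
part of a system of local coordinates which detects congruences
(`sub_mem_iff_localCoord_sub_mem`), and counting residue classes shows that the piece has volume
`q^{-|ξ| - n + #J - ∑ a_j}`, where `a_j = max(1, -⟨γ_j, ξ⟩)` (`haarK_residuePiece_mul`). By the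
geometric series this is `q^{-n} (q - 1)^{#J}` times the sum of `q^{-|ξ| - |o|}` over the `o` with
`(ξ, o) ∈ C₀^J` (`GoodReduction.hasSum_volume`). Summation over `ξ` therefore gives the value of
the generating function of `C₀^J`, which is computed in `ToricDatum.exists_hasValue_W`: the
lattice points of a rational half-open cone correspond, by their lexicographically minimal
representations in terms of generators `v` of the monoid of lattice points of the closed cone, to
a difference of two upper sets in `ℕ^N`, so that the generating function has the denominator
`∏ (1 - X^v)`, which does not vanish on the open unit polydisc (`exists_hasSum_of_halfOpen`).

It remains to count the points `v` with given `J`. This is inclusion-exclusion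
(`card_filter_eq_sum`) together with the count of common zeros of the initial forms indexed by
`I`, which is `#Ū_I(𝔒/𝔓)` times the number of points of a torus of dimension `n - d(I)`
(`card_zeros_of_splitting`). The splitting exists because the differences of exponents of the
initial forms span a space of dimension `d(I)` (`ToricDatum.exists_isSplitting`), and the face `τ`
is the convex hull of the support of the product of the initial forms, which is the initial form
of the product (`ToricDatum.IsRegular.existsUnique_coneFace`).
-/

noncomputable section

namespace ToricZeta

/-! ### Generating functions of lattice points in half-open cones -/

section GeneratingFunctions

variable {ι : Type*} {N : ℕ}

/-- The additive map `ℕ^N → ℕ^ι` sending the standard basis to the vectors `v 0, …, v (N-1)`. -/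
def combine (v : Fin N → ι →₀ ℕ) : (Fin N → ℕ) →+ (ι →₀ ℕ) where
  toFun a := ∑ i, a i • v i
  map_zero' := by simp
  map_add' a b := by simp [add_smul, Finset.sum_add_distrib]

lemma combine_apply (v : Fin N → ι →₀ ℕ) (a : Fin N → ℕ) : combine v a = ∑ i, a i • v i := rfl

lemma combine_single (v : Fin N → ι →₀ ℕ) (i : Fin N) : combine v (Pi.single i 1) = v i := by
  rw [combine_apply, Finset.sum_eq_single i] <;> simp +contextual

lemma finite_fiber_combine {v : Fin N → ι →₀ ℕ} (hv : ∀ i, v i ≠ 0) (e : ι →₀ ℕ) :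
    {a | combine v a = e}.Finite := by
  refine (Set.finite_Iic (fun _ : Fin N => e.degree)).subset ?_
  rintro a rfl i
  have h1 : a i ≤ a i * (v i).degree :=
    Nat.le_mul_of_pos_right _ (Nat.pos_of_ne_zero fun h => hv i ((Finsupp.degree_eq_zero_iff _).1 h))
  have h2 : (combine v a).degree = ∑ i, a i * (v i).degree := by
    rw [combine_apply, map_sum]
    simp
  show a i ≤ _
  rw [h2]
  exact h1.trans (Finset.single_le_sum (f := fun i => a i * (v i).degree) (fun _ _ => Nat.zero_le _)
    (Finset.mem_univ i))

/-- The finite set of all `a ∈ ℕ^N` with `∑ a_i v_i = e`, for non-zero vectors `v_i`. -/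
def combineFiber {v : Fin N → ι →₀ ℕ} (hv : ∀ i, v i ≠ 0) (e : ι →₀ ℕ) : Finset (Fin N → ℕ) :=
  (finite_fiber_combine hv e).toFinset

lemma mem_combineFiber {v : Fin N → ι →₀ ℕ} (hv : ∀ i, v i ≠ 0) {e : ι →₀ ℕ} {a : Fin N → ℕ} :
    a ∈ combineFiber hv e ↔ combine v a = e := by
  simp [combineFiber]

/-- The push-forward `∑_a h(a) X^{∑ a_i v_i}` of a function `h` on `ℕ^N`. -/
def pushSeries {v : Fin N → ι →₀ ℕ} (hv : ∀ i, v i ≠ 0) :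
    ((Fin N → ℕ) → ℚ) →ₗ[ℚ] MvPowerSeries ι ℚ where
  toFun h := fun e => ∑ a ∈ combineFiber hv e, h a
  map_add' h h' := by
    funext e
    exact Finset.sum_add_distrib
  map_smul' c h := by
    funext e
    exact (Finset.mul_sum _ _ _).symm

lemma coeff_pushSeries {v : Fin N → ι →₀ ℕ} (hv : ∀ i, v i ≠ 0) (h : (Fin N → ℕ) → ℚ)
    (e : ι →₀ ℕ) :
    MvPowerSeries.coeff e (pushSeries hv h) = ∑ a ∈ combineFiber hv e, h a := rfl

open Classical in
lemma monomial_mul_pushSeries {v : Fin N → ι →₀ ℕ} (hv : ∀ i, v i ≠ 0) (h : (Fin N → ℕ) → ℚ)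
    (w : Fin N → ℕ) :
    MvPowerSeries.monomial (combine v w) 1 * pushSeries hv h =
      pushSeries hv fun a => if w ≤ a then h (a - w) else 0 := by
  ext e
  rw [MvPowerSeries.coeff_monomial_mul, coeff_pushSeries hv (fun a => ite (w ≤ a) _ _),
    ← Finset.sum_filter]
  split_ifs with he
  · rw [one_mul, coeff_pushSeries]
    refine Finset.sum_nbij' (fun a => a + w) (fun a => a - w) ?_ ?_ ?_ ?_ ?_
    · intro a ha
      rw [mem_combineFiber] at ha
      simp only [Finset.mem_filter, mem_combineFiber, map_add, ha]
      exact ⟨tsub_add_cancel_of_le he, le_add_self⟩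
    · intro a ha
      simp only [Finset.mem_filter, mem_combineFiber] at ha ⊢
      rw [← ha.1]
      nth_rewrite 2 [← tsub_add_cancel_of_le ha.2]
      rw [map_add, add_tsub_cancel_right]
    · intro a _
      exact add_tsub_cancel_right a w
    · intro a ha
      exact tsub_add_cancel_of_le (Finset.mem_filter.1 ha).2
    · intro a _
      simp
  · symm
    apply Finset.sum_eq_zero
    intro a ha
    simp only [Finset.mem_filter, mem_combineFiber] at ha
    refine absurd ?_ he
    rw [← ha.1, ← tsub_add_cancel_of_le ha.2, map_add]
    exact le_add_self

/-- The denominator `∏ (1 - X^{v_i})`. -/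
def geomDenom (v : Fin N → ι →₀ ℕ) : MvPolynomial ι ℚ :=
  ∏ i, (1 - MvPolynomial.monomial (v i) 1)

open Classical in
/-- Multiplying by the factors `1 - X^{v_i}`, `i ∈ s`, of the denominator cuts `ℕ^N` down to the
coordinate subspace `a_i = 0`, `i ∈ s`. -/
lemma prod_mul_pushSeries_one {v : Fin N → ι →₀ ℕ} (hv : ∀ i, v i ≠ 0) (s : Finset (Fin N)) :
    (∏ i ∈ s, (1 - MvPowerSeries.monomial (v i) 1)) * pushSeries hv 1 =
      pushSeries hv fun a => if ∀ i ∈ s, a i = 0 then 1 else 0 := by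
  induction s using Finset.induction_on with
  | empty =>
    simp
    rfl
  | insert i s hi ih =>
    rw [Finset.prod_insert hi, mul_assoc, ih, sub_mul, one_mul, ← combine_single v i,
      monomial_mul_pushSeries, ← map_sub]
    congr 1
    funext a
    have hle : Pi.single i 1 ≤ a ↔ 1 ≤ a i := by
      constructor
      · intro h
        simpa using h i
      · intro h j
        by_cases hj : j = i
        · subst hj
          simpa using h
        · simp [hj]
    have hs : (∀ j ∈ s, (a - (Pi.single i 1 : Fin N → ℕ)) j = 0) ↔ ∀ j ∈ s, a j = 0 := by
      refine forall₂_congr fun j hj => ?_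
      have : j ≠ i := fun h => hi (h ▸ hj)
      simp [this]
    simp only [Pi.sub_apply, hle] at hs ⊢
    simp only [hs, Finset.forall_mem_insert]
    by_cases h0 : a i = 0
    · simp [h0]
    · have : 1 ≤ a i := Nat.one_le_iff_ne_zero.2 h0
      simp [h0, this]

lemma coe_geomDenom (v : Fin N → ι →₀ ℕ) :
    (geomDenom v : MvPowerSeries ι ℚ) = ∏ i, (1 - MvPowerSeries.monomial (v i) 1) := by
  rw [geomDenom, ← MvPolynomial.coeToMvPowerSeries.ringHom_apply, map_prod]
  refine Finset.prod_congr rfl fun i _ => ?_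
  rw [map_sub, map_one, MvPolynomial.coeToMvPowerSeries.ringHom_apply, MvPolynomial.coe_monomial]

lemma geomDenom_mul_pushSeries_one {v : Fin N → ι →₀ ℕ} (hv : ∀ i, v i ≠ 0) :
    (geomDenom v : MvPowerSeries ι ℚ) * pushSeries hv 1 = 1 := by
  classical
  rw [coe_geomDenom, prod_mul_pushSeries_one]
  ext e
  have h0 : ∀ a : Fin N → ℕ, (∀ i ∈ Finset.univ, a i = 0) ↔ a = 0 := fun a => by
    simp [funext_iff]
  simp only [h0]
  rw [coeff_pushSeries, MvPowerSeries.coeff_one, Finset.sum_ite_eq']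
  simp [mem_combineFiber, eq_comm]

/-- The functions on `ℕ^N` whose push-forward is a rational function with denominator
`∏ (1 - X^{v_i})`. -/
def rationalPush {v : Fin N → ι →₀ ℕ} (hv : ∀ i, v i ≠ 0) : Submodule ℚ ((Fin N → ℕ) → ℚ) where
  carrier := {h | ∃ P : MvPolynomial ι ℚ,
    (geomDenom v : MvPowerSeries ι ℚ) * pushSeries hv h = (P : MvPowerSeries ι ℚ)}
  add_mem' := by
    rintro h h' ⟨P, hP⟩ ⟨P', hP'⟩
    exact ⟨P + P', by rw [map_add, mul_add, hP, hP', MvPolynomial.coe_add]⟩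
  zero_mem' := ⟨0, by simp⟩
  smul_mem' := by
    rintro c h ⟨P, hP⟩
    refine ⟨c • P, ?_⟩
    rw [map_smul, mul_smul_comm, hP, MvPolynomial.smul_eq_C_mul, MvPolynomial.coe_mul,
      MvPolynomial.coe_C, MvPowerSeries.smul_eq_C_mul]

lemma indicator_Ici_mem_rationalPush {v : Fin N → ι →₀ ℕ} (hv : ∀ i, v i ≠ 0) (w : Fin N → ℕ) :
    (Set.Ici w).indicator 1 ∈ rationalPush hv := by
  classical
  refine ⟨MvPolynomial.monomial (combine v w) 1, ?_⟩
  have : (Set.Ici w).indicator (1 : (Fin N → ℕ) → ℚ) =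
      fun a => if w ≤ a then (1 : (Fin N → ℕ) → ℚ) (a - w) else 0 := by
    funext a
    simp [Set.indicator_apply]
  rw [this, ← monomial_mul_pushSeries, mul_left_comm, geomDenom_mul_pushSeries_one, mul_one,
    MvPolynomial.coe_monomial]

/-- Rationality for a finite union of translated orthants, by inclusion-exclusion; the orthant `Ici w`
is carried along for the induction, since orthants are closed under intersection. -/
lemma indicator_Ici_inter_mem_rationalPush {v : Fin N → ι →₀ ℕ} (hv : ∀ i, v i ≠ 0)
    (s : Finset (Fin N → ℕ)) (w : Fin N → ℕ) :
    (Set.Ici w ∩ ⋃ u ∈ s, Set.Ici u).indicator 1 ∈ rationalPush hv := by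
  classical
  induction s using Finset.induction_on generalizing w with
  | empty =>
    have : (Set.Ici w ∩ ⋃ u ∈ (∅ : Finset (Fin N → ℕ)), Set.Ici u) = ∅ := by simp
    rw [this, Set.indicator_empty']
    exact zero_mem _
  | insert u s _ ih =>
    have h : (Set.Ici w ∩ ⋃ x ∈ insert u s, Set.Ici x).indicator (1 : (Fin N → ℕ) → ℚ) =
        (Set.Ici (w ⊔ u)).indicator 1 + (Set.Ici w ∩ ⋃ x ∈ s, Set.Ici x).indicator 1 -
          (Set.Ici (w ⊔ u) ∩ ⋃ x ∈ s, Set.Ici x).indicator 1 := by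
      rw [Finset.set_biUnion_insert]
      funext a
      simp only [Set.indicator_apply, Pi.sub_apply, Pi.add_apply, Set.mem_inter_iff, Set.mem_union,
        Set.mem_Ici, sup_le_iff, Pi.one_apply]
      by_cases h1 : w ≤ a <;> by_cases h2 : u ≤ a <;> by_cases h3 : a ∈ ⋃ x ∈ s, Set.Ici x <;>
        simp [h1, h2, h3]
    rw [h]
    exact sub_mem (add_mem (indicator_Ici_mem_rationalPush hv _) (ih _)) (ih _)

/-- Rationality for upper sets, which are finite unions of translated orthants by Dickson's lemma. -/
lemma indicator_upperSet_mem_rationalPush {v : Fin N → ι →₀ ℕ} (hv : ∀ i, v i ≠ 0)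
    {U : Set (Fin N → ℕ)} (hU : IsUpperSet U) : U.indicator 1 ∈ rationalPush hv := by
  have hpwo : U.IsPWO := Set.isPWO_of_wellQuasiOrderedLE U
  have hfin : {x | Minimal (· ∈ U) x}.Finite :=
    (setOfPred_minimal_antichain _).finite_of_partiallyWellOrderedOn
      (hpwo.mono (setOfPred_minimal_subset _))
  have hUeq : U = Set.Ici 0 ∩ ⋃ u ∈ hfin.toFinset, Set.Ici u := by
    ext a
    simp only [Set.mem_inter_iff, Set.mem_Ici, zero_le, true_and, Set.mem_iUnion,
      Set.Finite.mem_toFinset, Set.mem_ofPred_eq, exists_prop]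
    constructor
    · intro ha
      obtain ⟨b, hb, hmin⟩ := exists_minimal_le_of_wellFoundedLT (· ∈ U) a ha
      exact ⟨b, hmin, hb⟩
    · rintro ⟨u, hu, hua⟩
      exact hU hua hu.prop
  rw [hUeq]
  exact indicator_Ici_inter_mem_rationalPush hv _ _

/-- Among the representations of a lattice point as a non-negative combination of the `v_i` there is
exactly one which is lexicographically minimal; the non-minimal ones form an upper set. -/
lemma isUpperSet_not_lexMinimal (v : Fin N → ι →₀ ℕ) :
    IsUpperSet {a : Fin N → ℕ | ∃ b, toLex b < toLex a ∧ combine v b = combine v a} := by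
  rintro a c hac ⟨b, hb, hba⟩
  refine ⟨b + (c - a), ?_, ?_⟩
  · have : c = a + (c - a) := (add_tsub_cancel_of_le hac).symm
    conv_rhs => rw [this]
    rw [toLex_add, toLex_add]
    exact add_lt_add_left hb _
  · rw [map_add, hba, ← map_add, add_tsub_cancel_of_le hac]

/-- The generating function of an `M`-stable subset of a finitely generated monoid `M ⊆ ℕ^ι` is
rational with denominator `∏ (1 - X^{v_i})`, where the `v_i` generate `M`. -/
lemma exists_numerator_of_fg {v : Fin N → ι →₀ ℕ} (hv : ∀ i, v i ≠ 0) (C : Set (ι → ℝ))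
    (hC : ∀ e : ι →₀ ℕ, (fun i => (e i : ℝ)) ∈ C → ∃ a, combine v a = e)
    (hadd : ∀ a b, (fun i => (combine v a i : ℝ)) ∈ C → (fun i => (combine v (a + b) i : ℝ)) ∈ C) :
    ∃ P : MvPolynomial ι ℚ,
      (geomDenom v : MvPowerSeries ι ℚ) * latticeSeries C =
        (P : MvPowerSeries ι ℚ) := by
  classical
  set D : Set (ι →₀ ℕ) := {e | (fun i => (e i : ℝ)) ∈ C}
  set U : Set (Fin N → ℕ) := {a | combine v a ∈ D}
  set V : Set (Fin N → ℕ) := {a | ∃ b, toLex b < toLex a ∧ combine v b = combine v a}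
  have hU : IsUpperSet U := by
    intro a c hac ha
    have := hadd a (c - a) ha
    rwa [add_tsub_cancel_of_le hac] at this
  have hV : IsUpperSet V := isUpperSet_not_lexMinimal v
  obtain ⟨P, hP⟩ := sub_mem (indicator_upperSet_mem_rationalPush hv hU)
    (indicator_upperSet_mem_rationalPush hv (hU.inter hV))
  refine ⟨P, ?_⟩
  rw [← hP]
  congr 1
  funext e
  change (if e ∈ D then 1 else 0) = ∑ a ∈ combineFiber hv e, _
  have hterm : ∀ a ∈ combineFiber hv e,
      (U.indicator (1 : (Fin N → ℕ) → ℚ) - (U ∩ V).indicator (1 : (Fin N → ℕ) → ℚ) :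
        (Fin N → ℕ) → ℚ) a =
        if e ∈ D ∧ a ∉ V then 1 else 0 := by
    intro a ha
    rw [mem_combineFiber] at ha
    have : a ∈ U ↔ e ∈ D := by simp [U, ha]
    simp only [Pi.sub_apply, Set.indicator_apply, Set.mem_inter_iff, this, Pi.one_apply]
    by_cases h1 : e ∈ D <;> by_cases h2 : a ∈ V <;> simp [h1, h2]
  rw [Finset.sum_congr rfl hterm]
  by_cases he : e ∈ D
  · obtain ⟨a₀, ha₀⟩ := hC e he
    obtain ⟨m, hm, hmin⟩ := WellFounded.has_min (wellFounded_lt (α := Lex (Fin N → ℕ)))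
      {x | combine v (ofLex x) = e} ⟨toLex a₀, ha₀⟩
    have hm' : combine v (ofLex m) = e := hm
    have hmV : ofLex m ∉ V := by
      rintro ⟨b, hb, hbm⟩
      exact hmin (toLex b) (hbm.trans hm') hb
    rw [Finset.sum_eq_single (ofLex m)]
    · simp [he, hmV]
    · intro b hb hbm
      rw [mem_combineFiber] at hb
      have hlt : m < toLex b := lt_of_le_of_ne (not_lt.1 (hmin (toLex b) hb))
        fun h => hbm (by rw [h]; rfl)
      have : b ∈ V := ⟨ofLex m, hlt, hm'.trans hb.symm⟩
      simp [this]
    · intro h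
      exact absurd ((mem_combineFiber hv).2 hm') h
  · simp [he]

end GeneratingFunctions

section HalfOpenCones

variable {ι : Type*} [Fintype ι]

/-- Gordan's lemma: the lattice points of a closed rational cone in the non-negative orthant are the
non-negative integral combinations of finitely many non-zero vectors. -/
lemma exists_generators_of_cone {d : ℕ} (φ : Fin d → ι → ℤ) :
    ∃ (N : ℕ) (v : Fin N → ι →₀ ℕ), (∀ i, v i ≠ 0) ∧
      ∀ e : ι →₀ ℕ, (∀ i, 0 ≤ ∑ x, φ i x * (e x : ℤ)) ↔ ∃ a, combine v a = e := by
  classical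
  -- The slack variables `s i = ⟨φ i, e⟩` turn the inequalities into equations over `ℕ`.
  let F : (ι → ℕ) × (Fin d → ℕ) →+ (Fin d → ℤ) :=
    { toFun := fun p i => ∑ x, φ i x * (p.1 x : ℤ)
      map_zero' := by funext i; simp
      map_add' := fun p p' => by
        funext i
        simp [mul_add, Finset.sum_add_distrib] }
  let G : (ι → ℕ) × (Fin d → ℕ) →+ (Fin d → ℤ) :=
    { toFun := fun p i => (p.2 i : ℤ)
      map_zero' := by funext i; simp
      map_add' := fun p p' => by funext i; simp }
  let pr : (ι → ℕ) × (Fin d → ℕ) →+ (ι →₀ ℕ) :=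
    { toFun := fun p => Finsupp.equivFunOnFinite.symm p.1
      map_zero' := by ext; simp
      map_add' := fun p p' => by ext; simp }
  have hfg : (AddSubmonoid.map pr (F.eqLocusM G)).FG := (AddSubmonoid.fg_eqLocusM F G).map pr
  have hmem : ∀ e : ι →₀ ℕ, e ∈ AddSubmonoid.map pr (F.eqLocusM G) ↔
      ∀ i, 0 ≤ ∑ x, φ i x * (e x : ℤ) := by
    intro e
    rw [AddSubmonoid.mem_map]
    constructor
    · rintro ⟨p, hp, rfl⟩ i
      have := congrFun hp i
      change ∑ x, φ i x * (p.1 x : ℤ) = (p.2 i : ℤ) at this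
      change 0 ≤ ∑ x, φ i x * (p.1 x : ℤ)
      rw [this]
      positivity
    · intro h
      refine ⟨(e, fun i => (∑ x, φ i x * (e x : ℤ)).toNat), ?_, by ext; simp [pr]⟩
      funext i
      exact (Int.toNat_of_nonneg (h i)).symm
  obtain ⟨S, hS⟩ := hfg
  let S' := S.erase 0
  have hS' : AddSubmonoid.closure (S' : Set (ι →₀ ℕ)) = AddSubmonoid.map pr (F.eqLocusM G) := by
    rw [← hS, Finset.coe_erase, AddSubmonoid.closure_sdiff_singleton_zero]
  refine ⟨S'.card, fun i => (S'.equivFin.symm i : ι →₀ ℕ), fun i => ?_, fun e => ?_⟩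
  · exact Finset.ne_of_mem_erase (S'.equivFin.symm i).2
  rw [← hmem, ← hS', AddSubmonoid.mem_closure_finset]
  constructor
  · rintro ⟨f, -, rfl⟩
    refine ⟨fun i => f (S'.equivFin.symm i), ?_⟩
    rw [combine_apply, Equiv.sum_comp S'.equivFin.symm (fun a : S' => f a • (a : ι →₀ ℕ))]
    exact Finset.sum_coe_sort S' fun a => f a • a
  · rintro ⟨a, rfl⟩
    rw [← AddSubmonoid.mem_closure_finset, combine_apply]
    exact sum_mem fun i _ => AddSubmonoid.nsmul_mem _
      (AddSubmonoid.subset_closure (S'.equivFin.symm i).2) _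

/-- The generating function of a rational half-open cone is rational, with denominator a product of
factors `1 - X^v`, `v ≠ 0`. -/
lemma exists_latticeSeries_eq {d d' : ℕ} (φ : Fin d → ι → ℤ) (χ : Fin d' → ι → ℤ)
    {C : Set (ι → ℝ)}
    (hC : C = {ω | (∀ i, 0 ≤ ∑ x, (φ i x : ℝ) * ω x) ∧ ∀ j, 0 < ∑ x, (χ j x : ℝ) * ω x}) :
    ∃ (N : ℕ) (v : Fin N → ι →₀ ℕ) (P : MvPolynomial ι ℚ), (∀ i, v i ≠ 0) ∧
      (geomDenom v : MvPowerSeries ι ℚ) * latticeSeries C = (P : MvPowerSeries ι ℚ) := by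
  have hmem : ∀ e : ι →₀ ℕ, (fun x => (e x : ℝ)) ∈ C ↔
      (∀ i, 0 ≤ ∑ x, φ i x * (e x : ℤ)) ∧ ∀ j, 0 < ∑ x, χ j x * (e x : ℤ) := by
    intro e
    rw [hC, Set.mem_ofPred_eq]
    refine and_congr (forall_congr' fun i => ?_) (forall_congr' fun j => ?_)
    · rw [← Int.cast_nonneg_iff (R := ℝ)]
      push_cast
      rfl
    · rw [← Int.cast_pos (R := ℝ)]
      push_cast
      rfl
  obtain ⟨N, v, hv, hgen⟩ := exists_generators_of_cone (Fin.append φ χ)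
  have hgen' : ∀ e : ι →₀ ℕ, ((∀ i, 0 ≤ ∑ x, φ i x * (e x : ℤ)) ∧
      ∀ j, 0 ≤ ∑ x, χ j x * (e x : ℤ)) ↔ ∃ a, combine v a = e := by
    intro e
    rw [← hgen]
    constructor
    · rintro ⟨h1, h2⟩ i
      refine Fin.addCases (fun j => ?_) (fun j => ?_) i
      · simpa using h1 j
      · simpa using h2 j
    · exact fun h => ⟨fun i => by simpa using h (Fin.castAdd d' i),
        fun j => by simpa using h (Fin.natAdd d j)⟩
  obtain ⟨P, hP⟩ := exists_numerator_of_fg hv C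
    (fun e he => (hgen' e).1 ⟨((hmem e).1 he).1, fun j => (((hmem e).1 he).2 j).le⟩) (by
      intro a b hab
      obtain ⟨h1, h2⟩ := (hmem _).1 hab
      obtain ⟨h3, h4⟩ := (hgen' _).2 ⟨b, rfl⟩
      refine (hmem _).2 ?_
      simp only [map_add, Finsupp.add_apply, Nat.cast_add, mul_add, Finset.sum_add_distrib]
      exact ⟨fun i => add_nonneg (h1 i) (h3 i), fun j => add_pos_of_pos_of_nonneg (h2 j) (h4 j)⟩)
  exact ⟨N, v, P, hv, hP⟩

/-- The monomials of a power series ring are absolutely summable at points of the open unit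
polydisc. -/
lemma summable_prod_pow {r : ι → ℝ} (h0 : ∀ i, 0 ≤ r i) (h1 : ∀ i, r i < 1) :
    Summable fun e : ι →₀ ℕ => ∏ i, r i ^ e i := by
  classical
  refine summable_of_sum_le (c := ∏ i, (1 - r i)⁻¹)
    (fun e => Finset.prod_nonneg fun i _ => pow_nonneg (h0 i) _) fun s => ?_
  obtain ⟨M, hM⟩ : ∃ M : ℕ, ∀ e ∈ s, ∀ i, e i < M := by
    refine ⟨s.sup (fun e => e.degree) + 1, fun e he i => Nat.lt_succ_of_le ?_⟩
    exact (Finsupp.le_degree i e).trans (Finset.le_sup (f := fun e : ι →₀ ℕ => e.degree) he)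
  calc ∑ e ∈ s, ∏ i, r i ^ e i
      = ∑ e ∈ s.map (Finsupp.equivFunOnFinite.toEmbedding), ∏ i, r i ^ e i := by
        rw [Finset.sum_map]
        rfl
    _ ≤ ∑ e ∈ Fintype.piFinset fun _ => Finset.range M, ∏ i, r i ^ e i := by
        refine Finset.sum_le_sum_of_subset_of_nonneg ?_
          fun e _ _ => Finset.prod_nonneg fun i _ => pow_nonneg (h0 i) _
        intro e he
        obtain ⟨e', he', rfl⟩ := Finset.mem_map.1 he
        exact Fintype.mem_piFinset.2 fun i => Finset.mem_range.2 (hM e' he' i)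
    _ = ∏ i, ∑ m ∈ Finset.range M, r i ^ m :=
        (Finset.prod_univ_sum (fun _ => Finset.range M) fun i m => r i ^ m).symm
    _ ≤ ∏ i, (1 - r i)⁻¹ := by
        refine Finset.prod_le_prod (fun i _ => Finset.sum_nonneg fun m _ => pow_nonneg (h0 i) _)
          fun i _ => ?_
        rw [← tsum_geometric_of_lt_one (h0 i) (h1 i)]
        exact (summable_geometric_of_lt_one (h0 i) (h1 i)).sum_le_tsum _
          fun m _ => pow_nonneg (h0 i) _

/-- Multiplication of a convergent power series by a polynomial is compatible with evaluation. -/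
lemma hasSum_polynomial_mul {y : ι → ℂ} {L : MvPowerSeries ι ℚ} {V : ℂ}
    (hL : HasSum (fun e => ((MvPowerSeries.coeff e L : ℚ) : ℂ) * ∏ i, y i ^ e i) V)
    (Q : MvPolynomial ι ℚ) :
    HasSum (fun e => ((MvPowerSeries.coeff e ((Q : MvPowerSeries ι ℚ) * L) : ℚ) : ℂ) *
        ∏ i, y i ^ e i)
      (MvPolynomial.aeval y Q * V) := by
  classical
  induction Q using MvPolynomial.induction_on' with
  | monomial d c =>
    rw [MvPolynomial.coe_monomial, MvPolynomial.aeval_monomial]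
    have hinj : Function.Injective fun e : ι →₀ ℕ => d + e := add_right_injective d
    rw [← hinj.hasSum_iff]
    · refine (hL.mul_left ((algebraMap ℚ ℂ c) * d.prod fun i k => y i ^ k)).congr_fun fun e => ?_
      simp only [Function.comp, MvPowerSeries.coeff_add_monomial_mul, Rat.cast_mul, Finsupp.add_apply,
        pow_add, Finset.prod_mul_distrib]
      rw [Finsupp.prod_fintype _ _ (fun i => pow_zero _)]
      rw [eq_ratCast]
      ring
    · intro e he
      rw [MvPowerSeries.coeff_monomial_mul, if_neg, Rat.cast_zero, zero_mul]
      exact fun hde => he ⟨e - d, add_tsub_cancel_of_le hde⟩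
  | add p q hp hq =>
    rw [MvPolynomial.coe_add, add_mul, map_add, add_mul]
    refine (hp.add hq).congr_fun fun e => ?_
    rw [map_add, Rat.cast_add, add_mul]

lemma aeval_geomDenom_ne_zero {N : ℕ} {v : Fin N → ι →₀ ℕ} (hv : ∀ i, v i ≠ 0) {y : ι → ℂ}
    (hy : ∀ i, ‖y i‖ < 1) : MvPolynomial.aeval y (geomDenom v) ≠ 0 := by
  rw [geomDenom, map_prod, Finset.prod_ne_zero_iff]
  intro i _
  rw [map_sub, map_one, MvPolynomial.aeval_monomial, map_one, one_mul, sub_ne_zero,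
    Finsupp.prod_fintype _ _ (fun i => pow_zero _)]
  intro h
  have h1 : ∏ x, ‖y x‖ ^ v i x = 1 := by
    rw [← norm_one (α := ℂ), h, norm_prod]
    simp
  obtain ⟨x, hx⟩ := Finsupp.ne_iff.1 (hv i)
  refine absurd h1 (ne_of_lt ?_)
  calc ∏ x, ‖y x‖ ^ v i x ≤ ‖y x‖ ^ v i x := by
        classical
        rw [← Finset.mul_prod_erase _ _ (Finset.mem_univ x)]
        refine mul_le_of_le_one_right (by positivity) (Finset.prod_le_one (fun _ _ => by positivity)
          fun j _ => pow_le_one₀ (norm_nonneg _) (hy j).le)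
    _ < 1 := pow_lt_one₀ (norm_nonneg _) (hy x) hx

/-- The generating function of a rational half-open cone converges on the open unit polydisc to the
value of the rational function. -/
lemma exists_hasSum_of_halfOpen {d d' : ℕ} (φ : Fin d → ι → ℤ) (χ : Fin d' → ι → ℤ)
    {C : Set (ι → ℝ)}
    (hC : C = {ω | (∀ i, 0 ≤ ∑ x, (φ i x : ℝ) * ω x) ∧ ∀ j, 0 < ∑ x, (χ j x : ℝ) * ω x}) :
    ∃ P Q : MvPolynomial ι ℚ, Q ≠ 0 ∧
      (Q : MvPowerSeries ι ℚ) * latticeSeries C = (P : MvPowerSeries ι ℚ) ∧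
      ∀ y : ι → ℂ, (∀ i, ‖y i‖ < 1) → MvPolynomial.aeval y Q ≠ 0 ∧
        HasSum (fun e : ι →₀ ℕ => (latticeSeries C e : ℂ) * ∏ i, y i ^ e i)
          (MvPolynomial.aeval y P / MvPolynomial.aeval y Q) := by
  classical
  obtain ⟨N, v, P, hv, hP⟩ := exists_latticeSeries_eq φ χ hC
  have key : ∀ y : ι → ℂ, (∀ i, ‖y i‖ < 1) → MvPolynomial.aeval y (geomDenom v) ≠ 0 :=
    fun y hy => aeval_geomDenom_ne_zero hv hy
  refine ⟨P, geomDenom v, ?_, hP, fun y hy => ⟨key y hy, ?_⟩⟩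
  · intro h
    apply key 0 (by simp)
    rw [h, map_zero]
  have hs : Summable fun e : ι →₀ ℕ => (latticeSeries C e : ℂ) * ∏ i, y i ^ e i := by
    refine Summable.of_norm_bounded (summable_prod_pow (fun i => norm_nonneg (y i)) hy) fun e => ?_
    rw [norm_mul, norm_prod]
    simp only [norm_pow]
    refine mul_le_of_le_one_left (by positivity) ?_
    change ‖((if (fun i => (e i : ℝ)) ∈ C then 1 else 0 : ℚ) : ℂ)‖ ≤ 1
    split_ifs <;> simp
  obtain ⟨V, hV⟩ := hs
  have h1 := hasSum_polynomial_mul (L := latticeSeries C) hV (geomDenom v)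
  have h2 : HasSum (fun e => ((MvPowerSeries.coeff e (1 : MvPowerSeries ι ℚ) : ℚ) : ℂ) *
      ∏ i, y i ^ e i) 1 := by
    convert hasSum_ite_eq (0 : ι →₀ ℕ) (1 : ℂ) using 2 with e
    rw [MvPowerSeries.coeff_one]
    split_ifs with h
    · simp [h]
    · simp
  have h3 := hasSum_polynomial_mul h2 P
  rw [mul_one, mul_one] at h3
  rw [hP] at h1
  rw [h3.unique h1, mul_div_cancel_left₀ _ (key y hy)]
  exact hV

end HalfOpenCones

/-! ### Values of rational functions -/

section RationalFunctions

variable {ι κ L : Type*} [Field L] [Algebra ℚ L]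

/-- `F` can be written as a fraction (not necessarily in lowest terms) whose denominator does not
vanish at `y` and whose value at `y` is `v`. -/
def RatFun.HasValue (F : RatFun ι) (y : ι → L) (v : L) : Prop :=
  ∃ P Q : MvPolynomial ι ℚ, MvPolynomial.aeval y Q ≠ 0 ∧
    F * algebraMap (MvPolynomial ι ℚ) (RatFun ι) Q = algebraMap (MvPolynomial ι ℚ) (RatFun ι) P ∧
    v * MvPolynomial.aeval y Q = MvPolynomial.aeval y P

namespace RatFun.HasValue

variable {F G : RatFun ι} {y : ι → L} {v w : L}

/-- Passing to lowest terms: the reduced denominator divides every other denominator. -/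
lemma isRegularAt_and_eval (h : F.HasValue y v) : F.IsRegularAt y ∧ F.eval y = v := by
  obtain ⟨P, Q, hQ, hF, hv⟩ := h
  set a := IsFractionRing.num (MvPolynomial ι ℚ) F with ha
  set b := (IsFractionRing.den (MvPolynomial ι ℚ) F : MvPolynomial ι ℚ) with hb
  have hb0 : b ≠ 0 := nonZeroDivisors.ne_zero (IsFractionRing.den (MvPolynomial ι ℚ) F).2
  have hFab : F * algebraMap (MvPolynomial ι ℚ) (RatFun ι) b =
      algebraMap (MvPolynomial ι ℚ) (RatFun ι) a := by
    conv_lhs => rw [← IsFractionRing.mk'_num_den' (MvPolynomial ι ℚ) F]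
    rw [div_mul_cancel₀]
    rwa [Ne, FaithfulSMul.algebraMap_eq_zero_iff]
  have hcross : a * Q = P * b := by
    apply FaithfulSMul.algebraMap_injective (MvPolynomial ι ℚ) (RatFun ι)
    rw [map_mul, map_mul, ← hFab, ← hF]
    ring
  have hrel : IsRelPrime b a := (IsFractionRing.num_den_reduced (MvPolynomial ι ℚ) F).symm
  obtain ⟨R, rfl⟩ : b ∣ Q := hrel.dvd_of_dvd_mul_left (hcross ▸ dvd_mul_left b P)
  have hP : P = a * R := by
    apply mul_right_cancel₀ hb0
    rw [← hcross]
    ring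
  rw [map_mul] at hQ
  have hb' := left_ne_zero_of_mul hQ
  have hR' := right_ne_zero_of_mul hQ
  refine ⟨hb', ?_⟩
  rw [RatFun.eval, div_eq_iff hb']
  apply mul_right_cancel₀ hR'
  rw [← map_mul, ← hP, ← hv, map_mul]
  ring

lemma eval_eq (h : F.HasValue y v) : F.eval y = v := h.isRegularAt_and_eval.2

lemma unique (h : F.HasValue y v) (h' : F.HasValue y w) : v = w := h.eval_eq.symm.trans h'.eval_eq

lemma of_algebraMap (P : MvPolynomial ι ℚ) (y : ι → L) :
    (algebraMap (MvPolynomial ι ℚ) (RatFun ι) P).HasValue y (MvPolynomial.aeval y P) :=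
  ⟨P, 1, by simp, by simp, by simp⟩

lemma var (i : ι) (y : ι → L) : (RatFun.var i).HasValue y (y i) := by
  simpa [RatFun.var] using of_algebraMap (MvPolynomial.X i) y

lemma zero (y : ι → L) : (0 : RatFun ι).HasValue y 0 := by
  simpa using of_algebraMap (0 : MvPolynomial ι ℚ) y

lemma one (y : ι → L) : (1 : RatFun ι).HasValue y 1 := by
  simpa using of_algebraMap (1 : MvPolynomial ι ℚ) y

lemma add (h : F.HasValue y v) (h' : G.HasValue y w) : (F + G).HasValue y (v + w) := by
  obtain ⟨P, Q, hQ, hF, hv⟩ := h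
  obtain ⟨P', Q', hQ', hG, hw⟩ := h'
  refine ⟨P * Q' + P' * Q, Q * Q', ?_, ?_, ?_⟩
  · rw [map_mul]
    exact mul_ne_zero hQ hQ'
  · rw [map_add, map_mul, map_mul, map_mul, ← hF, ← hG]
    ring
  · rw [map_add, map_mul, map_mul, map_mul, ← hv, ← hw]
    ring

lemma mul (h : F.HasValue y v) (h' : G.HasValue y w) : (F * G).HasValue y (v * w) := by
  obtain ⟨P, Q, hQ, hF, hv⟩ := h
  obtain ⟨P', Q', hQ', hG, hw⟩ := h'
  refine ⟨P * P', Q * Q', ?_, ?_, ?_⟩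
  · rw [map_mul]
    exact mul_ne_zero hQ hQ'
  · rw [map_mul, map_mul, ← hF, ← hG]
    ring
  · rw [map_mul, map_mul, ← hv, ← hw]
    ring

lemma sub_one (h : F.HasValue y v) : (F - 1).HasValue y (v - 1) := by
  have h1 := h.add (of_algebraMap (-1 : MvPolynomial ι ℚ) y)
  simpa [sub_eq_add_neg] using h1

lemma ne_zero (h : F.HasValue y v) (hv : v ≠ 0) : F ≠ 0 := by
  rintro rfl
  exact hv (h.unique (zero y))

lemma inv (h : F.HasValue y v) (hv : v ≠ 0) : F⁻¹.HasValue y v⁻¹ := by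
  have hF0 := h.ne_zero hv
  obtain ⟨P, Q, hQ, hF, hv'⟩ := h
  refine ⟨Q, P, ?_, ?_, ?_⟩
  · rw [← hv']
    exact mul_ne_zero hv hQ
  · rw [← hF, inv_mul_cancel_left₀ hF0]
  · rw [← hv', inv_mul_cancel_left₀ hv]

lemma pow (h : F.HasValue y v) (k : ℕ) : (F ^ k).HasValue y (v ^ k) := by
  induction k with
  | zero => simpa using one y
  | succ k ih => simpa only [pow_succ] using ih.mul h

lemma zpow (h : F.HasValue y v) (hv : v ≠ 0) (k : ℤ) : (F ^ k).HasValue y (v ^ k) := by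
  cases k with
  | ofNat k => simpa using h.pow k
  | negSucc k => simpa [zpow_negSucc] using (h.pow (k + 1)).inv (pow_ne_zero _ hv)

lemma prod {α : Type*} (s : Finset α) {F : α → RatFun ι} {v : α → L}
    (h : ∀ a ∈ s, (F a).HasValue y (v a)) : (∏ a ∈ s, F a).HasValue y (∏ a ∈ s, v a) := by
  classical
  induction s using Finset.induction_on with
  | empty => simpa using one y
  | insert a s ha ih =>
    rw [Finset.prod_insert ha, Finset.prod_insert ha]
    exact (h a (Finset.mem_insert_self a s)).mul
      (ih fun b hb => h b (Finset.mem_insert_of_mem hb))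

lemma aeval {G : ι → RatFun κ} {z : κ → L} {w : ι → L} (h : ∀ i, (G i).HasValue z (w i))
    (P : MvPolynomial ι ℚ) :
    RatFun.HasValue (MvPolynomial.aeval G P) z (MvPolynomial.aeval w P) := by
  induction P using MvPolynomial.induction_on with
  | C a =>
    have h1 := of_algebraMap (MvPolynomial.C a) z
    rw [MvPolynomial.aeval_C] at h1
    rw [MvPolynomial.aeval_C, MvPolynomial.aeval_C]
    convert h1
    rw [eq_ratCast, ← RingHom.comp_apply, eq_ratCast]
  | add p q hp hq => simpa only [map_add] using hp.add hq
  | mul_X p i hp => simpa only [map_mul, MvPolynomial.aeval_X] using hp.mul (h i)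

/-- Substituting rational functions into a rational function. -/
lemma comp {G : ι → RatFun κ} {z : κ → L} {w : ι → L} (h : F.HasValue w v)
    (hG : ∀ i, (G i).HasValue z (w i)) : RatFun.HasValue (F.eval G) z v := by
  obtain ⟨P, Q, hQ, hF, hv⟩ := h
  have hQG := aeval hG Q
  have hQ0 := hQG.ne_zero hQ
  have hev : F.eval G = MvPolynomial.aeval G P * (MvPolynomial.aeval G Q)⁻¹ :=
    eval_eq ⟨P, Q, hQ0, hF, inv_mul_cancel_right₀ hQ0 _⟩
  rw [hev, ← mul_inv_cancel_right₀ hQ v, hv]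
  exact (aeval hG P).mul (hQG.inv hQ)

end RatFun.HasValue

/-- The generating function takes the same values as every fraction expanding to the series of
lattice points. -/
lemma hasValue_genFun {C : Set (ι → ℝ)} {P Q : MvPolynomial ι ℚ} (hQ0 : Q ≠ 0)
    (hPQ : (Q : MvPowerSeries ι ℚ) * latticeSeries C = (P : MvPowerSeries ι ℚ)) {y : ι → L}
    (hQ : MvPolynomial.aeval y Q ≠ 0) :
    (genFun C).HasValue y (MvPolynomial.aeval y P / MvPolynomial.aeval y Q) := by
  have hinj := FaithfulSMul.algebraMap_injective (MvPolynomial ι ℚ) (RatFun ι)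
  have hex : ∃ F, IsGenFun C F := ⟨_, P, Q, hQ0, rfl, hPQ⟩
  have hgen : IsGenFun C (genFun C) := by
    rw [genFun, dif_pos hex]
    exact hex.choose_spec
  obtain ⟨P', Q', hQ0', hF, hPQ'⟩ := hgen
  have hcross : P * Q' = P' * Q := by
    apply MvPolynomial.coe_injective ι ℚ
    rw [MvPolynomial.coe_mul, MvPolynomial.coe_mul, ← hPQ, ← hPQ']
    ring
  refine ⟨P, Q, hQ, ?_, div_mul_cancel₀ _ hQ⟩
  rw [hF, div_mul_eq_mul_div, div_eq_iff (by rwa [Ne, FaithfulSMul.algebraMap_eq_zero_iff]),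
    ← map_mul, ← map_mul, hcross]

end RationalFunctions

section ValueOfW

variable {k : Type*} [Field k] {n r : ℕ} (T : ToricDatum k n r)

/-- The cone `C₀^J` as a set cut out by integral linear inequalities in `ℝⁿ × ℝ^J`. -/
lemma ToricDatum.exists_coneJ_eq (γ : Fin r → Fin n → ℤ) (J : Finset (Fin r)) :
    ∃ (d d' : ℕ) (φ : Fin d → Fin n ⊕ J → ℤ) (χ : Fin d' → Fin n ⊕ J → ℤ),
      T.coneJ γ J = {ω | (∀ i, 0 ≤ ∑ x, (φ i x : ℝ) * ω x) ∧ ∀ j, 0 < ∑ x, (χ j x : ℝ) * ω x} := by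
  classical
  obtain ⟨d, e, φ, χ, hC⟩ := T.isCone
  let φ' : (Fin d ⊕ Fin n) ⊕ Fin r → Fin n ⊕ J → ℤ := Sum.elim
    (Sum.elim (fun i => Sum.elim (φ i) 0) fun i => Sum.elim (Pi.single i 1) 0)
    fun i => Sum.elim (γ i) fun j => if (j : Fin r) = i then 1 else 0
  let χ' : Fin e ⊕ J → Fin n ⊕ J → ℤ :=
    Sum.elim (fun i => Sum.elim (χ i) 0) fun j => Sum.elim 0 (Pi.single j 1)
  refine ⟨_, _, φ' ∘ (Fintype.equivFin _).symm, χ' ∘ (Fintype.equivFin _).symm, ?_⟩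
  ext ω
  have h1 : ∀ p : (Fin d ⊕ Fin n) ⊕ Fin r → Prop,
      (∀ i, p ((Fintype.equivFin _).symm i)) ↔ ∀ i, p i :=
    fun p => ⟨fun h i => by simpa using h (Fintype.equivFin _ i), fun h i => h _⟩
  have h2 : ∀ p : Fin e ⊕ J → Prop, (∀ i, p ((Fintype.equivFin _).symm i)) ↔ ∀ i, p i :=
    fun p => ⟨fun h i => by simpa using h (Fintype.equivFin _ i), fun h i => h _⟩
  rw [ToricDatum.coneJ, Set.mem_ofPred_eq, Set.mem_ofPred_eq, hC]
  simp only [Function.comp_apply]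
  rw [h1 fun i => 0 ≤ ∑ x, (φ' i x : ℝ) * ω x, h2 fun i => 0 < ∑ x, (χ' i x : ℝ) * ω x]
  simp only [φ', χ', Sum.forall, Fintype.sum_sum_type, Sum.elim_inl, Sum.elim_inr, Pi.zero_apply,
    Int.cast_zero, zero_mul, Finset.sum_const_zero, add_zero, zero_add, Pi.single_apply,
    Int.cast_ite, Int.cast_one, ite_mul, one_mul, Finset.sum_ite_eq', Finset.mem_univ, if_true,
    Set.mem_ofPred_eq, pairing, Function.comp_apply]
  tauto

/-- The value of `W_J` at a point `(q, t₁, …, t_m)` with `|q| > 1` and `|t_l| ≤ 1`, as a sum over the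
lattice points of `C₀^J`. -/
lemma ToricDatum.exists_hasValue_W (τ : Set (Fin n → ℝ)) (γ : Fin r → Fin n → ℤ) {m : ℕ}
    (β : Matrix (Fin m) (Fin n) ℕ) (J : Finset (Fin r)) {z : Fin (m + 1) → ℂ} (h0 : 1 < ‖z 0‖)
    (hz : ∀ l : Fin m, ‖z l.succ‖ ≤ 1) :
    ∃ V : ℂ, HasSum (fun e : Fin n ⊕ J →₀ ℕ => (latticeSeries (T.coneJ γ J) e : ℂ) *
        ∏ a, ((z 0)⁻¹ * ∏ l : Fin m, z l.succ ^ matA β J a l.succ) ^ e a) V ∧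
      (T.W τ γ β J).HasValue z (z 0 ^ (-(n : ℤ)) *
        (z 0 - 1) ^ ((n : ℤ) - (polyDim τ : ℤ) + (J.card : ℤ)) * V) := by
  obtain ⟨d, d', φ, χ, hC⟩ := T.exists_coneJ_eq γ J
  obtain ⟨P, Q, hQ0, hPQ, hsum⟩ := exists_hasSum_of_halfOpen φ χ hC
  have hz0 : z 0 ≠ 0 := by
    rintro h
    rw [h, norm_zero] at h0
    linarith
  have hz1 : z 0 - 1 ≠ 0 := by
    rw [sub_ne_zero]
    rintro h
    rw [h, norm_one] at h0
    exact lt_irrefl _ h0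
  set w : Fin n ⊕ J → ℂ := fun a => (z 0)⁻¹ * ∏ l : Fin m, z l.succ ^ matA β J a l.succ with hw
  have hw1 : ∀ a, ‖w a‖ < 1 := by
    intro a
    rw [hw]
    simp only [norm_mul, norm_inv, norm_prod, norm_pow]
    calc _ ≤ ‖z 0‖⁻¹ * 1 := by
          gcongr
          exact Finset.prod_le_one (fun _ _ => by positivity)
            fun l _ => pow_le_one₀ (norm_nonneg _) (hz l)
      _ < 1 := by
        rw [mul_one]
        exact inv_lt_one_of_one_lt₀ h0
  obtain ⟨hQ, hV⟩ := hsum w hw1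
  refine ⟨_, hV, ?_⟩
  have hgen := hasValue_genFun hQ0 hPQ hQ
  set y : Fin (m + 1) → ℂ := Fin.cons (z 0)⁻¹ fun l => z l.succ with hy
  have hsubst : (monomialSubst (matA β J) (genFun (T.coneJ γ J))).HasValue y
      (MvPolynomial.aeval w P / MvPolynomial.aeval w Q) := by
    refine hgen.comp fun a => ?_
    have : w a = ∏ l, y l ^ matA β J a l := by
      rw [Fin.prod_univ_succ]
      simp [hw, hy, matA]
    rw [this]
    exact RatFun.HasValue.prod _ fun l _ => (RatFun.HasValue.var l y).pow _
  have hinner : ((monomialSubst (matA β J) (genFun (T.coneJ γ J))).eval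
      (Fin.cons (RatFun.var 0)⁻¹ fun l : Fin m => RatFun.var l.succ : Fin (m + 1) →
        RatFun (Fin (m + 1)))).HasValue z (MvPolynomial.aeval w P / MvPolynomial.aeval w Q) := by
    refine hsubst.comp fun l => ?_
    refine Fin.cases ?_ (fun l => ?_) l
    · simpa [hy] using (RatFun.HasValue.var 0 z).inv hz0
    · simpa [hy] using RatFun.HasValue.var l.succ z
  exact (((RatFun.HasValue.var 0 z).zpow hz0 _).mul
    ((RatFun.HasValue.var 0 z).sub_one.zpow hz1 _)).mul hinner

end ValueOfW

/-! ### Evaluation of Laurent polynomials at units -/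

section Evaluation

variable {R R' A A' : Type*} [CommRing R] [CommRing R'] [CommRing A] [CommRing A'] {n : ℕ}

/-- The character `α ↦ x^α` of `ℤⁿ` attached to an `n`-tuple of units. -/
def unitMonomial (x : Fin n → Aˣ) : Multiplicative (Fin n → ℤ) →* Aˣ where
  toFun α := ∏ i, x i ^ (Multiplicative.toAdd α) i
  map_one' := by simp
  map_mul' α β := by simp [zpow_add, Finset.prod_mul_distrib]

/-- Evaluation of Laurent polynomials over `R` at a tuple of units of an `R`-algebra. -/
def evalHom (φ : R →+* A) (x : Fin n → Aˣ) : Laurent R n →+* A :=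
  AddMonoidAlgebra.liftNCRingHom φ ((Units.coeHom A).comp (unitMonomial x))
    fun _ _ => Commute.all _ _

lemma evalHom_single (φ : R →+* A) (x : Fin n → Aˣ) (α : Fin n → ℤ) (c : R) :
    evalHom φ x (AddMonoidAlgebra.single α c) = φ c * ((∏ i, x i ^ α i : Aˣ) : A) := by
  rw [evalHom, AddMonoidAlgebra.liftNCRingHom_single]
  rfl

lemma evalHom_eq_sum (φ : R →+* A) (x : Fin n → Aˣ) (f : Laurent R n) :
    evalHom φ x f = f.coeff.sum fun α c => φ c * ((∏ i, x i ^ α i : Aˣ) : A) := by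
  conv_lhs => rw [← AddMonoidAlgebra.sum_coeff_single f]
  rw [Finsupp.sum, map_sum]
  simp only [evalHom_single]
  rfl

lemma evalHom_map (ψ : R →+* R') (φ : R' →+* A) (x : Fin n → Aˣ) (f : Laurent R n) :
    evalHom φ x (AddMonoidAlgebra.mapRingHom _ ψ f) = evalHom (φ.comp ψ) x f := by
  induction f using AddMonoidAlgebra.induction_linear with
  | zero => simp
  | add f g hf hg => simp only [map_add, hf, hg]
  | single α c => rw [AddMonoidAlgebra.mapRingHom_single, evalHom_single, evalHom_single]; rfl

lemma map_evalHom (σ : A →+* A') (φ : R →+* A) (x : Fin n → Aˣ) (f : Laurent R n) :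
    σ (evalHom φ x f) = evalHom (σ.comp φ) (fun i => Units.map (σ : A →* A') (x i)) f := by
  induction f using AddMonoidAlgebra.induction_linear with
  | zero => simp
  | add f g hf hg => simp only [map_add, hf, hg]
  | single α c =>
    rw [evalHom_single, evalHom_single, map_mul]
    congr 1
    rw [← MonoidHom.coe_coe, ← Units.coe_map, map_prod]
    simp only [map_zpow]

/-- A ring homomorphism out of a ring of Laurent polynomials is evaluation at the images of the
variables. -/
lemma eq_evalHom (ψ : Laurent R n →+* A) {φ : R →+* A} {u : Fin n → Aˣ}
    (hu : ∀ i, ψ (AddMonoidAlgebra.single (Pi.single i 1) 1) = u i)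
    (hφ : ∀ c, ψ (AddMonoidAlgebra.single 0 c) = φ c) (f : Laurent R n) :
    ψ f = evalHom φ u f := by
  let g : Multiplicative (Fin n → ℤ) →* Aˣ :=
    ((ψ : Laurent R n →* A).comp (AddMonoidAlgebra.of R (Fin n → ℤ))).toHomUnits
  have hg : ∀ α : Fin n → ℤ, g (Multiplicative.ofAdd α) = ∏ i, u i ^ α i := by
    intro α
    have h1 : Multiplicative.ofAdd α =
        ∏ i, (Multiplicative.ofAdd (Pi.single i 1 : Fin n → ℤ)) ^ α i := by
      apply Multiplicative.toAdd.injective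
      rw [toAdd_prod]
      simp only [toAdd_zpow, toAdd_ofAdd]
      conv_lhs => rw [← Finset.univ_sum_single α]
      refine Finset.sum_congr rfl fun i _ => ?_
      rw [← Pi.single_smul, smul_eq_mul, mul_one]
    rw [h1, map_prod]
    refine Finset.prod_congr rfl fun i _ => ?_
    rw [map_zpow]
    congr 1
    exact Units.ext (hu i)
  induction f using AddMonoidAlgebra.induction_linear with
  | zero => simp
  | add f g hf hg => simp only [map_add, hf, hg]
  | single α c =>
    have h2 : (AddMonoidAlgebra.single α c : Laurent R n) =
        AddMonoidAlgebra.single 0 c * AddMonoidAlgebra.single α 1 := by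
      rw [AddMonoidAlgebra.single_mul_single, zero_add, mul_one]
    rw [evalHom_single, ← hg, h2, map_mul, hφ]
    rfl

/-- The formal partial derivative `∂f/∂Xᵢ` of a Laurent polynomial over a commutative ring. -/
def pderiv (i : Fin n) : Laurent R n →+ Laurent R n where
  toFun f := f.coeff.sum fun α c => AddMonoidAlgebra.single (α - Pi.single i 1) ((α i : R) * c)
  map_zero' := by simp
  map_add' f g := by
    rw [AddMonoidAlgebra.coeff_add]
    exact Finsupp.sum_add_index' (fun α => by simp) (fun α c d => by simp [mul_add])

lemma pderiv_single (i : Fin n) (α : Fin n → ℤ) (c : R) :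
    pderiv i (AddMonoidAlgebra.single α c) =
      AddMonoidAlgebra.single (α - Pi.single i 1) ((α i : R) * c) := by
  change (AddMonoidAlgebra.single α c).coeff.sum (fun α c =>
    (AddMonoidAlgebra.single (α - Pi.single i 1) ((α i : R) * c) : Laurent R n)) = _
  rw [AddMonoidAlgebra.coeff_single, Finsupp.sum_single_index (by simp)]

lemma map_pderiv (ψ : R →+* R') (i : Fin n) (f : Laurent R n) :
    AddMonoidAlgebra.mapRingHom _ ψ (pderiv i f) = pderiv i (AddMonoidAlgebra.mapRingHom _ ψ f) := by
  induction f using AddMonoidAlgebra.induction_linear with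
  | zero => simp
  | add f g hf hg => simp only [map_add, hf, hg]
  | single α c => simp [pderiv_single]

lemma evalHom_pderiv_single (φ : R →+* A) (x : Fin n → Aˣ) (i : Fin n) (α : Fin n → ℤ) (c : R) :
    evalHom φ x (pderiv i (AddMonoidAlgebra.single α c)) =
      φ c * ((∏ j, x j ^ α j : Aˣ) : A) * (α i : A) * (((x i)⁻¹ : Aˣ) : A) := by
  have h : (∏ j, x j ^ (α - Pi.single i 1 : Fin n → ℤ) j) = (∏ j, x j ^ α j) * (x i)⁻¹ := by
    simp only [Pi.sub_apply, zpow_sub, Finset.prod_mul_distrib]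
    congr 1
    rw [Finset.prod_eq_single i]
    · simp
    · intro j _ hj
      simp [hj]
    · simp
  rw [pderiv_single, evalHom_single, h, map_mul, map_intCast, Units.val_mul]
  ring

lemma laurentEval_eq_evalHom {k L : Type*} [Field k] [Field L] (φ : k →+* L) {u : Fin n → L}
    (hu : ∀ i, u i ≠ 0) (f : Laurent k n) :
    laurentEval φ u f = evalHom φ (fun i => Units.mk0 (u i) (hu i)) f := by
  rw [evalHom_eq_sum, laurentEval]
  refine Finsupp.sum_congr fun α _ => ?_
  simp [Units.coe_prod]

/-- A Laurent polynomial all of whose coefficients lie in a subring comes from that subring. -/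
lemma exists_lift_subring {k : Type*} [Field k] (S : Subring k) {f : Laurent k n}
    (hf : ∀ α, f.coeff α ∈ S) : ∃ f' : Laurent S n, AddMonoidAlgebra.mapRingHom _ S.subtype f' = f := by
  have : f ∈ Set.range (AddMonoidAlgebra.map (M := Fin n → ℤ) (S.subtype : S →+ k)) := by
    rw [AddMonoidAlgebra.range_map]
    exact fun α => ⟨⟨_, hf α⟩, rfl⟩
  exact this

lemma mapRingHom_subtype_injective {k : Type*} [Field k] (S : Subring k) :
    Function.Injective (AddMonoidAlgebra.mapRingHom (Fin n → ℤ) S.subtype) :=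
  AddMonoidAlgebra.map_injective (S.subtype : S →+ k) Subtype.val_injective

end Evaluation

/-! ### Spreading out regularity by the Nullstellensatz -/

section Nullstellensatz

variable {k : Type*} [Field k] {n r : ℕ}

/-- A matrix of full column rank has a non-vanishing maximal minor. -/
lemma exists_minor_ne_zero {L m : Type*} [Field L] [Fintype m] [DecidableEq m] (M : Matrix (Fin n) m L)
    (hM : M.rank = Fintype.card m) : ∃ e : m → Fin n, (M.submatrix e id).det ≠ 0 := by
  rw [Matrix.rank_eq_finrank_span_row] at hM
  obtain ⟨f, hf, -, hli⟩ := Submodule.exists_fun_fin_finrank_span_eq L (Set.range M.row)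
  choose g hg using hf
  let σ : m ≃ Fin (Module.finrank L (Submodule.span L (Set.range M.row))) :=
    Fintype.equivOfCardEq (by rw [hM, Fintype.card_fin])
  refine ⟨g ∘ σ, ?_⟩
  rw [← isUnit_iff_ne_zero, ← Matrix.isUnit_iff_isUnit_det, ← Matrix.linearIndependent_rows_iff_isUnit]
  have : (M.submatrix (g ∘ σ) id).row = f ∘ σ := by
    funext a
    exact hg (σ a)
  rw [this]
  exact hli.comp σ σ.injective

/-- The maximal minor of the Jacobian matrix of `F j`, `j ∈ J`, given by the variables `e j`. -/
def jacobianMinor {R : Type*} [CommRing R] (F : Fin r → Laurent R n) (J : Finset (Fin r))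
    (e : J → Fin n) : Laurent R n :=
  (Matrix.of fun a b : J => pderiv (e a) (F b)).det

/-- The Nullstellensatz for Laurent polynomials: regularity at all geometric points means that the
equations and the maximal minors of their Jacobian matrix generate the unit ideal. -/
lemma span_jacobianMinor_eq_top (F : Fin r → Laurent k n) (J : Finset (Fin r))
    (hreg : ∀ u : Fin n → AlgebraicClosure k, (∀ i, u i ≠ 0) →
      (∀ j ∈ J, laurentEval (algebraMap k (AlgebraicClosure k)) u (F j) = 0) →
      (Matrix.of fun (i : Fin n) (j : J) =>
        laurentEval (algebraMap k (AlgebraicClosure k)) u (laurentDeriv i (F j))).rank = J.card) :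
    Ideal.span (Set.range (Sum.elim (fun j : J => F j) (jacobianMinor F J))) = ⊤ := by
  classical
  by_contra htop
  obtain ⟨M, hM, hle⟩ := Ideal.exists_le_maximal _ htop
  let κ := Laurent k n ⧸ M
  let : Field κ := Ideal.Quotient.field M
  have : Algebra.FiniteType k κ := Algebra.FiniteType.of_surjective (Ideal.Quotient.mkₐ k M)
    (Ideal.Quotient.mkₐ_surjective k M)
  have : Module.Finite k κ := finite_of_finite_type_of_isJacobsonRing k κ
  let ψ : Laurent k n →ₐ[k] AlgebraicClosure k :=
    (IsAlgClosed.lift : κ →ₐ[k] AlgebraicClosure k).comp (Ideal.Quotient.mkₐ k M)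
  have hψ : ∀ f ∈ M, ψ f = 0 := by
    intro f hf
    have : Ideal.Quotient.mkₐ k M f = 0 := Ideal.Quotient.eq_zero_iff_mem.2 hf
    simp only [ψ, AlgHom.comp_apply, this, map_zero]
  have hunit : ∀ i : Fin n, IsUnit (AddMonoidAlgebra.single (Pi.single i 1) 1 : Laurent k n) := by
    intro i
    refine IsUnit.of_mul_eq_one (AddMonoidAlgebra.single (-Pi.single i 1) 1) ?_
    rw [AddMonoidAlgebra.single_mul_single, add_neg_cancel, mul_one]
    rfl
  let u : Fin n → (AlgebraicClosure k)ˣ :=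
    fun i => Units.map (ψ : Laurent k n →* AlgebraicClosure k) (hunit i).unit
  have hψu : ∀ f, ψ f = evalHom (algebraMap k (AlgebraicClosure k)) u f :=
    eq_evalHom (ψ : Laurent k n →+* AlgebraicClosure k) (fun i => rfl) ψ.commutes
  have hu0 : ∀ i, ((u i : AlgebraicClosure k)) ≠ 0 := fun i => (u i).ne_zero
  have hev : ∀ f, laurentEval (algebraMap k (AlgebraicClosure k))
      (fun i => (u i : AlgebraicClosure k)) f = ψ f := by
    intro f
    rw [hψu, laurentEval_eq_evalHom _ hu0]
    congr
    funext i
    ext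
    rfl
  have hmem : ∀ x, Sum.elim (fun j : J => F j) (jacobianMinor F J) x ∈ M :=
    fun x => hle (Ideal.subset_span ⟨x, rfl⟩)
  have hrank := hreg (fun i => (u i : AlgebraicClosure k)) hu0 fun j hj => by
    rw [hev]
    exact hψ _ (hmem (Sum.inl ⟨j, hj⟩))
  rw [← Fintype.card_coe] at hrank
  obtain ⟨e, he⟩ := exists_minor_ne_zero _ hrank
  apply he
  have h0 := hψ _ (hmem (Sum.inr e))
  rw [Sum.elim_inr, jacobianMinor, AlgHom.map_det] at h0
  rw [← h0]
  congr 1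
  ext a b
  exact hev _

/-- The condition on a subring `S ⊆ k` under which the Nullstellensatz certificate for `J` has
coefficients in `S`, so that regularity persists after every ring homomorphism from `S` to a field. -/
lemma exists_finset_minor (F : Fin r → Laurent k n) (J : Finset (Fin r))
    (htop : Ideal.span (Set.range (Sum.elim (fun j : J => F j) (jacobianMinor F J))) = ⊤) :
    ∃ s : Finset (Laurent k n), ∀ S : Subring k, (∀ g ∈ s, ∀ α, g.coeff α ∈ S) →
      ∀ (F' : Fin r → Laurent S n), (∀ j, AddMonoidAlgebra.mapRingHom _ S.subtype (F' j) = F j) →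
      ∀ {κ : Type*} [Field κ] (ρ : S →+* κ) (u : Fin n → κˣ), (∀ j ∈ J, evalHom ρ u (F' j) = 0) →
      ∃ e : J → Fin n, (Matrix.of fun a b : J => evalHom ρ u (pderiv (e a) (F' b))).det ≠ 0 := by
  classical
  have h1 : (1 : Laurent k n) ∈
      Ideal.span (Set.range (Sum.elim (fun j : J => F j) (jacobianMinor F J))) := by
    rw [htop]
    trivial
  -- The coefficients of the certificate `1 = ∑ c_x f_x + ∑ c_e det_e` are the elements of `s`.
  obtain ⟨c, hc⟩ := (Ideal.mem_span_range_iff_exists_fun).1 h1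
  refine ⟨Finset.univ.image c, fun S hS F' hF' κ _ ρ u hu => ?_⟩
  have hlift : ∀ x, ∃ f' : Laurent S n, AddMonoidAlgebra.mapRingHom _ S.subtype f' = c x :=
    fun x => exists_lift_subring S (hS _ (Finset.mem_image_of_mem _ (Finset.mem_univ x)))
  choose c' hc' using hlift
  have hminor : ∀ e, AddMonoidAlgebra.mapRingHom _ S.subtype (jacobianMinor F' J e) =
      jacobianMinor F J e := by
    intro e
    rw [jacobianMinor, RingHom.map_det, jacobianMinor]
    congr 1
    ext1 a b
    simp only [RingHom.mapMatrix_apply, Matrix.map_apply, Matrix.of_apply, map_pderiv, hF']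
  have hcert : ∑ x, c' x * Sum.elim (fun j : J => F' j) (jacobianMinor F' J) x = 1 := by
    apply mapRingHom_subtype_injective S
    rw [map_sum, map_one, ← hc]
    refine Finset.sum_congr rfl fun x _ => ?_
    rw [map_mul, hc']
    congr 1
    cases x with
    | inl j => exact hF' j
    | inr e => exact hminor e
  by_contra! hall
  have h0 : evalHom ρ u (∑ x, c' x * Sum.elim (fun j : J => F' j) (jacobianMinor F' J) x) = 0 := by
    rw [map_sum]
    refine Finset.sum_eq_zero fun x _ => ?_
    rw [map_mul]
    cases x with
    | inl j => rw [Sum.elim_inl, hu j j.2, mul_zero]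
    | inr e =>
      rw [Sum.elim_inr, jacobianMinor, RingHom.map_det]
      have := hall e
      rw [show (evalHom ρ u).mapMatrix (Matrix.of fun a b : J => pderiv (e a) (F' b)) =
        Matrix.of fun a b : J => evalHom ρ u (pderiv (e a) (F' b)) from rfl, this, mul_zero]
  rw [hcert, map_one] at h0
  exact one_ne_zero h0

end Nullstellensatz

/-! ### Initial forms and faces of Newton polytopes -/

section InitialForms

variable {k : Type*} [Field k] {n r : ℕ}

lemma mem_supp {f : Laurent k n} {α : Fin n → ℤ} : α ∈ supp f ↔ f.coeff α ≠ 0 :=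
  Finsupp.mem_support_iff

lemma pairing_add_left (α β : Fin n → ℤ) (ω : Fin n → ℝ) :
    pairing (α + β) ω = pairing α ω + pairing β ω := by
  simp [pairing, add_mul, Finset.sum_add_distrib]

open Classical in
lemma coeff_initForm (ω : Fin n → ℝ) (f : Laurent k n) (α : Fin n → ℤ) :
    (initForm ω f).coeff α =
      if ∀ α' ∈ supp f, pairing α ω ≤ pairing α' ω then f.coeff α else 0 := by
  rw [initForm, AddMonoidAlgebra.coeff_ofCoeff, Finsupp.filter_apply]

lemma mem_supp_initForm {ω : Fin n → ℝ} {f : Laurent k n} {α : Fin n → ℤ} :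
    α ∈ supp (initForm ω f) ↔ α ∈ supp f ∧ ∀ α' ∈ supp f, pairing α ω ≤ pairing α' ω := by
  classical
  rw [mem_supp, coeff_initForm, mem_supp]
  split_ifs with h
  · exact ⟨fun h' => ⟨h', h⟩, fun h' => h'.1⟩
  · simp [h]

lemma exists_mem_supp_initForm (ω : Fin n → ℝ) {f : Laurent k n} (hf : f ≠ 0) :
    ∃ α, α ∈ supp (initForm ω f) := by
  have hne : (supp f).Nonempty := by
    rw [supp, Finsupp.support_nonempty_iff]
    simpa using hf
  obtain ⟨α, hα, hmin⟩ := (supp f).exists_min_image (fun α => pairing α ω) hne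
  exact ⟨α, mem_supp_initForm.2 ⟨hα, hmin⟩⟩

/-- `f₀` consists of terms of weight `a`, and `f - f₀` of terms of larger weight. -/
def IsLeadingPart (ω : Fin n → ℝ) (a : ℝ) (f f₀ : Laurent k n) : Prop :=
  f₀ ≠ 0 ∧ (∀ α ∈ supp f₀, pairing α ω = a) ∧ ∀ α ∈ supp (f - f₀), a < pairing α ω

lemma isLeadingPart_initForm (ω : Fin n → ℝ) {f : Laurent k n} (hf : f ≠ 0) :
    ∃ a, IsLeadingPart ω a f (initForm ω f) := by
  classical
  obtain ⟨α, hα⟩ := exists_mem_supp_initForm ω hf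
  have hα' := mem_supp_initForm.1 hα
  refine ⟨pairing α ω, ?_, ?_, ?_⟩
  · rintro h
    rw [h] at hα
    simp [supp] at hα
  · intro β hβ
    have hβ' := mem_supp_initForm.1 hβ
    exact le_antisymm (hβ'.2 α hα'.1) (hα'.2 β hβ'.1)
  · intro β hβ
    rw [mem_supp, AddMonoidAlgebra.coeff_sub, Finsupp.sub_apply, coeff_initForm] at hβ
    split_ifs at hβ with h
    · simp at hβ
    · rw [sub_zero, ← mem_supp] at hβ
      refine lt_of_le_of_ne (hα'.2 β hβ) fun heq => h fun α' hα'' => ?_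
      rw [← heq]
      exact hα'.2 α' hα''

/-- The initial form is the only candidate for a leading part, for whatever weight. -/
lemma IsLeadingPart.initForm_eq {ω : Fin n → ℝ} {a : ℝ} {f f₀ : Laurent k n}
    (h : IsLeadingPart ω a f f₀) : initForm ω f = f₀ := by
  classical
  obtain ⟨h0, h1, h2⟩ := h
  have hc : ∀ α, pairing α ω = a → f.coeff α = f₀.coeff α := by
    intro α hα
    by_contra hne
    have := h2 α (mem_supp.2 (by
      rw [AddMonoidAlgebra.coeff_sub, Finsupp.sub_apply]
      exact sub_ne_zero.2 hne))
    linarith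
  have hge : ∀ α ∈ supp f, a ≤ pairing α ω := by
    intro α hα
    by_cases h : α ∈ supp (f - f₀)
    · exact (h2 α h).le
    · rw [mem_supp, not_not, AddMonoidAlgebra.coeff_sub, Finsupp.sub_apply, sub_eq_zero] at h
      rw [mem_supp, h, ← mem_supp] at hα
      exact (h1 α hα).ge
  obtain ⟨α₀, hα₀⟩ : ∃ α, α ∈ supp f₀ := by
    by_contra! hall
    exact h0 (by
      rw [← AddMonoidAlgebra.coeff_eq_zero]
      ext α
      simpa [mem_supp] using hall α)
  have hα₀f : α₀ ∈ supp f := by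
    rw [mem_supp, hc α₀ (h1 α₀ hα₀), ← mem_supp]
    exact hα₀
  rw [← AddMonoidAlgebra.coeff_inj]
  ext α
  rw [coeff_initForm]
  split_ifs with h
  · by_cases hα : α ∈ supp f
    · refine hc α (le_antisymm ?_ (hge α hα))
      rw [← h1 α₀ hα₀]
      exact h α₀ hα₀f
    · rw [mem_supp, not_not] at hα
      rw [hα]
      by_contra hne
      have hmem : α ∈ supp f₀ := mem_supp.2 (Ne.symm hne)
      rw [← hc α (h1 α hmem)] at hne
      exact hne hα.symm
  · by_contra hne
    have hmem : α ∈ supp f₀ := mem_supp.2 (Ne.symm hne)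
    exact h fun α' hα' => (h1 α hmem).le.trans (hge α' hα')

/-- Leading parts are multiplicative, as their product is non-zero. -/
lemma IsLeadingPart.mul {ω : Fin n → ℝ} {a b : ℝ} {f f₀ g g₀ : Laurent k n}
    (hf : IsLeadingPart ω a f f₀) (hg : IsLeadingPart ω b g g₀) :
    IsLeadingPart ω (a + b) (f * g) (f₀ * g₀) := by
  classical
  obtain ⟨f0, f1, f2⟩ := hf
  obtain ⟨g0, g1, g2⟩ := hg
  have hsupp : ∀ (p q : Laurent k n) (γ), γ ∈ supp (p * q) →
      ∃ α ∈ supp p, ∃ β ∈ supp q, α + β = γ := by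
    intro p q γ hγ
    exact Finset.mem_add.1 (AddMonoidAlgebra.support_coeff_mul_subset p q hγ)
  have hge : ∀ α ∈ supp g, b ≤ pairing α ω := by
    intro α hα
    by_cases h : α ∈ supp (g - g₀)
    · exact (g2 α h).le
    · rw [mem_supp, not_not, AddMonoidAlgebra.coeff_sub, Finsupp.sub_apply, sub_eq_zero] at h
      rw [mem_supp, h, ← mem_supp] at hα
      exact (g1 α hα).ge
  refine ⟨mul_ne_zero f0 g0, ?_, ?_⟩
  · intro γ hγ
    obtain ⟨α, hα, β, hβ, rfl⟩ := hsupp _ _ _ hγ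
    rw [pairing_add_left, f1 α hα, g1 β hβ]
  · intro γ hγ
    have hdec : f * g - f₀ * g₀ = f₀ * (g - g₀) + (f - f₀) * g := by ring
    rw [hdec, mem_supp, AddMonoidAlgebra.coeff_add, Finsupp.add_apply] at hγ
    have hor : γ ∈ supp (f₀ * (g - g₀)) ∨ γ ∈ supp ((f - f₀) * g) := by
      by_contra! h
      simp only [mem_supp, not_not] at h
      rw [h.1, h.2, add_zero] at hγ
      exact hγ rfl
    rcases hor with h | h
    · obtain ⟨α, hα, β, hβ, rfl⟩ := hsupp _ _ _ h
      rw [pairing_add_left, f1 α hα]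
      linarith [g2 β hβ]
    · obtain ⟨α, hα, β, hβ, rfl⟩ := hsupp _ _ _ h
      rw [pairing_add_left]
      linarith [f2 α hα, hge β hβ]

lemma initForm_prod (ω : Fin n → ℝ) (s : Finset (Fin r)) (f : Fin r → Laurent k n)
    (hf : ∀ i, f i ≠ 0) : initForm ω (∏ i ∈ s, f i) = ∏ i ∈ s, initForm ω (f i) := by
  classical
  have h : ∃ a, IsLeadingPart ω a (∏ i ∈ s, f i) (∏ i ∈ s, initForm ω (f i)) := by
    induction s using Finset.induction_on with
    | empty =>
      refine ⟨0, one_ne_zero, fun α hα => ?_, fun α hα => ?_⟩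
      · rw [Finset.prod_empty, mem_supp, AddMonoidAlgebra.one_def, AddMonoidAlgebra.coeff_single,
          Finsupp.single_apply] at hα
        have : α = 0 := by
          by_contra h
          exact hα (if_neg (Ne.symm h))
        simp [this, pairing]
      · rw [Finset.prod_empty, Finset.prod_empty, sub_self] at hα
        simp [supp] at hα
    | insert i s hi ih =>
      obtain ⟨a, ha⟩ := ih
      obtain ⟨b, hb⟩ := isLeadingPart_initForm ω (hf i)
      rw [Finset.prod_insert hi, Finset.prod_insert hi]
      exact ⟨_, hb.mul ha⟩
  obtain ⟨a, ha⟩ := h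
  exact ha.initForm_eq

/-- The face of the Newton polytope in direction `ω` is the Newton polytope of the initial form. -/
lemma face_newton (ω : Fin n → ℝ) (f : Laurent k n) :
    face ω (newton f) = newton (initForm ω f) := by
  classical
  let ι : (Fin n → ℤ) → Fin n → ℝ := fun α i => (α i : ℝ)
  have hpair : ∀ α, ι α ⬝ᵥ ω = pairing α ω := fun α => rfl
  have hsub : newton (initForm ω f) ⊆ newton f :=
    convexHull_mono (Set.image_mono fun α hα => (mem_supp_initForm.1 hα).1)
  by_cases hf : f = 0
  · subst hf
    have h0 : newton (0 : Laurent k n) = ∅ := by simp [newton, supp]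
    rw [h0] at hsub ⊢
    rw [Set.subset_empty_iff.1 hsub]
    simp [face]
  obtain ⟨a, hne, ha1, ha2⟩ := isLeadingPart_initForm ω hf
  obtain ⟨α₀, hα₀⟩ := exists_mem_supp_initForm ω hf
  have ha0 : pairing α₀ ω = a := ha1 _ hα₀
  have hmin : ∀ α ∈ supp f, a ≤ pairing α ω := by
    intro α hα
    rw [← ha0]
    exact (mem_supp_initForm.1 hα₀).2 α hα
  have hlin : IsLinearMap ℝ fun x : Fin n → ℝ => x ⬝ᵥ ω :=
    ⟨fun x y => add_dotProduct x y ω, fun c x => smul_dotProduct c x ω⟩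
  have hge : ∀ x ∈ newton f, a ≤ x ⬝ᵥ ω := by
    intro x hx
    refine convexHull_min (t := {x | a ≤ x ⬝ᵥ ω}) ?_ (convex_halfSpace_ge hlin a) hx
    rintro _ ⟨α, hα, rfl⟩
    exact hmin α hα
  have heq : ∀ x ∈ newton (initForm ω f), x ⬝ᵥ ω = a := by
    intro x hx
    refine convexHull_min (t := {x | x ⬝ᵥ ω = a}) ?_ (convex_hyperplane hlin a) hx
    rintro _ ⟨α, hα, rfl⟩
    exact ha1 α hα
  ext x
  constructor
  · rintro ⟨hx, hxmin⟩
    have hxa : x ⬝ᵥ ω = a :=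
      le_antisymm ((hxmin _ (subset_convexHull ℝ _ ⟨α₀, (mem_supp_initForm.1 hα₀).1, rfl⟩)).trans
        ha0.le) (hge x hx)
    rw [newton, ← Finset.coe_image, Finset.mem_convexHull'] at hx
    obtain ⟨w, hw0, hw1, rfl⟩ := hx
    -- A convex combination of minimal weight involves only points of minimal weight.
    have hzero : ∀ y ∈ (supp f).image ι, w y * (y ⬝ᵥ ω - a) = 0 := by
      have hnn : ∀ y ∈ (supp f).image ι, 0 ≤ w y * (y ⬝ᵥ ω - a) := by
        intro y hy
        obtain ⟨α, hα, rfl⟩ := Finset.mem_image.1 hy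
        exact mul_nonneg (hw0 _ hy) (sub_nonneg.2 (hmin α hα))
      refine (Finset.sum_eq_zero_iff_of_nonneg hnn).1 ?_
      have hsum : (∑ y ∈ (supp f).image ι, w y • y) ⬝ᵥ ω =
          ∑ y ∈ (supp f).image ι, w y * (y ⬝ᵥ ω) := by
        rw [sum_dotProduct]
        simp only [smul_dotProduct, smul_eq_mul]
      simp only [mul_sub, Finset.sum_sub_distrib, ← Finset.sum_mul]
      rw [hw1, ← hsum, hxa, one_mul, sub_self]
    have hsub' : (supp (initForm ω f)).image ι ⊆ (supp f).image ι :=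
      Finset.image_subset_image fun α hα => (mem_supp_initForm.1 hα).1
    have hvan : ∀ y ∈ (supp f).image ι, y ∉ (supp (initForm ω f)).image ι → w y = 0 := by
      intro y hy hy'
      refine (mul_eq_zero.1 (hzero y hy)).resolve_right fun h => hy' ?_
      obtain ⟨α, hα, rfl⟩ := Finset.mem_image.1 hy
      refine Finset.mem_image_of_mem _ (mem_supp_initForm.2 ⟨hα, fun α' hα' => ?_⟩)
      have : pairing α ω = a := by
        rw [← hpair]
        linarith
      rw [this]
      exact hmin α' hα'
    rw [newton, ← Finset.coe_image, Finset.mem_convexHull']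
    refine ⟨w, fun y hy => hw0 y (hsub' hy), ?_, ?_⟩
    · rw [← hw1]
      exact Finset.sum_subset hsub' hvan
    · refine Finset.sum_subset hsub' fun y hy hy' => ?_
      rw [hvan y hy hy', zero_smul]
  · intro hx
    refine ⟨hsub hx, fun y hy => ?_⟩
    rw [heq x hx]
    exact hge y hy

end InitialForms

section ConeFace

variable {k : Type*} [Field k] {n r : ℕ} {T : ToricDatum k n r}

lemma ToricDatum.init_eq (hbal : T.IsBalanced) {ω : Fin n → ℝ} (hω : ω ∈ T.cone) (i : Fin r) :
    T.init i = initForm ω (T.f i) := by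
  have hne : T.cone.Nonempty := ⟨ω, hω⟩
  rw [ToricDatum.init, dif_pos hne]
  exact hbal i _ hne.choose_spec _ hω

lemma ToricDatum.init_eq_zero_iff (hbal : T.IsBalanced) (hne : T.cone.Nonempty) (i : Fin r) :
    T.init i = 0 ↔ T.f i = 0 := by
  obtain ⟨ω, hω⟩ := hne
  rw [T.init_eq hbal hω]
  constructor
  · intro h
    by_contra hf
    obtain ⟨α, hα⟩ := exists_mem_supp_initForm ω hf
    rw [h] at hα
    simp [supp] at hα
  · intro h
    rw [h, initForm, AddMonoidAlgebra.coeff_zero, Finsupp.filter_zero]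
    rfl

/-- The initial forms of a regular toric datum are non-zero: the Jacobian matrix of the zero
polynomial has rank zero. -/
lemma ToricDatum.IsRegular.init_ne_zero (hreg : T.IsRegular) (hne : T.cone.Nonempty) (i : Fin r) :
    T.init i ≠ 0 := by
  intro h0
  have hJ := (hreg.2.resolve_left hne.ne_empty) {i} (fun _ => 1) (fun _ => one_ne_zero)
    (fun j hj => by
      rw [Finset.mem_singleton.1 hj, h0]
      simp [laurentEval])
  rw [Finset.card_singleton] at hJ
  have hz : (Matrix.of fun (a : Fin n) (j : ({i} : Finset (Fin r))) =>
      laurentEval (algebraMap k (AlgebraicClosure k)) (fun _ => 1)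
        (laurentDeriv a (T.init j))) = 0 := by
    ext a ⟨j, hj⟩
    rw [Finset.mem_singleton] at hj
    subst hj
    simp [h0, laurentDeriv, laurentEval]
  rw [hz, Matrix.rank_zero] at hJ
  exact zero_ne_one hJ

/-- The face `τ` is the Newton polytope of the product of the common initial forms. -/
lemma ToricDatum.IsRegular.existsUnique_coneFace (hreg : T.IsRegular) (hne : T.cone.Nonempty) :
    ∃! τ, T.IsConeFace τ := by
  have hf : ∀ i, T.f i ≠ 0 := fun i h =>
    hreg.init_ne_zero hne i ((T.init_eq_zero_iff hreg.1 hne i).2 h)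
  have hface : ∀ ω ∈ T.cone, face ω (newton (∏ i, T.f i)) = newton (∏ i, T.init i) := by
    intro ω hω
    rw [face_newton, initForm_prod _ _ _ hf]
    congr 1
    exact Finset.prod_congr rfl fun i _ => (T.init_eq hreg.1 hω i).symm
  obtain ⟨ω, hω⟩ := hne
  refine ⟨newton (∏ i, T.init i), ⟨⟨ω, hface ω hω⟩, hface⟩, ?_⟩
  rintro τ ⟨-, hτ⟩
  rw [← hface ω hω]
  exact (hτ hω).symm

end ConeFace

/-! ### Splitting off torus factors -/

section Splitting

variable {n r : ℕ}

/-- An integral vector as a real vector, as a map of abelian groups. -/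
def castVec (n : ℕ) : (Fin n → ℤ) →ₗ[ℤ] (Fin n → ℝ) where
  toFun α i := (α i : ℝ)
  map_add' α β := by funext i; simp
  map_smul' c α := by funext i; simp

/-- A rational subspace `V ⊆ ℝⁿ` is a coordinate subspace with respect to a suitable basis of `ℤⁿ`:
the lattice `V ∩ ℤⁿ` is saturated, hence a direct summand. -/
lemma exists_GL_of_rational (V : Submodule ℝ (Fin n → ℝ))
    (hV : V ≤ Submodule.span ℝ {x | x ∈ V ∧ ∃ α, castVec n α = x}) :
    ∃ B : GL (Fin n) ℤ, ∀ α : Fin n → ℤ, castVec n α ∈ V →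
      ∀ i : Fin n, Module.finrank ℝ V ≤ i → (α ᵥ* (B : Matrix (Fin n) (Fin n) ℤ)) i = 0 := by
  classical
  let Λ : Submodule ℤ (Fin n → ℤ) := (V.restrictScalars ℤ).comap (castVec n)
  have hΛ : ∀ α, α ∈ Λ ↔ castVec n α ∈ V := fun α => Iff.rfl
  have htf : Module.IsTorsionFree ℤ ((Fin n → ℤ) ⧸ Λ) := by
    refine Module.IsTorsionFree.of_smul_eq_zero fun c x hx => ?_
    obtain ⟨α, rfl⟩ := Λ.mkQ_surjective x
    by_cases hc : c = 0
    · exact Or.inl hc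
    right
    rw [← map_smul, Submodule.mkQ_apply, Submodule.Quotient.mk_eq_zero, hΛ, map_smul] at hx
    rw [Submodule.mkQ_apply, Submodule.Quotient.mk_eq_zero, hΛ]
    have h1 : ((c : ℝ)⁻¹) • (c • castVec n α) ∈ V := V.smul_mem _ hx
    rwa [← Int.cast_smul_eq_zsmul ℝ, inv_smul_smul₀ (Int.cast_ne_zero.2 hc)] at h1
  let d := Module.finrank ℤ Λ
  let e := Module.finrank ℤ ((Fin n → ℤ) ⧸ Λ)
  let bΛ : Module.Basis (Fin d) ℤ Λ := Module.finBasis ℤ Λ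
  let bQ : Module.Basis (Fin e) ℤ ((Fin n → ℤ) ⧸ Λ) := Module.finBasis ℤ _
  let b := bΛ.sumQuot bQ
  have hde : d + e = n := by
    have h1 := Module.finrank_eq_card_basis b
    rw [Module.finrank_fin_fun, Fintype.card_sum, Fintype.card_fin, Fintype.card_fin] at h1
    exact h1.symm
  let σ : Fin d ⊕ Fin e ≃ Fin n := finSumFinEquiv.trans (finCongr hde)
  let b' := b.reindex σ
  have hσ : ∀ i, ((σ (Sum.inl i) : Fin n) : ℕ) = i := fun i => rfl
  let E : (Fin n → ℤ) ≃ₗ[ℤ] (Fin n → ℤ) := b'.equivFun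
  let B : GL (Fin n) ℤ :=
    ⟨(LinearMap.toMatrix' (E : (Fin n → ℤ) →ₗ[ℤ] (Fin n → ℤ)))ᵀ,
      (LinearMap.toMatrix' (E.symm : (Fin n → ℤ) →ₗ[ℤ] (Fin n → ℤ)))ᵀ,
      by rw [← Matrix.transpose_mul, ← LinearMap.toMatrix'_comp]; simp,
      by rw [← Matrix.transpose_mul, ← LinearMap.toMatrix'_comp]; simp⟩
  have hB : ∀ α : Fin n → ℤ, α ᵥ* (B : Matrix (Fin n) (Fin n) ℤ) = E α := by
    intro α
    change α ᵥ* (LinearMap.toMatrix' (E : (Fin n → ℤ) →ₗ[ℤ] (Fin n → ℤ)))ᵀ = _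
    rw [Matrix.vecMul_transpose, LinearMap.toMatrix'_mulVec]
    rfl
  have hbinl : ∀ i, b' (σ (Sum.inl i)) = bΛ i := by
    intro i
    simp [b', b]
  -- The basis of `Λ` is also a basis of `V`, because integral bases stay independent over `ℝ`.
  have hfr : Module.finrank ℝ V = d := by
    let M : Matrix (Fin n) (Fin n) ℤ := Matrix.of fun i => b' i
    have hM : M * (B : Matrix (Fin n) (Fin n) ℤ) = 1 := by
      ext1 i j
      have : (M * (B : Matrix (Fin n) (Fin n) ℤ)) i = b' i ᵥ* (B : Matrix (Fin n) (Fin n) ℤ) := rfl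
      rw [this, hB]
      simp [E, Matrix.one_apply]
    have hMR : IsUnit (M.map (Int.castRingHom ℝ)) := by
      have h1 : IsUnit M := IsUnit.of_mul_eq_one _ hM
      exact h1.map (Int.castRingHom ℝ).mapMatrix
    have hli := Matrix.linearIndependent_rows_iff_isUnit.2 hMR
    have hli' : LinearIndependent ℝ fun i => castVec n (bΛ i : Fin n → ℤ) := by
      have h2 := hli.comp (fun i : Fin d => σ (Sum.inl i))
        (σ.injective.comp Sum.inl_injective)
      have h3 : (fun i => castVec n (bΛ i : Fin n → ℤ)) =
          (M.map (Int.castRingHom ℝ)).row ∘ fun i : Fin d => σ (Sum.inl i) := by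
        funext i
        rw [← hbinl]
        rfl
      rw [h3]
      exact h2
    have hspan : Submodule.span ℝ (Set.range fun i => castVec n (bΛ i : Fin n → ℤ)) = V := by
      apply le_antisymm
      · rw [Submodule.span_le]
        rintro _ ⟨i, rfl⟩
        exact (bΛ i).2
      · refine hV.trans (Submodule.span_le.2 ?_)
        rintro x ⟨hx, α, rfl⟩
        have h3 : (⟨α, hx⟩ : Λ) = ∑ i, bΛ.repr ⟨α, hx⟩ i • bΛ i := (bΛ.sum_repr _).symm
        have h4 : α = ∑ i, bΛ.repr ⟨α, hx⟩ i • (bΛ i : Fin n → ℤ) := by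
          have := congrArg (Λ.subtype) h3
          rw [map_sum] at this
          exact this
        rw [h4, map_sum]
        refine Submodule.sum_mem _ fun i _ => ?_
        rw [map_smul, ← Int.cast_smul_eq_zsmul ℝ]
        exact Submodule.smul_mem _ _ (Submodule.subset_span ⟨i, rfl⟩)
    rw [← hspan, finrank_span_eq_card hli', Fintype.card_fin]
  refine ⟨B, fun α hα i hi => ?_⟩
  rw [hfr] at hi
  rw [hB]
  obtain ⟨x, rfl⟩ := σ.surjective i
  cases x with
  | inl x =>
    rw [hσ] at hi
    exact absurd x.2 (not_lt.2 hi)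
  | inr x =>
    have h5 : b.repr α (Sum.inr x) = 0 := bΛ.sumQuot_repr_inr_of_mem bQ α hα x
    simpa [E, b'] using h5

variable {k : Type*} [Field k]

lemma vectorSpan_sum_newton {f : Fin r → Laurent k n} (I : Finset (Fin r)) :
    vectorSpan ℝ (∑ j ∈ I, newton (f j)) =
      vectorSpan ℝ (∑ j ∈ I, castVec n '' (supp (f j) : Set (Fin n → ℤ))) := by
  have h : ∑ j ∈ I, newton (f j) =
      convexHull ℝ (∑ j ∈ I, castVec n '' (supp (f j) : Set (Fin n → ℤ))) :=
    (convexHull_sum I _).symm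
  rw [h, ← direction_affineSpan, affineSpan_convexHull, direction_affineSpan]

/-- The linear space parallel to a sum of Newton polytopes is rational. -/
lemma vectorSpan_sum_newton_le (f : Fin r → Laurent k n) (I : Finset (Fin r)) :
    vectorSpan ℝ (∑ j ∈ I, newton (f j)) ≤ Submodule.span ℝ
      {x | x ∈ vectorSpan ℝ (∑ j ∈ I, newton (f j)) ∧ ∃ α, castVec n α = x} := by
  rw [vectorSpan_sum_newton]
  conv_lhs => rw [vectorSpan_def]
  refine Submodule.span_mono ?_
  have hint : ∀ x ∈ ∑ j ∈ I, castVec n '' (supp (f j) : Set (Fin n → ℤ)), ∃ α, castVec n α = x := by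
    intro x hx
    rw [Set.mem_finsetSum] at hx
    obtain ⟨g, hg, rfl⟩ := hx
    choose! α hα using fun j (hj : j ∈ I) => hg hj
    refine ⟨∑ j ∈ I, α j, ?_⟩
    rw [map_sum]
    exact Finset.sum_congr rfl fun j hj => (hα j hj).2
  rintro _ ⟨x, hx, y, hy, rfl⟩
  refine ⟨vsub_mem_vectorSpan ℝ hx hy, ?_⟩
  obtain ⟨α, rfl⟩ := hint x hx
  obtain ⟨β, rfl⟩ := hint y hy
  exact ⟨α - β, map_sub _ _ _⟩

/-- Differences of exponents of a single summand are directions of the Minkowski sum: vary one summand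
and keep points of the others fixed. -/
lemma castVec_sub_mem_vectorSpan {f : Fin r → Laurent k n} {I : Finset (Fin r)}
    (hf : ∀ j ∈ I, f j ≠ 0) {j : Fin r} (hj : j ∈ I) {α β : Fin n → ℤ} (hα : α ∈ supp (f j))
    (hβ : β ∈ supp (f j)) :
    castVec n (α - β) ∈ vectorSpan ℝ (∑ j ∈ I, newton (f j)) := by
  classical
  have hne : ∀ i : Fin r, ∃ γ, i ∈ I → γ ∈ supp (f i) := by
    intro i
    by_cases hi : i ∈ I
    · obtain ⟨γ, hγ⟩ := exists_mem_supp_initForm 0 (hf i hi)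
      exact ⟨γ, fun _ => (mem_supp_initForm.1 hγ).1⟩
    · exact ⟨0, fun h => absurd h hi⟩
  choose γ hγ using hne
  rw [vectorSpan_sum_newton]
  have hmem : ∀ δ ∈ supp (f j), castVec n (∑ i ∈ I, Function.update γ j δ i) ∈
      ∑ j ∈ I, castVec n '' (supp (f j) : Set (Fin n → ℤ)) := by
    intro δ hδ
    rw [map_sum, Set.mem_finsetSum]
    refine ⟨fun i => castVec n (Function.update γ j δ i), fun {i} hi => ?_, rfl⟩
    refine ⟨_, ?_, rfl⟩
    by_cases hij : i = j
    · subst hij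
      simpa using hδ
    · simpa [hij] using hγ i hi
  have h := vsub_mem_vectorSpan ℝ (hmem α hα) (hmem β hβ)
  have hdiff : ∑ i ∈ I, Function.update γ j α i - ∑ i ∈ I, Function.update γ j β i = α - β := by
    rw [← Finset.sum_sub_distrib, Finset.sum_eq_single j]
    · simp
    · intro i _ hij
      simp [hij]
    · exact fun h => absurd hj h
  rwa [vsub_eq_sub, ← map_sub, hdiff] at h

/-- The inclusion `ℤ^d → ℤⁿ` of the first `d` coordinates underlying `extendVars`. -/
def padVec {d : ℕ} (n : ℕ) (α : Fin d → ℤ) (i : Fin n) : ℤ := if h : (i : ℕ) < d then α ⟨i, h⟩ else 0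

lemma padVec_injective {d : ℕ} (hd : d ≤ n) : Function.Injective (padVec (d := d) n) := by
  intro α β h
  funext i
  have := congrFun h ⟨i, i.2.trans_le hd⟩
  simpa [padVec] using this

lemma extendVars_eq {d : ℕ} (g : Laurent k d) :
    extendVars n g = AddMonoidAlgebra.mapDomain (padVec n) g := rfl

lemma mem_range_padVec {d : ℕ} {v : Fin n → ℤ} (hv : ∀ i : Fin n, d ≤ i → v i = 0) :
    v ∈ Set.range (padVec (d := d) n) := by
  refine ⟨fun i => if h : (i : ℕ) < n then v ⟨i, h⟩ else 0, ?_⟩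
  funext i
  by_cases hi : (i : ℕ) < d
  · simp [padVec, hi]
  · simp [padVec, hi, hv i (not_lt.1 hi)]

lemma glAct_injective (B : GL (Fin n) ℤ) :
    Function.Injective (glAct B : Laurent k n → Laurent k n) := by
  refine AddMonoidAlgebra.mapDomain_injective ?_
  exact Matrix.vecMul_injective_of_isUnit B.isUnit

/-- A unimodular change of coordinates moves all differences of exponents into the first `d(I)`
coordinates; after division by a monomial, each initial form involves only these variables. -/
lemma ToricDatum.exists_isSplitting (T : ToricDatum k n r) (hf : ∀ j, T.init j ≠ 0)
    (I : Finset (Fin r)) : ∃ B g, T.IsSplitting I B g := by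
  classical
  obtain ⟨B, hB⟩ := exists_GL_of_rational _ (vectorSpan_sum_newton_le T.init I)
  have hd : T.dimSum I ≤ n := by
    refine (Submodule.finrank_le _).trans ?_
    simp
  have key : ∀ j ∈ I, ∃ g : Laurent k (T.dimSum I), g ≠ 0 ∧ ∃ (c : k) (α : Fin n → ℤ), c ≠ 0 ∧
      glAct B (T.init j) = AddMonoidAlgebra.single α c * extendVars n g := by
    intro j hj
    obtain ⟨α₀, hα₀⟩ := exists_mem_supp_initForm 0 (hf j)
    replace hα₀ := (mem_supp_initForm.1 hα₀).1
    set α₁ : Fin n → ℤ := α₀ ᵥ* (B : Matrix (Fin n) (Fin n) ℤ) with hα₁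
    set h : Laurent k n := AddMonoidAlgebra.single (-α₁) 1 * glAct B (T.init j) with hh
    have hact : glAct B (T.init j) = AddMonoidAlgebra.single α₁ 1 * h := by
      rw [hh, ← mul_assoc, AddMonoidAlgebra.single_mul_single, add_neg_cancel, mul_one,
        ← AddMonoidAlgebra.one_def, one_mul]
    have hsupp : (h.coeff.support : Set (Fin n → ℤ)) ⊆ Set.range (padVec (d := T.dimSum I) n) := by
      intro v hv
      have h1 := AddMonoidAlgebra.support_coeff_single_mul_subset _ _ _ hv
      obtain ⟨w, hw, rfl⟩ := Finset.mem_image.1 h1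
      obtain ⟨α, hα, rfl⟩ := Finset.mem_image.1 (Finsupp.mapDomain_support hw)
      refine mem_range_padVec fun i hi => ?_
      have h2 := hB (α - α₀) (castVec_sub_mem_vectorSpan (fun j _ => hf j) hj hα hα₀) i hi
      rw [Matrix.sub_vecMul] at h2
      rw [neg_add_eq_sub]
      exact h2
    refine ⟨AddMonoidAlgebra.comapDomain (padVec n) (padVec_injective hd) h, ?_, 1, α₁, one_ne_zero,
      ?_⟩
    · intro h0
      have h3 := AddMonoidAlgebra.mapDomain_comapDomain hsupp (padVec_injective hd)
      rw [h0, AddMonoidAlgebra.mapDomain_zero] at h3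
      rw [← h3, mul_zero] at hact
      refine hf j (glAct_injective B ?_)
      rw [hact, glAct, AddMonoidAlgebra.mapDomain_zero]
    · rw [extendVars_eq, AddMonoidAlgebra.mapDomain_comapDomain hsupp, hact]
  choose! g hg using key
  exact ⟨B, g, hg⟩

end Splitting

/-! ### Counting points of the reductions over the residue field -/

section Torus

variable {R A : Type*} [CommRing R] [CommRing A] {n d : ℕ}

lemma zpow_sum {G ι : Type*} [CommGroup G] (x : G) (s : Finset ι) (a : ι → ℤ) :
    x ^ ∑ i ∈ s, a i = ∏ i ∈ s, x ^ a i := by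
  classical
  induction s using Finset.induction_on with
  | empty => simp
  | insert i s hi ih => rw [Finset.sum_insert hi, Finset.prod_insert hi, zpow_add, ih]

/-- The endomorphism `u ↦ u^B` of the torus given by an integral matrix. -/
def torusMap (B : Matrix (Fin n) (Fin n) ℤ) (u : Fin n → Aˣ) (i : Fin n) : Aˣ := ∏ j, u j ^ B i j

lemma prod_zpow_vecMul (B : Matrix (Fin n) (Fin n) ℤ) (u : Fin n → Aˣ) (α : Fin n → ℤ) :
    ∏ j, u j ^ (α ᵥ* B) j = ∏ i, torusMap B u i ^ α i := by
  simp only [torusMap, ← Finset.prod_zpow, ← zpow_mul]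
  rw [Finset.prod_comm]
  refine Finset.prod_congr rfl fun j _ => ?_
  rw [Matrix.vecMul, dotProduct]
  simp only [mul_comm (B _ j)]
  exact zpow_sum _ _ _

lemma torusMap_mul (B B' : Matrix (Fin n) (Fin n) ℤ) (u : Fin n → Aˣ) :
    torusMap (B * B') u = torusMap B (torusMap B' u) := by
  funext i
  exact prod_zpow_vecMul B' u (B i)

lemma torusMap_one (u : Fin n → Aˣ) : torusMap 1 u = u := by
  funext i
  rw [torusMap, Finset.prod_eq_single i]
  · simp
  · intro j _ hj
    simp [Matrix.one_apply_ne hj.symm]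
  · simp

/-- An element of `GL_n(ℤ)` acts bijectively on the points of the torus. -/
def torusEquiv (B : GL (Fin n) ℤ) : (Fin n → Aˣ) ≃ (Fin n → Aˣ) where
  toFun := torusMap (B : Matrix (Fin n) (Fin n) ℤ)
  invFun := torusMap ((B⁻¹ : GL (Fin n) ℤ) : Matrix (Fin n) (Fin n) ℤ)
  left_inv u := by rw [← torusMap_mul, ← Units.val_mul, inv_mul_cancel, Units.val_one, torusMap_one]
  right_inv u := by rw [← torusMap_mul, ← Units.val_mul, mul_inv_cancel, Units.val_one, torusMap_one]

lemma evalHom_mapDomain_vecMul (φ : R →+* A) (B : GL (Fin n) ℤ) (u : Fin n → Aˣ) (f : Laurent R n) :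
    evalHom φ u (AddMonoidAlgebra.mapDomain
      (fun α : Fin n → ℤ => α ᵥ* (B : Matrix (Fin n) (Fin n) ℤ)) f) =
      evalHom φ (torusEquiv B u) f := by
  induction f using AddMonoidAlgebra.induction_linear with
  | zero => simp
  | add f g hf hg => simp only [AddMonoidAlgebra.mapDomain_add, map_add, hf, hg]
  | single α c =>
    rw [AddMonoidAlgebra.mapDomain_single, evalHom_single, evalHom_single, prod_zpow_vecMul]
    rfl

lemma evalHom_mapDomain_padVec (φ : R →+* A) (hd : d ≤ n) (u : Fin n → Aˣ) (f : Laurent R d) :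
    evalHom φ u (AddMonoidAlgebra.mapDomain (padVec n) f) =
      evalHom φ (fun i => u (Fin.castLE hd i)) f := by
  induction f using AddMonoidAlgebra.induction_linear with
  | zero => simp
  | add f g hf hg => simp only [AddMonoidAlgebra.mapDomain_add, map_add, hf, hg]
  | single α c =>
    rw [AddMonoidAlgebra.mapDomain_single, evalHom_single, evalHom_single]
    congr 2
    obtain ⟨e, rfl⟩ := Nat.exists_eq_add_of_le hd
    rw [Fin.prod_univ_add]
    simp [padVec]
    rfl

/-- The points of the torus of dimension `n` which satisfy a condition on the first `d` coordinates. -/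
lemma card_first_coordinates [Finite Aˣ] (hd : d ≤ n) (p : (Fin d → Aˣ) → Prop) :
    Nat.card {u : Fin n → Aˣ // p fun i => u (Fin.castLE hd i)} =
      Nat.card {u : Fin d → Aˣ // p u} * Nat.card Aˣ ^ (n - d) := by
  obtain ⟨e, rfl⟩ := Nat.exists_eq_add_of_le hd
  have h1 : {u : Fin (d + e) → Aˣ // p fun i => u (Fin.castLE hd i)} ≃
      {u : Fin d → Aˣ // p u} × (Fin e → Aˣ) :=
    { toFun := fun u => (⟨fun i => u.1 (Fin.castLE hd i), u.2⟩, fun i => u.1 (Fin.natAdd d i))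
      invFun := fun v => ⟨Fin.append v.1.1 v.2, by
        have : (fun i => Fin.append v.1.1 v.2 (Fin.castLE hd i)) = v.1.1 := by
          funext i
          exact Fin.append_left v.1.1 v.2 i
        rw [this]
        exact v.1.2⟩
      left_inv := fun u => by
        ext1
        funext i
        refine Fin.addCases (fun i => ?_) (fun i => ?_) i
        · exact Fin.append_left _ _ i
        · exact Fin.append_right _ _ i
      right_inv := fun v => by
        refine Prod.ext (Subtype.ext ?_) ?_
        · funext i
          exact Fin.append_left _ _ i
        · funext i
          exact Fin.append_right _ _ i }
  rw [Nat.card_congr h1, Nat.card_prod, Nat.card_fun, Nat.card_fin, Nat.add_sub_cancel_left]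

/-- A polynomial system which becomes, after a monomial change of coordinates and division by
monomials, a system in the first `d` variables has `(q-1)^(n-d)` times as many solutions in the
torus. -/
lemma card_zeros_of_splitting {k κ ι : Type*} [Field k] [Field κ] [Finite κ] (hd : d ≤ n)
    (S : Subring k) (ρ : S →+* κ) (I : Finset ι) (B : GL (Fin n) ℤ) (f : ι → Laurent S n)
    (g : ι → Laurent S d)
    (h : ∀ j ∈ I, ∃ (c c' : S) (α : Fin n → ℤ), c * c' = 1 ∧
      glAct B (AddMonoidAlgebra.mapRingHom _ S.subtype (f j)) =
        AddMonoidAlgebra.single α (c : k) *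
          extendVars n (AddMonoidAlgebra.mapRingHom _ S.subtype (g j))) :
    Nat.card {u : Fin n → κˣ // ∀ j ∈ I, evalHom ρ u (f j) = 0} =
      Nat.card {u : Fin d → κˣ // ∀ j ∈ I, evalHom ρ u (g j) = 0} * (Nat.card κ - 1) ^ (n - d) := by
  have hmapdom : ∀ {m m' : ℕ} (t : (Fin m → ℤ) → (Fin m' → ℤ)) (p : Laurent S m),
      AddMonoidAlgebra.mapRingHom _ S.subtype (AddMonoidAlgebra.mapDomain t p) =
        AddMonoidAlgebra.mapDomain t (AddMonoidAlgebra.mapRingHom _ S.subtype p) := by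
    intro m m' t p
    induction p using AddMonoidAlgebra.induction_linear with
    | zero => simp
    | add f g hf hg => simp only [AddMonoidAlgebra.mapDomain_add, map_add, hf, hg]
    | single α c => simp
  have hiff : ∀ u : Fin n → κˣ, (∀ j ∈ I, evalHom ρ (torusEquiv B u) (f j) = 0) ↔
      ∀ j ∈ I, evalHom ρ (fun i => u (Fin.castLE hd i)) (g j) = 0 := by
    intro u
    refine forall₂_congr fun j hj => ?_
    obtain ⟨c, c', α, hc, hB⟩ := h j hj
    have hS : AddMonoidAlgebra.mapDomain
        (fun α : Fin n → ℤ => α ᵥ* (B : Matrix (Fin n) (Fin n) ℤ)) (f j) =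
        AddMonoidAlgebra.single α c * AddMonoidAlgebra.mapDomain (padVec n) (g j) := by
      apply mapRingHom_subtype_injective S
      rw [hmapdom, map_mul, hmapdom, AddMonoidAlgebra.mapRingHom_single]
      exact hB
    rw [← evalHom_mapDomain_vecMul, hS, map_mul, evalHom_mapDomain_padVec ρ hd, evalHom_single]
    have hρ : ρ c ≠ 0 := by
      intro h0
      have := congrArg ρ hc
      rw [map_mul, h0, zero_mul, map_one] at this
      exact zero_ne_one this
    rw [mul_eq_zero, or_iff_right (mul_ne_zero hρ (Units.ne_zero _))]
  have h1 : {u : Fin n → κˣ // ∀ j ∈ I, evalHom ρ (torusEquiv B u) (f j) = 0} ≃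
      {u : Fin n → κˣ // ∀ j ∈ I, evalHom ρ u (f j) = 0} :=
    (torusEquiv B).subtypeEquiv fun u => Iff.rfl
  rw [← Nat.card_congr h1, Nat.card_congr (Equiv.subtypeEquivRight hiff),
    card_first_coordinates hd fun u => ∀ j ∈ I, evalHom ρ u (g j) = 0, Nat.card_units]

end Torus

section InclusionExclusion

/-- Möbius inversion on a Boolean lattice. -/
lemma sum_neg_one_pow_of_subset {ι : Type*} [Fintype ι] [DecidableEq ι] (J Z : Finset ι) :
    ∑ I : Finset ι with J ⊆ I, (if I ⊆ Z then (-1 : ℂ) ^ (J.card + I.card) else 0) =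
      if Z = J then 1 else 0 := by
  rw [← Finset.sum_filter, Finset.filter_filter]
  by_cases hJZ : J ⊆ Z
  · have h1 : ∑ I : Finset ι with J ⊆ I ∧ I ⊆ Z, (-1 : ℂ) ^ (J.card + I.card) =
        ∑ m ∈ (Z \ J).powerset, (-1 : ℂ) ^ m.card := by
      refine Finset.sum_nbij' (fun I => I \ J) (fun m => J ∪ m) ?_ ?_ ?_ ?_ ?_
      · intro I hI
        simp only [Finset.mem_filter, Finset.mem_univ, true_and] at hI
        exact Finset.mem_powerset.2 (Finset.sdiff_subset_sdiff hI.2 subset_rfl)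
      · intro m hm
        simp only [Finset.mem_filter, Finset.mem_univ, true_and]
        exact ⟨Finset.subset_union_left, Finset.union_subset hJZ
          ((Finset.mem_powerset.1 hm).trans Finset.sdiff_subset)⟩
      · intro I hI
        simp only [Finset.mem_filter, Finset.mem_univ, true_and] at hI
        exact Finset.union_sdiff_of_subset hI.1
      · intro m hm
        have hd : Disjoint m J := (Finset.subset_sdiff.1 (Finset.mem_powerset.1 hm)).2
        rw [Finset.union_sdiff_left, Finset.sdiff_eq_self_of_disjoint hd]
      · intro I hI
        simp only [Finset.mem_filter, Finset.mem_univ, true_and] at hI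
        rw [Finset.card_sdiff_of_subset hI.1]
        have hle := Finset.card_le_card hI.1
        have : J.card + I.card = (I.card - J.card) + 2 * J.card := by omega
        rw [this, pow_add, pow_mul]
        simp
    rw [h1]
    have h2 := Finset.sum_powerset_neg_one_pow_card (x := Z \ J)
    have h3 : ∑ m ∈ (Z \ J).powerset, (-1 : ℂ) ^ m.card =
        ((∑ m ∈ (Z \ J).powerset, (-1 : ℤ) ^ m.card : ℤ) : ℂ) := by push_cast; rfl
    rw [h3, h2]
    have h4 : Z \ J = ∅ ↔ Z = J := by
      rw [Finset.sdiff_eq_empty_iff_subset]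
      exact ⟨fun h => h.antisymm hJZ, fun h => h.le⟩
    simp only [h4]
    split_ifs <;> simp
  · rw [if_neg fun h => hJZ h.ge, Finset.filter_false_of_mem, Finset.sum_empty]
    intro I _ h
    exact hJZ (h.1.trans h.2)

/-- The number of points `x` with `Z x = J`, in terms of the numbers of points with `I ⊆ Z x`. -/
lemma card_filter_eq_sum {ι X : Type*} [Fintype ι] [DecidableEq ι] [Fintype X] (Z : X → Finset ι)
    (J : Finset ι) :
    ((Finset.univ.filter fun x => Z x = J).card : ℂ) =
      ∑ I : Finset ι with J ⊆ I, (-1 : ℂ) ^ (J.card + I.card) *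
        (Nat.card {x // I ⊆ Z x} : ℂ) := by
  have h1 : ∀ I : Finset ι, (Nat.card {x // I ⊆ Z x} : ℂ) = ∑ x, if I ⊆ Z x then 1 else 0 := by
    intro I
    rw [Nat.card_eq_fintype_card, Fintype.card_subtype, Finset.card_filter, Nat.cast_sum]
    refine Finset.sum_congr rfl fun x _ => ?_
    rw [Nat.cast_ite, Nat.cast_one, Nat.cast_zero]
  simp only [h1, Finset.mul_sum]
  rw [Finset.sum_comm, Finset.card_filter, Nat.cast_sum]
  refine Finset.sum_congr rfl fun x _ => ?_
  rw [Nat.cast_ite, Nat.cast_one, Nat.cast_zero]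
  refine (sum_neg_one_pow_of_subset J (Z x)).symm.trans ?_
  refine Finset.sum_congr rfl fun I _ => ?_
  rw [mul_ite, mul_one, mul_zero]

end InclusionExclusion

/-! ### The normalised valuation of a local field -/

section Valuation

variable {K : Type*} [Field K] [ValuativeRel K] [TopologicalSpace K] [IsNonarchimedeanLocalField K]

lemma valueIso_ne_zero {x : K} (hx : x ≠ 0) :
    IsNonarchimedeanLocalField.valueGroupWithZeroIsoInt K (ValuativeRel.valuation K x) ≠ 0 := by
  rw [Ne, map_eq_zero_iff _ (EquivLike.injective _)]
  exact (Valuation.ne_zero_iff _).2 hx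

lemma nuK_mul {x y : K} (hx : x ≠ 0) (hy : y ≠ 0) : nuK (x * y) = nuK x + nuK y := by
  rw [nuK, map_mul, map_mul, WithZero.log_mul (valueIso_ne_zero hx) (valueIso_ne_zero hy), neg_add]
  rfl

lemma nuK_one : nuK (1 : K) = 0 := by
  rw [nuK, map_one, map_one, WithZero.log_one, neg_zero]

lemma nuK_le_nuK {x y : K} (hx : x ≠ 0) (hy : y ≠ 0) :
    nuK x ≤ nuK y ↔ ValuativeRel.valuation K y ≤ ValuativeRel.valuation K x := by
  rw [nuK, nuK, neg_le_neg_iff, WithZero.log_le_log (valueIso_ne_zero hy) (valueIso_ne_zero hx)]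
  exact map_le_map_iff (IsNonarchimedeanLocalField.valueGroupWithZeroIsoInt K)

lemma mem_integer_iff {x : K} (hx : x ≠ 0) : x ∈ 𝒪[K] ↔ 0 ≤ nuK x := by
  rw [← nuK_one (K := K), nuK_le_nuK one_ne_zero hx, map_one]
  rfl

lemma nuK_inv {x : K} (hx : x ≠ 0) : nuK x⁻¹ = -nuK x := by
  have := nuK_mul hx (inv_ne_zero hx)
  rw [mul_inv_cancel₀ hx, nuK_one] at this
  linarith

lemma nuK_pow {x : K} (hx : x ≠ 0) (m : ℕ) : nuK (x ^ m) = m * nuK x := by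
  induction m with
  | zero => simp [nuK_one]
  | succ m ih =>
    rw [pow_succ, nuK_mul (pow_ne_zero _ hx) hx, ih]
    push_cast
    ring

lemma nuK_zpow {x : K} (hx : x ≠ 0) (m : ℤ) : nuK (x ^ m) = m * nuK x := by
  cases m with
  | ofNat m => simpa using nuK_pow hx m
  | negSucc m =>
    rw [zpow_negSucc, nuK_inv (pow_ne_zero _ hx), nuK_pow hx]
    simp [Int.negSucc_eq]
    ring

lemma nuK_prod {ι : Type*} (s : Finset ι) {x : ι → K} (hx : ∀ i ∈ s, x i ≠ 0) :
    nuK (∏ i ∈ s, x i) = ∑ i ∈ s, nuK (x i) := by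
  classical
  induction s using Finset.induction_on with
  | empty => simp [nuK_one]
  | insert i s hi ih =>
    have h : ∀ j ∈ s, x j ≠ 0 := fun j hj => hx j (Finset.mem_insert_of_mem hj)
    rw [Finset.prod_insert hi, Finset.sum_insert hi,
      nuK_mul (hx i (Finset.mem_insert_self i s)) (Finset.prod_ne_zero_iff.2 h), ih h]

lemma nuK_unit (u : 𝒪[K]ˣ) : nuK ((u : 𝒪[K]) : K) = 0 := by
  have hu : ((u : 𝒪[K]) : K) ≠ 0 := fun h => u.ne_zero (Subtype.ext h)
  have hu' : (((u⁻¹ : 𝒪[K]ˣ) : 𝒪[K]) : K) ≠ 0 := fun h => (u⁻¹).ne_zero (Subtype.ext h)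
  have h1 := (mem_integer_iff hu).1 (u : 𝒪[K]).2
  have h2 := (mem_integer_iff hu').1 ((u⁻¹ : 𝒪[K]ˣ) : 𝒪[K]).2
  have h3 := nuK_mul hu hu'
  have h4 : ((u : 𝒪[K]) : K) * (((u⁻¹ : 𝒪[K]ˣ) : 𝒪[K]) : K) = 1 := by
    have := congrArg (Subtype.val : 𝒪[K] → K) u.mul_inv
    exact this
  rw [h4, nuK_one] at h3
  linarith

variable (K) in
lemma exists_nuK_eq_one : ∃ x : K, x ≠ 0 ∧ nuK x = 1 := by
  obtain ⟨x, hx⟩ := ValuativeRel.valuation_surjective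
    ((IsNonarchimedeanLocalField.valueGroupWithZeroIsoInt K).symm (WithZero.exp (-1)))
  have h1 : IsNonarchimedeanLocalField.valueGroupWithZeroIsoInt K (ValuativeRel.valuation K x) =
      WithZero.exp (-1) := by
    rw [hx]
    exact (IsNonarchimedeanLocalField.valueGroupWithZeroIsoInt K).toEquiv.apply_symm_apply _
  refine ⟨x, ?_, ?_⟩
  · rintro rfl
    rw [map_zero, map_zero] at h1
    exact WithZero.exp_ne_zero h1.symm
  · rw [nuK, h1, WithZero.log_exp, neg_neg]

variable (K) in
/-- A uniformiser of `K`. -/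
def unif : K := (exists_nuK_eq_one K).choose

lemma unif_ne_zero : unif K ≠ 0 := (exists_nuK_eq_one K).choose_spec.1

lemma nuK_unif : nuK (unif K) = 1 := (exists_nuK_eq_one K).choose_spec.2

variable (K) in
/-- The uniformiser as an element of the valuation ring. -/
def unifO : 𝒪[K] := ⟨unif K, (mem_integer_iff unif_ne_zero).2 (by rw [nuK_unif]; exact zero_le_one)⟩

lemma coe_unifO : (unifO K : K) = unif K := rfl

lemma isUnit_of_nuK_eq_zero {x : 𝒪[K]} (hx : (x : K) ≠ 0) (h : nuK (x : K) = 0) : IsUnit x := by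
  refine IsUnit.of_mul_eq_one ⟨(x : K)⁻¹, ?_⟩ (Subtype.ext (mul_inv_cancel₀ hx))
  rw [mem_integer_iff (inv_ne_zero hx), nuK_inv hx, h, neg_zero]

/-- The powers of the maximal ideal in terms of the normalised valuation. -/
lemma mem_maximalIdeal_pow {x : 𝒪[K]} (hx : (x : K) ≠ 0) (a : ℕ) :
    x ∈ 𝓂[K] ^ a ↔ (a : ℤ) ≤ nuK (x : K) := by
  have hspan : 𝓂[K] = Ideal.span {unifO K} := by
    apply le_antisymm
    · intro y hy
      rw [Ideal.mem_span_singleton]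
      by_cases hy0 : (y : K) = 0
      · rw [show y = 0 from Subtype.ext hy0]
        exact dvd_zero _
      have h0 : 0 ≤ nuK (y : K) := (mem_integer_iff hy0).1 y.2
      have h1 : nuK (y : K) ≠ 0 := fun h =>
        (IsLocalRing.mem_maximalIdeal _).1 hy (isUnit_of_nuK_eq_zero hy0 h)
      refine ⟨⟨(unif K)⁻¹ * y, ?_⟩, Subtype.ext (mul_inv_cancel_left₀ unif_ne_zero _).symm⟩
      rw [mem_integer_iff (mul_ne_zero (inv_ne_zero unif_ne_zero) hy0),
        nuK_mul (inv_ne_zero unif_ne_zero) hy0, nuK_inv unif_ne_zero, nuK_unif]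
      omega
    · rw [Ideal.span_singleton_le_iff_mem, IsLocalRing.mem_maximalIdeal]
      intro hu
      have := nuK_unit hu.unit
      rw [IsUnit.unit_spec, coe_unifO, nuK_unif] at this
      exact one_ne_zero this
  rw [hspan, Ideal.span_singleton_pow, Ideal.mem_span_singleton]
  have hp : unif K ^ a ≠ 0 := pow_ne_zero _ unif_ne_zero
  constructor
  · rintro ⟨c, rfl⟩
    have hc : (c : K) ≠ 0 := by
      rintro h
      apply hx
      rw [Subring.coe_mul, h, mul_zero]
    rw [Subring.coe_mul, Subring.coe_pow, coe_unifO, nuK_mul hp hc, nuK_pow unif_ne_zero, nuK_unif]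
    have := (mem_integer_iff hc).1 c.2
    linarith
  · intro h
    refine ⟨⟨(unif K ^ a)⁻¹ * x, ?_⟩, Subtype.ext (mul_inv_cancel_left₀ hp _).symm⟩
    rw [mem_integer_iff (mul_ne_zero (inv_ne_zero hp) hx), nuK_mul (inv_ne_zero hp) hx,
      nuK_inv hp, nuK_pow unif_ne_zero, nuK_unif]
    linarith

lemma unifO_pow_mul_mem {a b : ℕ} {x : 𝒪[K]} :
    unifO K ^ a * x ∈ 𝓂[K] ^ (b + a) ↔ x ∈ 𝓂[K] ^ b := by
  by_cases hx : (x : K) = 0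
  · rw [show x = 0 from Subtype.ext hx, mul_zero]
    exact ⟨fun _ => zero_mem _, fun _ => zero_mem _⟩
  have hp : unif K ^ a ≠ 0 := pow_ne_zero _ unif_ne_zero
  have h : ((unifO K ^ a * x : 𝒪[K]) : K) = unif K ^ a * x := rfl
  rw [mem_maximalIdeal_pow (by rw [h]; exact mul_ne_zero hp hx), mem_maximalIdeal_pow hx, h,
    nuK_mul hp hx, nuK_pow unif_ne_zero, nuK_unif]
  push_cast
  constructor <;> intro _ <;> linarith

lemma one_lt_qK : 1 < qK K := by
  rw [qK]
  exact Finite.one_lt_card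

lemma absK_le_one_iff {x : K} : absK x ≤ 1 ↔ x ∈ 𝒪[K] := by
  by_cases hx : x = 0
  · subst hx
    simp [absK]
  · rw [mem_integer_iff hx, absK, if_neg hx]
    have h1 : (1 : ℝ) < qK K := by exact_mod_cast one_lt_qK
    rw [zpow_le_one_iff_right₀ h1]
    omega

/-- A non-zero element is a power of the uniformiser times a unit. -/
lemma exists_unit_of_nuK_eq {x : K} (hx : x ≠ 0) {a : ℤ} (h : nuK x = a) :
    ∃ u : 𝒪[K]ˣ, x = unif K ^ a * ((u : 𝒪[K]) : K) := by
  have hp : unif K ^ a ≠ 0 := zpow_ne_zero _ unif_ne_zero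
  have hν : nuK ((unif K ^ a)⁻¹ * x) = 0 := by
    rw [nuK_mul (inv_ne_zero hp) hx, nuK_inv hp, nuK_zpow unif_ne_zero, nuK_unif, h]
    ring
  have hne := mul_ne_zero (inv_ne_zero hp) hx
  have hu : IsUnit (⟨(unif K ^ a)⁻¹ * x, (mem_integer_iff hne).2 hν.ge⟩ : 𝒪[K]) :=
    isUnit_of_nuK_eq_zero hne hν
  exact ⟨hu.unit, (mul_inv_cancel_left₀ hp _).symm⟩

end Valuation

/-! ### Volumes of sets defined by congruences -/

section Volume

variable {K : Type*} [Field K] [ValuativeRel K] {n : ℕ}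

/-- An integral vector as a vector with entries in `K`. -/
def intVec (y : Fin n → 𝒪[K]) (i : Fin n) : K := y i

lemma intVec_injective : Function.Injective (intVec : (Fin n → 𝒪[K]) → (Fin n → K)) := by
  intro x y h
  funext i
  exact Subtype.ext (congrFun h i)

/-- Reduction of the `i`-th coordinate modulo `𝔓^{b i}` for all `i`. -/
def reduceVec (b : Fin n → ℕ) : (Fin n → 𝒪[K]) →+ ((i : Fin n) → 𝒪[K] ⧸ 𝓂[K] ^ b i) where
  toFun y i := Ideal.Quotient.mk _ (y i)
  map_zero' := by funext i; simp
  map_add' x y := by funext i; simp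

lemma reduceVec_eq_iff {b : Fin n → ℕ} {x y : Fin n → 𝒪[K]} :
    reduceVec b x = reduceVec b y ↔ ∀ i, x i - y i ∈ 𝓂[K] ^ b i := by
  rw [funext_iff]
  exact forall_congr' fun i => Ideal.Quotient.eq

lemma reduceVec_surjective (b : Fin n → ℕ) :
    Function.Surjective (reduceVec b : (Fin n → 𝒪[K]) → _) := by
  intro t
  choose y hy using fun i => Ideal.Quotient.mk_surjective (t i)
  exact ⟨y, funext hy⟩

/-- Residue classes are translates of one another. -/
lemma intVec_image_fiber (b : Fin n → ℕ) (y : Fin n → 𝒪[K]) :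
    intVec '' (reduceVec b ⁻¹' {reduceVec b y}) =
      (fun x => -intVec y + x) ⁻¹' (intVec '' (reduceVec b ⁻¹' {0})) := by
  ext x
  constructor
  · rintro ⟨z, hz, rfl⟩
    refine ⟨-y + z, ?_, rfl⟩
    rw [Set.mem_preimage, Set.mem_singleton_iff] at hz ⊢
    rw [map_add, map_neg, hz, neg_add_cancel]
  · rintro ⟨z, hz, hzx⟩
    refine ⟨y + z, ?_, ?_⟩
    · rw [Set.mem_preimage, Set.mem_singleton_iff] at hz ⊢
      rw [map_add, hz, add_zero]
    · have : x = intVec y + (-intVec y + x) := (add_neg_cancel_left _ _).symm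
      rw [this]
      simp only [← hzx]
      rfl

lemma intVec_image_preimage (b : Fin n → ℕ) (s : Set ((i : Fin n) → 𝒪[K] ⧸ 𝓂[K] ^ b i)) :
    intVec '' (reduceVec b ⁻¹' s) = ⋃ t ∈ s, intVec '' (reduceVec b ⁻¹' {t}) := by
  rw [← Set.image_iUnion₂, ← Set.preimage_iUnion₂, Set.biUnion_of_singleton]

variable [TopologicalSpace K] [IsNonarchimedeanLocalField K]

lemma card_quotient_pow (a : ℕ) : Nat.card (𝒪[K] ⧸ 𝓂[K] ^ a) = qK K ^ a := by
  have h : 𝓂[K] ≠ ⊥ := IsDiscreteValuationRing.not_a_field 𝒪[K]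
  have := cardQuot_pow_of_prime (S := 𝒪[K]) (P := 𝓂[K]) h (i := a)
  rw [Submodule.cardQuot_apply, Submodule.cardQuot_apply] at this
  exact this

instance finite_quotient_pow (a : ℕ) : Finite (𝒪[K] ⧸ 𝓂[K] ^ a) := by
  apply Nat.finite_of_card_ne_zero
  rw [card_quotient_pow]
  exact pow_ne_zero _ (zero_lt_one.trans one_lt_qK).ne'

lemma isOpen_image_pow (a : ℕ) : IsOpen {x : K | ∃ y : 𝒪[K], y ∈ 𝓂[K] ^ a ∧ (y : K) = x} := by
  have hp : unif K ^ a ≠ 0 := pow_ne_zero _ unif_ne_zero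
  have h : {x : K | ∃ y : 𝒪[K], y ∈ 𝓂[K] ^ a ∧ (y : K) = x} =
      (fun x => (unif K ^ a)⁻¹ * x) ⁻¹' (𝒪[K] : Set K) := by
    ext x
    constructor
    · rintro ⟨y, hy, rfl⟩
      change (unif K ^ a)⁻¹ * (y : K) ∈ 𝒪[K]
      by_cases hy0 : (y : K) = 0
      · rw [hy0, mul_zero]
        exact zero_mem _
      rw [mem_maximalIdeal_pow hy0] at hy
      rw [mem_integer_iff (mul_ne_zero (inv_ne_zero hp) hy0), nuK_mul (inv_ne_zero hp) hy0,
        nuK_inv hp, nuK_pow unif_ne_zero, nuK_unif]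
      linarith
    · intro hx
      have h1 := (unifO_pow_mul_mem (K := K) (a := a) (b := 0)
        (x := ⟨(unif K ^ a)⁻¹ * x, hx⟩)).2 (by simp)
      rw [zero_add] at h1
      exact ⟨_, h1, mul_inv_cancel_left₀ hp x⟩
  rw [h]
  exact (isOpen_integer K).preimage (continuous_const.mul continuous_id)

lemma isOpen_intVec_fiber (b : Fin n → ℕ) (t : (i : Fin n) → 𝒪[K] ⧸ 𝓂[K] ^ b i) :
    IsOpen (intVec '' (reduceVec b ⁻¹' {t})) := by
  obtain ⟨y, rfl⟩ := reduceVec_surjective b t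
  rw [intVec_image_fiber]
  refine IsOpen.preimage (continuous_const.add continuous_id) ?_
  have h : intVec '' (reduceVec b ⁻¹' {(0 : (i : Fin n) → 𝒪[K] ⧸ 𝓂[K] ^ b i)}) =
      Set.univ.pi fun i => {x : K | ∃ y : 𝒪[K], y ∈ 𝓂[K] ^ b i ∧ (y : K) = x} := by
    ext x
    constructor
    · rintro ⟨z, hz, rfl⟩ i -
      exact ⟨z i, Ideal.Quotient.eq_zero_iff_mem.1 (congrFun hz i), rfl⟩
    · intro hx
      choose z hz using fun i => hx i (Set.mem_univ i)
      exact ⟨z, funext fun i => Ideal.Quotient.eq_zero_iff_mem.2 (hz i).1,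
        funext fun i => (hz i).2⟩
  rw [h]
  exact isOpen_set_pi Set.finite_univ fun i _ => isOpen_image_pow _

lemma isOpen_intVec_preimage (b : Fin n → ℕ) (s : Set ((i : Fin n) → 𝒪[K] ⧸ 𝓂[K] ^ b i)) :
    IsOpen (intVec '' (reduceVec b ⁻¹' s)) := by
  rw [intVec_image_preimage]
  exact isOpen_biUnion fun t _ => isOpen_intVec_fiber b t

variable [MeasurableSpace (Fin n → K)] [BorelSpace (Fin n → K)]

instance isAddLeftInvariant_haarK : (haarK K n).IsAddLeftInvariant := by
  rw [haarK]
  infer_instance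

/-- The volume of a set of integral vectors. -/
def vol (E : Set (Fin n → 𝒪[K])) : ENNReal := haarK K n (intVec '' E)

lemma vol_univ : vol (Set.univ : Set (Fin n → 𝒪[K])) = 1 := by
  have h : intVec '' (Set.univ : Set (Fin n → 𝒪[K])) = (unitPolydisc K n : Set (Fin n → K)) := by
    ext x
    constructor
    · rintro ⟨y, -, rfl⟩ i -
      exact (y i).2
    · intro hx
      exact ⟨fun i => ⟨x i, hx i (Set.mem_univ i)⟩, Set.mem_univ _, rfl⟩
  rw [vol, h, haarK, Measure.addHaarMeasure_self]

lemma vol_preimage_eq_mul (b : Fin n → ℕ) (s : Set ((i : Fin n) → 𝒪[K] ⧸ 𝓂[K] ^ b i)) :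
    vol (reduceVec b ⁻¹' s) =
      s.ncard * vol (reduceVec b ⁻¹' ({0} : Set ((i : Fin n) → 𝒪[K] ⧸ 𝓂[K] ^ b i))) := by
  have hs : s.Finite := s.toFinite
  rw [vol, intVec_image_preimage, ← hs.coe_toFinset]
  simp only [Finset.mem_coe]
  rw [measure_biUnion_finset, Set.ncard_coe_finset, ← nsmul_eq_mul]
  · refine Finset.sum_eq_card_nsmul fun t _ => ?_
    obtain ⟨y, rfl⟩ := reduceVec_surjective b t
    rw [intVec_image_fiber, measure_preimage_add]
    rfl
  · intro t _ t' _ htt'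
    refine (Set.disjoint_image_iff intVec_injective).2 ?_
    exact Disjoint.preimage _ (Set.disjoint_singleton.2 htt')
  · exact fun t _ => (isOpen_intVec_fiber b t).measurableSet

/-- The volume of a set which is a union of residue classes: the number of residue classes divided by
the total number of residue classes. -/
lemma vol_preimage_mul (b : Fin n → ℕ) (s : Set ((i : Fin n) → 𝒪[K] ⧸ 𝓂[K] ^ b i)) :
    vol (reduceVec b ⁻¹' s) * (qK K : ENNReal) ^ (∑ i, b i) = s.ncard := by
  have hcard : (Set.univ : Set ((i : Fin n) → 𝒪[K] ⧸ 𝓂[K] ^ b i)).ncard = qK K ^ ∑ i, b i := by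
    rw [Set.ncard_univ, Nat.card_pi, ← Finset.prod_pow_eq_pow_sum]
    exact Finset.prod_congr rfl fun i _ => card_quotient_pow _
  have h1 := vol_preimage_eq_mul b (Set.univ : Set ((i : Fin n) → 𝒪[K] ⧸ 𝓂[K] ^ b i))
  rw [Set.preimage_univ, vol_univ, hcard] at h1
  rw [vol_preimage_eq_mul, mul_assoc, mul_comm (vol _), ← Nat.cast_pow, ← h1, mul_one]

/-- Two unions of residue classes, for possibly different moduli, consist of equally many classes if
they are parametrised by the same set in such a way that congruences correspond. -/
lemma vol_mul_eq_vol_mul {Ω : Type*} (p p' : Ω → Fin n → 𝒪[K]) (b b' : Fin n → ℕ)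
    (h : ∀ ω ω', reduceVec b (p ω) = reduceVec b (p ω') ↔
      reduceVec b' (p' ω) = reduceVec b' (p' ω')) :
    vol {y | ∃ ω, reduceVec b y = reduceVec b (p ω)} * (qK K : ENNReal) ^ (∑ i, b i) =
      vol {y | ∃ ω, reduceVec b' y = reduceVec b' (p' ω)} * (qK K : ENNReal) ^ (∑ i, b' i) := by
  have hset : ∀ (b : Fin n → ℕ) (p : Ω → Fin n → 𝒪[K]),
      {y | ∃ ω, reduceVec b y = reduceVec b (p ω)} =
        reduceVec b ⁻¹' Set.range fun ω => reduceVec b (p ω) := by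
    intro b p
    ext y
    exact ⟨fun ⟨ω, hω⟩ => ⟨ω, hω.symm⟩, fun ⟨ω, hω⟩ => ⟨ω, hω.symm⟩⟩
  rw [hset, hset, vol_preimage_mul, vol_preimage_mul, ← Nat.card_coe_set_eq, ← Nat.card_coe_set_eq]
  congr 1
  refine Nat.card_congr ?_
  exact (Setoid.quotientKerEquivRange (fun ω => reduceVec b (p ω))).symm.trans
    ((Quotient.congrRight fun ω ω' => h ω ω').trans
      (Setoid.quotientKerEquivRange fun ω => reduceVec b' (p' ω)))

end Volume

/-! ### A multivariate form of Hensel's lemma -/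

section Hensel

variable {A : Type*} [CommRing A] {n : ℕ} {I : Ideal A}

/-- The values of a Laurent polynomial at congruent points are congruent. -/
lemma evalHom_sub_mem {x y : Fin n → Aˣ} (h : ∀ i, (x i : A) - y i ∈ I) (G : Laurent A n) :
    evalHom (RingHom.id A) x G - evalHom (RingHom.id A) y G ∈ I := by
  rw [← Ideal.Quotient.eq, map_evalHom, map_evalHom]
  congr 2
  funext i
  exact Units.ext (Ideal.Quotient.eq.2 (h i))

lemma prod_zpow_sub_mem {x y : Fin n → Aˣ} (h : ∀ i, (x i : A) - y i ∈ I) (α : Fin n → ℤ) :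
    ((∏ i, x i ^ α i : Aˣ) : A) - ((∏ i, y i ^ α i : Aˣ) : A) ∈ I := by
  have := evalHom_sub_mem h (AddMonoidAlgebra.single α 1)
  rwa [evalHom_single, evalHom_single, map_one, one_mul, one_mul] at this

/-- First order expansion of a monomial: the difference of the values at `x` and `y` is
`u^α ∑ αᵢ uᵢ⁻¹ (xᵢ - yᵢ)` up to an error of higher order. -/
lemma prod_zpow_sub_sub_mem {x y u : Fin n → Aˣ} {N : ℕ} (hN : 1 ≤ N)
    (hxy : ∀ i, (x i : A) - y i ∈ I ^ N) (hyu : ∀ i, (y i : A) - u i ∈ I) (α : Fin n → ℤ) :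
    ((∏ i, x i ^ α i : Aˣ) : A) - ((∏ i, y i ^ α i : Aˣ) : A) -
      ((∏ i, u i ^ α i : Aˣ) : A) * ∑ i, (α i : A) * (((u i)⁻¹ : Aˣ) : A) * ((x i : A) - y i) ∈
        I ^ (N + 1) := by
  have hxu : ∀ i, (x i : A) - u i ∈ I := fun i => by
    have := I.add_mem (Ideal.pow_le_self (by omega) (hxy i)) (hyu i)
    rwa [sub_add_sub_cancel] at this
  let L : (Fin n → ℤ) → A := fun α => ∑ i, (α i : A) * (((u i)⁻¹ : Aˣ) : A) * ((x i : A) - y i)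
  have hL : ∀ α, L α ∈ I ^ N := fun α => Ideal.sum_mem _ fun i _ => Ideal.mul_mem_left _ _ (hxy i)
  have hLadd : ∀ α β, L (α + β) = L α + L β := fun α β => by
    simp only [L, ← Finset.sum_add_distrib]
    refine Finset.sum_congr rfl fun i _ => ?_
    push_cast [Pi.add_apply]
    ring
  have hadd : ∀ (z : Fin n → Aˣ) (α β : Fin n → ℤ),
      (∏ i, z i ^ (α + β) i) = (∏ i, z i ^ α i) * ∏ i, z i ^ β i := fun z α β => by
    simp only [Pi.add_apply, zpow_add, Finset.prod_mul_distrib]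
  let H : AddSubgroup (Fin n → ℤ) :=
    { carrier := {α | ((∏ i, x i ^ α i : Aˣ) : A) - ((∏ i, y i ^ α i : Aˣ) : A) -
        ((∏ i, u i ^ α i : Aˣ) : A) * L α ∈ I ^ (N + 1)}
      zero_mem' := by simp [L]
      add_mem' := by
        intro α β hα hβ
        change _ ∈ I ^ (N + 1) at hα hβ
        have h1 : (((∏ i, x i ^ α i : Aˣ) : A) - ((∏ i, u i ^ α i : Aˣ) : A)) *
            (((∏ i, u i ^ β i : Aˣ) : A) * L β) ∈ I ^ (N + 1) := by
          rw [pow_succ']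
          exact Ideal.mul_mem_mul (prod_zpow_sub_mem hxu α) (Ideal.mul_mem_left _ _ (hL β))
        have h2 : (((∏ i, y i ^ β i : Aˣ) : A) - ((∏ i, u i ^ β i : Aˣ) : A)) *
            (((∏ i, u i ^ α i : Aˣ) : A) * L α) ∈ I ^ (N + 1) := by
          rw [pow_succ']
          exact Ideal.mul_mem_mul (prod_zpow_sub_mem hyu β) (Ideal.mul_mem_left _ _ (hL α))
        have h3 := Ideal.mul_mem_left _ ((∏ i, x i ^ α i : Aˣ) : A) hβ
        have h4 := Ideal.mul_mem_left _ ((∏ i, y i ^ β i : Aˣ) : A) hα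
        change _ ∈ I ^ (N + 1)
        rw [hadd, hadd, hadd, hLadd]
        have := add_mem (add_mem h1 h2) (add_mem h3 h4)
        convert this using 1
        push_cast
        ring
      neg_mem' := by
        intro α hα
        have hneg : ∀ z : Fin n → Aˣ, (∏ i, z i ^ (-α) i) = (∏ i, z i ^ α i)⁻¹ := fun z => by
          simp
        have hLneg : L (-α) = -L α := by
          have := hLadd α (-α)
          rw [add_neg_cancel, show L 0 = 0 by simp [L]] at this
          exact (neg_eq_of_add_eq_zero_right this.symm).symm
        change _ ∈ I ^ (N + 1)
        rw [hneg, hneg, hneg, hLneg]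
        have hxα := prod_zpow_sub_mem hxu α
        have hyα := prod_zpow_sub_mem hyu α
        change ((∏ i, x i ^ α i : Aˣ) : A) - ((∏ i, y i ^ α i : Aˣ) : A) -
          ((∏ i, u i ^ α i : Aˣ) : A) * L α ∈ I ^ (N + 1) at hα
        generalize (∏ i, x i ^ α i) = a at *
        generalize (∏ i, y i ^ α i) = b at *
        generalize (∏ i, u i ^ α i) = c at *
        -- `a⁻¹ - b⁻¹ + c⁻¹ L = -a⁻¹ b⁻¹ (a - b - c L) + a⁻¹ b⁻¹ c⁻¹ (a b - c²) L`
        have h1 := Ideal.mul_mem_left _ (-((a⁻¹ : Aˣ) : A) * ((b⁻¹ : Aˣ) : A)) hα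
        have h2 : ((a : A) * (b - c) + (a - c) * c) * (((a⁻¹ : Aˣ) : A) * ((b⁻¹ : Aˣ) : A) *
            ((c⁻¹ : Aˣ) : A) * L α) ∈ I ^ (N + 1) := by
          rw [pow_succ']
          exact Ideal.mul_mem_mul (add_mem (Ideal.mul_mem_left _ _ hyα)
            (Ideal.mul_mem_right _ _ hxα)) (Ideal.mul_mem_left _ _ (hL α))
        have := add_mem h1 h2
        convert this using 1
        have ha := a.mul_inv
        have hb := b.mul_inv
        have hc := c.mul_inv
        generalize ((a⁻¹ : Aˣ) : A) = a' at *
        generalize ((b⁻¹ : Aˣ) : A) = b' at *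
        generalize ((c⁻¹ : Aˣ) : A) = c' at *
        linear_combination (b' - L α * b * b' * c') * ha - (a' + L α * c') * hb +
          (L α * c * a' * b') * hc }
  have htop : ∀ α : Fin n → ℤ, α ∈ H := by
    intro α
    rw [← Finset.univ_sum_single α]
    refine AddSubgroup.sum_mem _ fun i _ => ?_
    rw [show (Pi.single i (α i) : Fin n → ℤ) = α i • Pi.single i 1 by
      rw [← Pi.single_smul, smul_eq_mul, mul_one]]
    refine AddSubgroup.zsmul_mem _ ?_ _
    have hsingle : ∀ z : Fin n → Aˣ, (∏ j, z j ^ (Pi.single i 1 : Fin n → ℤ) j) = z i := fun z => by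
      rw [Finset.prod_eq_single i]
      · simp
      · intro j _ hj
        simp [hj]
      · simp
    have hLs : L (Pi.single i 1) = (((u i)⁻¹ : Aˣ) : A) * ((x i : A) - y i) := by
      simp only [L]
      rw [Finset.sum_eq_single i]
      · simp
      · intro j _ hj
        simp [hj]
      · simp
    change _ ∈ I ^ (N + 1)
    rw [hsingle, hsingle, hsingle, hLs, Units.mul_inv_cancel_left, sub_self]
    exact zero_mem _
  exact htop α

/-- First order expansion of a Laurent polynomial. -/
lemma evalHom_sub_sub_mem {x y u : Fin n → Aˣ} {N : ℕ} (hN : 1 ≤ N)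
    (hxy : ∀ i, (x i : A) - y i ∈ I ^ N) (hyu : ∀ i, (y i : A) - u i ∈ I) (G : Laurent A n) :
    evalHom (RingHom.id A) x G - evalHom (RingHom.id A) y G -
      ∑ i, evalHom (RingHom.id A) u (pderiv i G) * ((x i : A) - y i) ∈ I ^ (N + 1) := by
  induction G using AddMonoidAlgebra.induction_linear with
  | zero => simp
  | add f g hf hg =>
    have := add_mem hf hg
    convert this using 1
    simp only [map_add, add_mul, Finset.sum_add_distrib]
    ring
  | single α c =>
    have := Ideal.mul_mem_left _ c (prod_zpow_sub_sub_mem hN hxy hyu α)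
    convert this using 1
    simp only [evalHom_single, evalHom_pderiv_single, RingHom.id_apply, mul_sub, Finset.mul_sum]
    congr 1
    refine Finset.sum_congr rfl fun i _ => ?_
    ring

variable {ι : Type*}

/-- The local coordinates at `u` in which the functions `G j` replace the variables `e j`, the other
variables being centred at `u`. -/
def localCoord (G : ι → Laurent A n) (e : ι → Fin n) (u x : Fin n → Aˣ) : Fin n → A :=
  Function.extend e (fun j => evalHom (RingHom.id A) x (G j)) fun i => (x i : A) - u i

lemma localCoord_apply {G : ι → Laurent A n} {e : ι → Fin n} (he : Function.Injective e)
    (u x : Fin n → Aˣ) (j : ι) : localCoord G e u x (e j) = evalHom (RingHom.id A) x (G j) :=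
  he.extend_apply _ _ _

lemma localCoord_apply_of_notMem {G : ι → Laurent A n} {e : ι → Fin n} (u x : Fin n → Aˣ)
    {i : Fin n} (hi : ¬∃ j, e j = i) : localCoord G e u x i = x i - u i :=
  Function.extend_apply' _ _ _ hi

variable [Fintype ι] [DecidableEq ι]

/-- The Jacobian minor of `G` at `u` for the variables `e`. -/
def minorAt (G : ι → Laurent A n) (e : ι → Fin n) (u : Fin n → Aˣ) : Matrix ι ι A :=
  Matrix.of fun a b => evalHom (RingHom.id A) u (pderiv (e a) (G b))

lemma injective_of_isUnit_det [Nontrivial A] {G : ι → Laurent A n} {e : ι → Fin n}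
    {u : Fin n → Aˣ} (hdet : IsUnit (minorAt G e u).det) : Function.Injective e := by
  intro a b hab
  by_contra hne
  refine hdet.ne_zero (Matrix.det_zero_of_row_eq hne ?_)
  funext c
  simp [minorAt, hab]

lemma mem_of_mulVec_mem {M : Matrix ι ι A} (hM : IsUnit M.det) {v : ι → A} {I : Ideal A}
    (h : ∀ i, (M *ᵥ v) i ∈ I) (i : ι) : v i ∈ I := by
  have : v = M⁻¹ *ᵥ (M *ᵥ v) := by
    rw [Matrix.mulVec_mulVec, Matrix.nonsing_inv_mul _ hM, Matrix.one_mulVec]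
  rw [this]
  exact Ideal.sum_mem _ fun j _ => Ideal.mul_mem_left _ _ (h j)

/-- The coordinates `localCoord` detect congruences. -/
lemma sub_mem_iff_localCoord_sub_mem {G : ι → Laurent A n} {e : ι → Fin n} {u : Fin n → Aˣ}
    (he : Function.Injective e) (hdet : IsUnit (minorAt G e u).det) {x y : Fin n → Aˣ}
    (hx : ∀ i, (x i : A) - u i ∈ I) (hy : ∀ i, (y i : A) - u i ∈ I) (N : ℕ) :
    (∀ i, (x i : A) - y i ∈ I ^ N) ↔
      ∀ i, localCoord G e u x i - localCoord G e u y i ∈ I ^ N := by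
  constructor
  · intro h i
    by_cases hi : ∃ j, e j = i
    · obtain ⟨j, rfl⟩ := hi
      rw [localCoord_apply he, localCoord_apply he]
      exact evalHom_sub_mem h _
    · rw [localCoord_apply_of_notMem _ _ hi, localCoord_apply_of_notMem _ _ hi, sub_sub_sub_cancel_right]
      exact h i
  · intro h
    suffices H : ∀ M, M ≤ N → ∀ i, (x i : A) - y i ∈ I ^ M from H N le_rfl
    intro M
    induction M with
    | zero => simp
    | succ M ih =>
      intro hM
      rcases Nat.eq_zero_or_pos M with rfl | hM0
      · intro i
        have := I.sub_mem (hx i) (hy i)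
        rwa [sub_sub_sub_cancel_right, ← pow_one I] at this
      have h1 := ih (by omega)
      have hout : ∀ i, (¬∃ j, e j = i) → (x i : A) - y i ∈ I ^ (M + 1) := fun i hi => by
        have := Ideal.pow_le_pow_right hM (h i)
        rwa [localCoord_apply_of_notMem _ _ hi, localCoord_apply_of_notMem _ _ hi,
          sub_sub_sub_cancel_right] at this
      have hin : ∀ j, (x (e j) : A) - y (e j) ∈ I ^ (M + 1) := by
        refine mem_of_mulVec_mem (M := (minorAt G e u)ᵀ) (by rwa [Matrix.det_transpose])
          (v := fun j => (x (e j) : A) - y (e j)) fun j => ?_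
        have h2 := evalHom_sub_sub_mem hM0 h1 hy (G j)
        have h3 := Ideal.pow_le_pow_right hM (h (e j))
        rw [localCoord_apply he, localCoord_apply he] at h3
        have h4 := sub_mem h3 h2
        rw [sub_sub_cancel] at h4
        have h5 : ((minorAt G e u)ᵀ *ᵥ fun j => (x (e j) : A) - y (e j)) j =
            ∑ i ∈ Finset.univ.image e,
              evalHom (RingHom.id A) u (pderiv i (G j)) * ((x i : A) - y i) := by
          rw [Finset.sum_image he.injOn]
          rfl
        rw [h5]
        rw [← Finset.sum_add_sum_compl (Finset.univ.image e)] at h4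
        refine (Ideal.add_mem_iff_left _ (Ideal.sum_mem _ fun i hi => ?_)).1 h4
        refine Ideal.mul_mem_left _ _ (hout i ?_)
        simpa using hi
      intro i
      by_cases hi : ∃ j, e j = i
      · obtain ⟨j, rfl⟩ := hi
        exact hin j
      · exact hout i hi

/-- A self-map of a set which does not identify distinct classes, of which there are finitely many,
meets all classes. -/
lemma exists_class_eq {X Y : Type*} [Finite Y] (ρ : X → Y) (f : X → X)
    (h : ∀ x x', ρ (f x) = ρ (f x') → ρ x = ρ x') (x : X) : ∃ x', ρ (f x') = ρ x := by
  have hsec : ∀ t : Set.range ρ, ∃ x, ρ x = t := fun t => t.2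
  choose σ hσ using hsec
  have hinj : Function.Injective fun t : Set.range ρ =>
      (⟨ρ (f (σ t)), Set.mem_range_self _⟩ : Set.range ρ) := by
    intro t t' htt'
    have := h _ _ (congrArg Subtype.val htt')
    rw [hσ, hσ] at this
    exact Subtype.ext this
  obtain ⟨t, ht⟩ := Finite.injective_iff_surjective.1 hinj ⟨ρ x, Set.mem_range_self x⟩
  exact ⟨_, congrArg Subtype.val ht⟩

end Hensel

/-! ### Volumes of solution sets near a smooth point -/

section LocalVolume

variable {K : Type*} [Field K] [ValuativeRel K] {n : ℕ} {ι : Type*}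

lemma exists_units_eq_add (u : Fin n → 𝒪[K]ˣ) {v : Fin n → 𝒪[K]} (hv : ∀ i, v i ∈ 𝓂[K]) :
    ∃ x : Fin n → 𝒪[K]ˣ, ∀ i, (x i : 𝒪[K]) = u i + v i := by
  have h : ∀ i, IsUnit ((u i : 𝒪[K]) + v i) := by
    intro i
    by_contra hi
    have h1 := Ideal.sub_mem _ ((IsLocalRing.mem_maximalIdeal _).2 hi) (hv i)
    rw [add_sub_cancel_right, IsLocalRing.mem_maximalIdeal] at h1
    exact h1 (u i).isUnit
  exact ⟨fun i => (h i).unit, fun i => (h i).unit_spec⟩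

variable [TopologicalSpace K] [IsNonarchimedeanLocalField K]

/-- The points of valuation `ξ` which, after division by the powers of the uniformiser, are congruent
to `u` and satisfy `G j ≡ 0` modulo `𝔓^{a j}`. -/
def residuePiece (ξ : Fin n → ℕ) (u : Fin n → 𝒪[K]ˣ) (G : ι → Laurent 𝒪[K] n) (a : ι → ℕ) :
    Set (Fin n → K) :=
  {x | ∃ w : Fin n → 𝒪[K]ˣ, (∀ i, x i = unif K ^ ξ i * ((w i : 𝒪[K]) : K)) ∧
    (∀ i, (w i : 𝒪[K]) - u i ∈ 𝓂[K]) ∧ ∀ j, evalHom (RingHom.id _) w (G j) ∈ 𝓂[K] ^ a j}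

lemma localCoord_mem {G : ι → Laurent 𝒪[K] n} {e : ι → Fin n} (he : Function.Injective e)
    {u x : Fin n → 𝒪[K]ˣ} (hG : ∀ j, evalHom (RingHom.id _) u (G j) ∈ 𝓂[K])
    (hx : ∀ i, (x i : 𝒪[K]) - u i ∈ 𝓂[K]) (i : Fin n) : localCoord G e u x i ∈ 𝓂[K] := by
  by_cases hi : ∃ j, e j = i
  · obtain ⟨j, rfl⟩ := hi
    rw [localCoord_apply he]
    have := Ideal.add_mem _ (evalHom_sub_mem hx (G j)) (hG j)
    rwa [sub_add_cancel] at this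
  · rw [localCoord_apply_of_notMem _ _ hi]
    exact hx i

/-- Membership in `residuePiece` only depends on residue classes. -/
lemma residuePiece_eq_image [Finite ι] (ξ : Fin n → ℕ) (u : Fin n → 𝒪[K]ˣ)
    (G : ι → Laurent 𝒪[K] n) (a : ι → ℕ) {N : ℕ} (hN : 1 ≤ N) (haN : ∀ j, a j ≤ N) :
    residuePiece ξ u G a = intVec '' {y | ∃ w : {w : Fin n → 𝒪[K]ˣ //
      (∀ i, (w i : 𝒪[K]) - u i ∈ 𝓂[K]) ∧ ∀ j, evalHom (RingHom.id _) w (G j) ∈ 𝓂[K] ^ a j},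
        reduceVec (fun i => N + ξ i) y =
          reduceVec (fun i => N + ξ i) fun i => unifO K ^ ξ i * (w.1 i : 𝒪[K])} := by
  ext x
  constructor
  · rintro ⟨w, hw, hwu, hwG⟩
    exact ⟨fun i => unifO K ^ ξ i * (w i : 𝒪[K]), ⟨⟨w, hwu, hwG⟩, rfl⟩, funext fun i => (hw i).symm⟩
  · rintro ⟨y, ⟨⟨w, hwu, hwG⟩, hy⟩, rfl⟩
    rw [reduceVec_eq_iff] at hy
    have h1 : ∀ i, ∃ z : 𝒪[K], z ∈ 𝓂[K] ^ N ∧ y i = unifO K ^ ξ i * ((w i : 𝒪[K]) + z) := by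
      intro i
      have hp : unif K ^ ξ i ≠ 0 := pow_ne_zero _ unif_ne_zero
      obtain ⟨z, hz⟩ : ∃ z : 𝒪[K], y i - unifO K ^ ξ i * (w i : 𝒪[K]) = unifO K ^ ξ i * z := by
        by_cases h0 : ((y i - unifO K ^ ξ i * (w i : 𝒪[K]) : 𝒪[K]) : K) = 0
        · exact ⟨0, by rw [mul_zero]; exact Subtype.ext h0⟩
        · have h2 := (mem_maximalIdeal_pow h0 _).1 (hy i)
          refine ⟨⟨(unif K ^ ξ i)⁻¹ * (y i - unifO K ^ ξ i * (w i : 𝒪[K]) : 𝒪[K]), ?_⟩,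
            Subtype.ext (mul_inv_cancel_left₀ hp _).symm⟩
          rw [mem_integer_iff (mul_ne_zero (inv_ne_zero hp) h0), nuK_mul (inv_ne_zero hp) h0,
            nuK_inv hp, nuK_pow unif_ne_zero, nuK_unif]
          rw [Nat.cast_add] at h2
          linarith
      refine ⟨z, ?_, ?_⟩
      · have h2 := hy i
        simp only [] at h2
        rwa [hz, unifO_pow_mul_mem] at h2
      · rw [mul_add, ← hz]
        ring
    choose z hz hyz using h1
    have hzm : ∀ i, z i ∈ 𝓂[K] := fun i => Ideal.pow_le_self (by omega) (hz i)
    obtain ⟨x, hx⟩ := exists_units_eq_add w hzm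
    have hxw : ∀ i, (x i : 𝒪[K]) - w i = z i := fun i => by rw [hx, add_sub_cancel_left]
    refine ⟨x, fun i => ?_, fun i => ?_, fun j => ?_⟩
    · rw [hx, ← coe_unifO, intVec, hyz]
      rfl
    · have := Ideal.add_mem _ (hzm i) (hwu i)
      rwa [← hxw, sub_add_sub_cancel] at this
    · have h2 := evalHom_sub_mem (I := 𝓂[K] ^ N) (fun i => by rw [hxw]; exact hz i) (G j)
      have h3 := Ideal.add_mem _ (Ideal.pow_le_pow_right (haN j) h2) (hwG j)
      rwa [sub_add_cancel] at h3

lemma isOpen_residuePiece [Finite ι] (ξ : Fin n → ℕ) (u : Fin n → 𝒪[K]ˣ)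
    (G : ι → Laurent 𝒪[K] n) (a : ι → ℕ) : IsOpen (residuePiece ξ u G a) := by
  obtain ⟨N, hN⟩ := (Set.finite_range a).bddAbove
  rw [residuePiece_eq_image ξ u G a (N := N + 1) (by omega)
    fun j => (hN (Set.mem_range_self j)).trans (by omega)]
  have := isOpen_intVec_preimage (K := K) (fun i => N + 1 + ξ i)
    {t | ∃ w : {w : Fin n → 𝒪[K]ˣ //
      (∀ i, (w i : 𝒪[K]) - u i ∈ 𝓂[K]) ∧ ∀ j, evalHom (RingHom.id _) w (G j) ∈ 𝓂[K] ^ a j},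
        t = reduceVec (fun i => N + 1 + ξ i) fun i => unifO K ^ ξ i * (w.1 i : 𝒪[K])}
  exact this

variable [Fintype ι] [DecidableEq ι]

/-- Hensel's lemma: near a smooth point, the coordinates `localCoord` take all values. -/
lemma exists_localCoord_sub_mem {G : ι → Laurent 𝒪[K] n} {e : ι → Fin n} {u : Fin n → 𝒪[K]ˣ}
    (he : Function.Injective e) (hdet : IsUnit (minorAt G e u).det)
    (hG : ∀ j, evalHom (RingHom.id _) u (G j) ∈ 𝓂[K]) {v : Fin n → 𝒪[K]} (hv : ∀ i, v i ∈ 𝓂[K])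
    (N : ℕ) : ∃ x : Fin n → 𝒪[K]ˣ, (∀ i, (x i : 𝒪[K]) - u i ∈ 𝓂[K]) ∧
      ∀ i, localCoord G e u x i - v i ∈ 𝓂[K] ^ N := by
  choose x hx using fun v : {v : Fin n → 𝒪[K] // ∀ i, v i ∈ 𝓂[K]} => exists_units_eq_add u v.2
  have hxu : ∀ v i, (x v i : 𝒪[K]) - u i ∈ 𝓂[K] := fun v i => by
    rw [hx, add_sub_cancel_left]
    exact v.2 i
  obtain ⟨w, hw⟩ := exists_class_eq
    (fun v : {v : Fin n → 𝒪[K] // ∀ i, v i ∈ 𝓂[K]} => reduceVec (fun _ => N) v.1)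
    (fun v => ⟨localCoord G e u (x v), localCoord_mem he hG (hxu v)⟩) (fun v v' h => by
      rw [reduceVec_eq_iff] at h ⊢
      have := (sub_mem_iff_localCoord_sub_mem he hdet (hxu v) (hxu v') N).2 h
      intro i
      have h2 := this i
      rwa [hx, hx, add_sub_add_left_eq_sub] at h2) ⟨v, hv⟩
  exact ⟨x w, hxu w, reduceVec_eq_iff.1 hw⟩

variable [MeasurableSpace (Fin n → K)] [BorelSpace (Fin n → K)]

/-- The volume of `residuePiece` at a smooth point of the special fibre. -/
lemma haarK_residuePiece_mul (ξ : Fin n → ℕ) {u : Fin n → 𝒪[K]ˣ} {G : ι → Laurent 𝒪[K] n}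
    {e : ι → Fin n} (hdet : IsUnit (minorAt G e u).det)
    (hG : ∀ j, evalHom (RingHom.id _) u (G j) ∈ 𝓂[K]) {a : ι → ℕ} (ha : ∀ j, 1 ≤ a j) :
    haarK K n (residuePiece ξ u G a) *
      (qK K : ENNReal) ^ (∑ i, ξ i + (∑ j, a j + (n - Fintype.card ι))) = 1 := by
  have he := injective_of_isUnit_det hdet
  have hq0 : (qK K : ENNReal) ≠ 0 := by
    exact_mod_cast (zero_lt_one.trans (one_lt_qK (K := K))).ne'
  have hqt : (qK K : ENNReal) ≠ ⊤ := ENNReal.natCast_ne_top _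
  let N := ∑ j, a j + 1
  have haN : ∀ j, a j ≤ N := fun j =>
    (Finset.single_le_sum (fun _ _ => Nat.zero_le _) (Finset.mem_univ j)).trans (Nat.le_succ _)
  let Ω := {w : Fin n → 𝒪[K]ˣ //
    (∀ i, (w i : 𝒪[K]) - u i ∈ 𝓂[K]) ∧ ∀ j, evalHom (RingHom.id _) w (G j) ∈ 𝓂[K] ^ a j}
  let c : Fin n → ℕ := Function.extend e a fun _ => 1
  have hcN : ∀ i, c i ≤ N := by
    intro i
    by_cases hi : ∃ j, e j = i
    · obtain ⟨j, rfl⟩ := hi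
      simp only [c, he.extend_apply]
      exact haN j
    · simp only [c, Function.extend_apply' _ _ _ hi]
      exact Nat.le_add_left _ _
  have hcsum : ∑ i, c i = ∑ j, a j + (n - Fintype.card ι) := by
    rw [← Finset.sum_add_sum_compl (Finset.univ.image e), Finset.sum_image he.injOn]
    congr 1
    · exact Finset.sum_congr rfl fun j _ => he.extend_apply _ _ _
    · rw [Finset.sum_congr rfl fun i hi => Function.extend_apply' a (fun _ => 1) i
        (by simpa using hi)]
      rw [Finset.sum_const, Finset.card_compl, Finset.card_image_of_injective _ he]
      simp
  have hcmem : ∀ w : Fin n → 𝒪[K]ˣ, (∀ i, (w i : 𝒪[K]) - u i ∈ 𝓂[K]) →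
      ((∀ j, evalHom (RingHom.id _) w (G j) ∈ 𝓂[K] ^ a j) ↔
        ∀ i, localCoord G e u w i ∈ 𝓂[K] ^ c i) := by
    intro w hw
    constructor
    · intro h i
      by_cases hi : ∃ j, e j = i
      · obtain ⟨j, rfl⟩ := hi
        simp only [c, he.extend_apply, localCoord_apply he]
        exact h j
      · simp only [c, Function.extend_apply' _ _ _ hi, localCoord_apply_of_notMem _ _ hi, pow_one]
        exact hw i
    · intro h j
      have := h (e j)
      simp only [c, he.extend_apply, localCoord_apply he] at this
      exact this
  have key := vol_mul_eq_vol_mul (fun (w : Ω) i => unifO K ^ ξ i * (w.1 i : 𝒪[K]))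
    (fun w => localCoord G e u w.1) (fun i => N + ξ i) (fun _ => N) (fun w w' => by
      rw [reduceVec_eq_iff, reduceVec_eq_iff,
        ← sub_mem_iff_localCoord_sub_mem he hdet w.2.1 w'.2.1 N]
      refine forall_congr' fun i => ?_
      rw [← mul_sub, unifO_pow_mul_mem])
  have hbox : {y | ∃ w : Ω, reduceVec (fun _ => N) y = reduceVec (fun _ => N) (localCoord G e u w.1)}
      = reduceVec c ⁻¹' {0} := by
    ext y
    have hy0 : y ∈ reduceVec c ⁻¹' {0} ↔ ∀ i, y i ∈ 𝓂[K] ^ c i := by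
      rw [Set.mem_preimage, Set.mem_singleton_iff, ← map_zero (reduceVec c), reduceVec_eq_iff]
      simp
    rw [hy0]
    constructor
    · rintro ⟨w, hw⟩ i
      have h1 := Ideal.pow_le_pow_right (hcN i) (reduceVec_eq_iff.1 hw i)
      have h2 := Ideal.add_mem _ h1 ((hcmem w.1 w.2.1).1 w.2.2 i)
      rwa [sub_add_cancel] at h2
    · intro hy
      have hc1 : ∀ i, c i ≠ 0 := by
        intro i
        by_cases hi : ∃ j, e j = i
        · obtain ⟨j, rfl⟩ := hi
          simp only [c, he.extend_apply]
          have := ha j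
          omega
        · simp only [c, Function.extend_apply' _ _ _ hi]
          exact one_ne_zero
      obtain ⟨x, hxu, hx⟩ := exists_localCoord_sub_mem he hdet hG
        (fun i => Ideal.pow_le_self (hc1 i) (hy i)) N
      refine ⟨⟨x, hxu, (hcmem x hxu).2 fun i => ?_⟩, ?_⟩
      · have h2 := Ideal.add_mem _ (Ideal.pow_le_pow_right (hcN i) (hx i)) (hy i)
        rwa [sub_add_cancel] at h2
      · exact (reduceVec_eq_iff.2 hx).symm
  rw [hbox, Finset.sum_add_distrib, pow_add, ← mul_assoc, mul_right_comm] at key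
  have hne : (qK K : ENNReal) ^ (∑ i : Fin n, N) ≠ 0 := pow_ne_zero _ hq0
  have hnt : (qK K : ENNReal) ^ (∑ i : Fin n, N) ≠ ⊤ := ENNReal.pow_ne_top hqt
  have key2 := (ENNReal.mul_left_inj hne hnt).1 key
  have hbv := vol_preimage_mul (K := K) c {0}
  rw [Set.ncard_singleton, ← key2] at hbv
  rw [residuePiece_eq_image ξ u G a (Nat.le_add_left 1 _) haN, pow_add, ← mul_assoc, ← hcsum]
  rw [Nat.cast_one] at hbv
  exact hbv

end LocalVolume

/-! ### Integrality away from finitely many primes, and reduction -/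

/-- Finitely many elements of a number field are integral at all but finitely many primes. -/
lemma exists_finite_primes_forall_integral {k : Type*} [Field k] [NumberField k] (s : Finset k) :
    ∃ S : Set (Ideal (𝓞 k)), S.Finite ∧ ∀ (K : Type*) [Field K] [ValuativeRel K] [Algebra k K],
      primeBelow k K ∉ S → ∀ c ∈ s, algebraMap k K c ∈ 𝒪[K] := by
  obtain ⟨b, hb⟩ := IsLocalization.exist_integer_multiples_of_finset (nonZeroDivisors (𝓞 k)) s
  have hb0 : (b : 𝓞 k) ≠ 0 := nonZeroDivisors.coe_ne_zero b
  refine ⟨{P | (b : 𝓞 k) ∈ P}, ?_, ?_⟩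
  · have hspan : Ideal.span {(b : 𝓞 k)} ≠ 0 := by simp [hb0]
    let : Fintype {P // P ∣ Ideal.span {(b : 𝓞 k)}} :=
      UniqueFactorizationMonoid.fintypeSubtypeDvd (Ideal.span {(b : 𝓞 k)}) hspan
    have hfin : {P : Ideal (𝓞 k) | P ∣ Ideal.span {(b : 𝓞 k)}}.Finite :=
      Set.finite_coe_iff.1 (inferInstanceAs (Finite {P // P ∣ Ideal.span {(b : 𝓞 k)}}))
    refine hfin.subset fun P hP => ?_
    exact Ideal.dvd_iff_le.2 ((Ideal.span_singleton_le_iff_mem _).2 hP)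
  · intro K _ _ _ hK c hc
    obtain ⟨a, ha⟩ := hb c hc
    have hu : IsUnit (integersHom k K b) := by
      by_contra h
      exact hK (Ideal.mem_comap.2 ((IsLocalRing.mem_maximalIdeal _).2 h))
    obtain ⟨v, hv⟩ := hu.exists_left_inv
    have h1 : algebraMap k K c = ((v * integersHom k K a : 𝒪[K]) : K) := by
      have h2 : (v : K) * algebraMap k K ((b : 𝓞 k) : k) = 1 := congrArg Subtype.val hv
      have h3 : algebraMap k K ((a : 𝓞 k) : k) =
          algebraMap k K ((b : 𝓞 k) : k) * algebraMap k K c := by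
        rw [← map_mul]
        exact congrArg _ ha
      change _ = (v : K) * algebraMap k K ((a : 𝓞 k) : k)
      rw [h3, ← mul_assoc, h2, one_mul]
    rw [h1]
    exact Subtype.mem _

section Reduction

variable (k K : Type*) [Field k] [Field K] [ValuativeRel K] [Algebra k K]

/-- The elements of `k` which are integral at `𝔓_K`. -/
def integralAt : Subring k := 𝒪[K].comap (algebraMap k K)

/-- The inclusion of the elements integral at `𝔓_K` into the valuation ring. -/
def integralHom : integralAt k K →+* 𝒪[K] :=
  ((algebraMap k K).comp (integralAt k K).subtype).codRestrict 𝒪[K] fun c => c.2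

/-- Reduction modulo `𝔓_K`. -/
def reduceHom : integralAt k K →+* 𝓀[K] := (IsLocalRing.residue 𝒪[K]).comp (integralHom k K)

variable {k K}

lemma coe_integralHom (c : integralAt k K) : ((integralHom k K c : 𝒪[K]) : K) = algebraMap k K c :=
  rfl

lemma reduceCoeff_coe (c : integralAt k K) : reduceCoeff K (c : k) = reduceHom k K c :=
  dif_pos c.2

/-- Evaluation of the reduction of a Laurent polynomial with integral coefficients. -/
lemma laurentEval_reduceCoeff {d : ℕ} {u : Fin d → 𝓀[K]} (hu : ∀ i, u i ≠ 0)
    (g : Laurent (integralAt k K) d) :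
    laurentEval (reduceCoeff K) u (AddMonoidAlgebra.mapRingHom _ (integralAt k K).subtype g) =
      evalHom (reduceHom k K) (fun i => Units.mk0 (u i) (hu i)) g := by
  rw [evalHom_eq_sum, laurentEval]
  have h0 : reduceCoeff K (0 : k) = 0 := by
    have := reduceCoeff_coe (0 : integralAt k K)
    rwa [map_zero] at this
  change (Finsupp.mapRange (integralAt k K).subtype (map_zero _) g.coeff).sum _ = _
  rw [Finsupp.sum_mapRange_index fun α => by rw [h0, zero_mul]]
  refine Finsupp.sum_congr fun α _ => ?_
  rw [Subring.subtype_apply, reduceCoeff_coe]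
  simp [Units.coe_prod]

/-- The number of points of the reduction, in terms of points with unit coordinates. -/
lemma numPoints_eq {d r : ℕ} (I : Finset (Fin r)) (g : Fin r → Laurent k d)
    (g' : Fin r → Laurent (integralAt k K) d)
    (h : ∀ j ∈ I, AddMonoidAlgebra.mapRingHom _ (integralAt k K).subtype (g' j) = g j) :
    numPoints K I g = Nat.card {u : Fin d → 𝓀[K]ˣ // ∀ j ∈ I, evalHom (reduceHom k K) u (g' j) = 0} := by
  refine Nat.card_congr
    { toFun := fun u => ⟨fun i => Units.mk0 (u.1 i) (u.2.1 i), fun j hj => ?_⟩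
      invFun := fun u => ⟨fun i => u.1 i, fun i => (u.1 i).ne_zero, fun j hj => ?_⟩
      left_inv := fun u => rfl
      right_inv := fun u => by
        apply Subtype.ext
        funext i
        exact Units.ext rfl }
  · rw [← laurentEval_reduceCoeff u.2.1, h j hj]
    exact u.2.2 j hj
  · rw [← h j hj, laurentEval_reduceCoeff fun i => (u.1 i).ne_zero]
    have : (fun i => Units.mk0 (u.1 i : 𝓀[K]) (u.1 i).ne_zero) = u.1 := by
      funext i
      exact Units.ext rfl
    rw [this]
    exact u.2 j hj

lemma exists_unit_residue_eq {n : ℕ} (v : Fin n → 𝓀[K]ˣ) :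
    ∃ u : Fin n → 𝒪[K]ˣ, ∀ i, IsLocalRing.residue 𝒪[K] (u i) = v i := by
  choose u hu using fun i => IsLocalRing.surjective_units_map_of_local_ringHom
    (IsLocalRing.residue 𝒪[K]) Ideal.Quotient.mk_surjective inferInstance (v i)
  exact ⟨u, fun i => congrArg Units.val (hu i)⟩

end Reduction

/-! ### Rescaling a Laurent polynomial by powers of the uniformiser -/

section Tilt

variable {k K : Type*} [Field k] [Field K] [ValuativeRel K] [Algebra k K]
variable [TopologicalSpace K] [IsNonarchimedeanLocalField K] {n : ℕ}

/-- The Laurent polynomial `ϖ^{-e} f(ϖ^ξ X)` over the valuation ring, provided that `e` is a lower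
bound for `⟨α, ξ⟩` on the support of `f`. -/
def tilt (f : Laurent (integralAt k K) n) (ξ : Fin n → ℤ) (e : ℤ) : Laurent 𝒪[K] n :=
  AddMonoidAlgebra.ofCoeff (Finsupp.onFinset f.coeff.support
    (fun α => integralHom k K (f.coeff α) * unifO K ^ (α ⬝ᵥ ξ - e).toNat) fun α h => by
      rw [Finsupp.mem_support_iff]
      rintro h0
      rw [h0, map_zero, zero_mul] at h
      exact h rfl)

lemma coeff_tilt (f : Laurent (integralAt k K) n) (ξ : Fin n → ℤ) (e : ℤ) (α : Fin n → ℤ) :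
    (tilt f ξ e).coeff α = integralHom k K (f.coeff α) * unifO K ^ (α ⬝ᵥ ξ - e).toNat := rfl

lemma support_tilt_subset (f : Laurent (integralAt k K) n) (ξ : Fin n → ℤ) (e : ℤ) :
    (tilt f ξ e).coeff.support ⊆ f.coeff.support := by
  intro α h
  rw [Finsupp.mem_support_iff] at h ⊢
  rintro h0
  rw [coeff_tilt, h0, map_zero, zero_mul] at h
  exact h rfl

/-- The value of `f` at a point of valuation `ξ` in terms of its rescaling. -/
lemma laurentEval_eq_tilt (f : Laurent (integralAt k K) n) {ξ : Fin n → ℤ} {e : ℤ}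
    (he : ∀ α, f.coeff α ≠ 0 → e ≤ α ⬝ᵥ ξ) {x : Fin n → K} {w : Fin n → 𝒪[K]ˣ}
    (hx : ∀ i, x i = unif K ^ ξ i * ((w i : 𝒪[K]) : K)) :
    laurentEval (algebraMap k K) x (AddMonoidAlgebra.mapRingHom _ (integralAt k K).subtype f) =
      unif K ^ e * ((evalHom (RingHom.id _) w (tilt f ξ e) : 𝒪[K]) : K) := by
  have hmon : ∀ α : Fin n → ℤ, ∏ i, x i ^ α i =
      unif K ^ (α ⬝ᵥ ξ) * (((∏ i, w i ^ α i : 𝒪[K]ˣ) : 𝒪[K]) : K) := by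
    intro α
    let p : Kˣ := Units.mk0 (unif K) unif_ne_zero
    let σ : 𝒪[K]ˣ →* Kˣ := Units.map (𝒪[K].subtype : 𝒪[K] →* K)
    have h1 : ∏ i, (p ^ ξ i * σ (w i)) ^ α i = p ^ (α ⬝ᵥ ξ) * σ (∏ i, w i ^ α i) := by
      rw [map_prod, dotProduct, zpow_sum, ← Finset.prod_mul_distrib]
      refine Finset.prod_congr rfl fun i _ => ?_
      rw [mul_zpow, map_zpow, ← zpow_mul, mul_comm (ξ i)]
    have h2 := congrArg Units.val h1
    rw [Units.coe_prod, Units.val_mul, Units.val_zpow_eq_zpow_val] at h2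
    simp only [Units.val_zpow_eq_zpow_val, Units.val_mul] at h2
    simp only [hx]
    exact h2
  have h0 : laurentEval (algebraMap k K) x
      (AddMonoidAlgebra.mapRingHom _ (integralAt k K).subtype f) =
        ∑ α ∈ f.coeff.support, algebraMap k K (f.coeff α) * ∏ i, x i ^ α i :=
    Finsupp.sum_mapRange_index (hf := map_zero _) fun α => by rw [map_zero, zero_mul]
  have h1 : evalHom (RingHom.id _) w (tilt f ξ e) = ∑ α ∈ f.coeff.support,
      integralHom k K (f.coeff α) * unifO K ^ (α ⬝ᵥ ξ - e).toNat *
        ((∏ i, w i ^ α i : 𝒪[K]ˣ) : 𝒪[K]) := by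
    rw [evalHom_eq_sum]
    exact Finsupp.sum_of_support_subset _ (support_tilt_subset f ξ e) _
      fun α _ => by rw [map_zero, zero_mul]
  rw [h0, h1, ← 𝒪[K].subtype_apply, map_sum, Finset.mul_sum]
  refine Finset.sum_congr rfl fun α hα => ?_
  rw [hmon, Subring.subtype_apply, Subring.coe_mul, Subring.coe_mul,
    Subring.coe_pow, coe_integralHom, coe_unifO]
  have h2 : unif K ^ (α ⬝ᵥ ξ) = unif K ^ e * unif K ^ (α ⬝ᵥ ξ - e).toNat := by
    have := he α (Finsupp.mem_support_iff.1 hα)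
    rw [← zpow_natCast, ← zpow_add₀ unif_ne_zero]
    congr 1
    omega
  rw [h2]
  ring

lemma residue_unifO : IsLocalRing.residue 𝒪[K] (unifO K) = 0 := by
  rw [IsLocalRing.residue_eq_zero_iff]
  have := (mem_maximalIdeal_pow (x := unifO K) unif_ne_zero 1).2 (by rw [coe_unifO, nuK_unif]; rfl)
  rwa [pow_one] at this

/-- The rescaling of `f` reduces to its initial form. -/
lemma residue_tilt {f f₀ : Laurent (integralAt k K) n} {ξ : Fin n → ℤ} {e : ℤ}
    (he : ∀ α, f.coeff α ≠ 0 → e ≤ α ⬝ᵥ ξ) (h1 : ∀ α, f₀.coeff α ≠ 0 → f₀.coeff α = f.coeff α)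
    (h2 : ∀ α, f.coeff α ≠ 0 → (f₀.coeff α ≠ 0 ↔ α ⬝ᵥ ξ = e)) :
    AddMonoidAlgebra.mapRingHom _ (IsLocalRing.residue 𝒪[K]) (tilt f ξ e) =
      AddMonoidAlgebra.mapRingHom _ (reduceHom k K) f₀ := by
  ext α
  change IsLocalRing.residue 𝒪[K] ((tilt f ξ e).coeff α) = reduceHom k K (f₀.coeff α)
  rw [coeff_tilt, map_mul, map_pow, residue_unifO]
  by_cases hf : f.coeff α = 0
  · have : f₀.coeff α = 0 := by
      by_contra h
      exact h ((h1 α h).trans hf)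
    rw [hf, this, map_zero, map_zero, map_zero, zero_mul]
  by_cases h0 : f₀.coeff α = 0
  · have hne : α ⬝ᵥ ξ ≠ e := fun h => (h2 α hf).2 h h0
    have hle := he α hf
    rw [h0, map_zero, zero_pow (by omega), mul_zero]
  · rw [(h2 α hf).1 h0, sub_self, Int.toNat_zero, pow_zero, mul_one, h1 α h0]
    rfl

end Tilt

/-! ### Multiple geometric series -/

section Geometric

/-- The multiple geometric series. -/
lemma hasSum_pow_sum {ι : Type*} [Fintype ι] {x : ℂ} (hx : ‖x‖ < 1) :
    HasSum (fun o : ι → ℕ => x ^ ∑ j, o j) ((1 - x)⁻¹ ^ Fintype.card ι) := by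
  classical
  have hs : Summable fun o : ι → ℕ => x ^ ∑ j, o j := by
    have h1 := summable_prod_pow (ι := ι) (fun _ => norm_nonneg x) (fun _ => hx)
    rw [← Finsupp.equivFunOnFinite.symm.summable_iff] at h1
    refine Summable.of_norm_bounded h1 fun o => ?_
    rw [norm_pow, ← Finset.prod_pow_eq_pow_sum]
    rfl
  have hbox : Filter.Tendsto (fun M : ℕ => Fintype.piFinset fun _ : ι => Finset.range M)
      Filter.atTop Filter.atTop := by
    refine Filter.tendsto_atTop_finset_of_monotone
      (fun M M' h => Fintype.piFinset_subset _ _ fun _ => Finset.range_mono h) fun o => ?_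
    refine ⟨∑ j, o j + 1, Fintype.mem_piFinset.2 fun j => Finset.mem_range.2 ?_⟩
    exact Nat.lt_succ_of_le (Finset.single_le_sum (fun _ _ => Nat.zero_le _) (Finset.mem_univ j))
  have h1 := hs.hasSum.comp hbox
  have h2 : Filter.Tendsto (fun M : ℕ => ∏ _j : ι, ∑ a ∈ Finset.range M, x ^ a) Filter.atTop
      (nhds ((1 - x)⁻¹ ^ Fintype.card ι)) := by
    simp only [Finset.prod_const, Finset.card_univ]
    exact (hasSum_geometric_of_norm_lt_one hx).tendsto_sum_nat.pow _
  have h3 : ∀ M : ℕ, ∏ _j : ι, ∑ a ∈ Finset.range M, x ^ a =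
      ∑ o ∈ Fintype.piFinset fun _ : ι => Finset.range M, x ^ ∑ j, o j := by
    intro M
    rw [Finset.prod_univ_sum]
    exact Finset.sum_congr rfl fun o _ => Finset.prod_pow_eq_pow_sum _ _ _
  simp only [h3] at h2
  rw [← tendsto_nhds_unique h1 h2]
  exact hs.hasSum

lemma hasSum_pow_sum_of_le {ι : Type*} [Fintype ι] {x : ℂ} (hx : ‖x‖ < 1) (a : ι → ℕ)
    [DecidablePred fun o : ι → ℕ => ∀ j, a j ≤ o j] :
    HasSum (fun o : ι → ℕ => if ∀ j, a j ≤ o j then x ^ ∑ j, o j else 0)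
      (x ^ (∑ j, a j) * (1 - x)⁻¹ ^ Fintype.card ι) := by
  have hinj : Function.Injective fun o : ι → ℕ => a + o := add_right_injective a
  rw [← hinj.hasSum_iff]
  · refine ((hasSum_pow_sum hx).mul_left (x ^ ∑ j, a j)).congr_fun ?_
    intro o
    simp [Finset.sum_add_distrib, pow_add]
  · intro o ho
    rw [if_neg]
    intro h
    exact ho ⟨fun j => o j - a j, funext fun j => Nat.add_sub_cancel' (h j)⟩

end Geometric

/-! ### The pieces of the domain of integration -/

section Pieces

variable {k K : Type*} [Field k] [Field K] [ValuativeRel K] {n r : ℕ}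

lemma coe_unit_ne_zero (w : 𝒪[K]ˣ) : ((w : 𝒪[K]) : K) ≠ 0 := fun h => w.ne_zero (Subtype.ext h)

variable [TopologicalSpace K] [IsNonarchimedeanLocalField K]

lemma zpow_mul_mem_integer_iff (e : ℤ) (y : 𝒪[K]) :
    unif K ^ e * (y : K) ∈ 𝒪[K] ↔ y ∈ 𝓂[K] ^ (-e).toNat := by
  by_cases hy : (y : K) = 0
  · rw [hy, mul_zero, show y = 0 from Subtype.ext hy]
    exact ⟨fun _ => zero_mem _, fun _ => zero_mem _⟩
  have hp : unif K ^ e ≠ 0 := zpow_ne_zero _ unif_ne_zero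
  have h0 := (mem_integer_iff hy).1 y.2
  rw [mem_integer_iff (mul_ne_zero hp hy), mem_maximalIdeal_pow hy, nuK_mul hp hy,
    nuK_zpow unif_ne_zero, nuK_unif]
  omega

/-- The points of valuation `ξ` with leading coefficients `v`. -/
def torusPiece (ξ : Fin n → ℕ) (v : Fin n → 𝓀[K]ˣ) : Set (Fin n → K) :=
  {x | ∃ w : Fin n → 𝒪[K]ˣ, (∀ i, x i = unif K ^ ξ i * ((w i : 𝒪[K]) : K)) ∧
    ∀ i, IsLocalRing.residue 𝒪[K] (w i) = v i}

lemma nuK_pow_mul_unit (a : ℕ) (w : 𝒪[K]ˣ) : nuK (unif K ^ a * ((w : 𝒪[K]) : K)) = a := by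
  rw [nuK_mul (pow_ne_zero _ unif_ne_zero) (coe_unit_ne_zero w), nuK_pow unif_ne_zero, nuK_unif,
    nuK_unit, mul_one, add_zero]

lemma nuK_of_mem_torusPiece {ξ : Fin n → ℕ} {v : Fin n → 𝓀[K]ˣ} {x : Fin n → K}
    (hx : x ∈ torusPiece ξ v) (i : Fin n) : x i ≠ 0 ∧ nuK (x i) = ξ i := by
  obtain ⟨w, hw, -⟩ := hx
  rw [hw]
  exact ⟨mul_ne_zero (pow_ne_zero _ unif_ne_zero) (coe_unit_ne_zero _), nuK_pow_mul_unit _ _⟩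

lemma eq_of_mem_torusPiece {ξ ξ' : Fin n → ℕ} {v v' : Fin n → 𝓀[K]ˣ} {x : Fin n → K}
    (hx : x ∈ torusPiece ξ v) (hx' : x ∈ torusPiece ξ' v') : ξ = ξ' ∧ v = v' := by
  have hξ : ξ = ξ' := by
    funext i
    have := (nuK_of_mem_torusPiece hx i).2.symm.trans (nuK_of_mem_torusPiece hx' i).2
    exact_mod_cast this
  subst hξ
  refine ⟨rfl, ?_⟩
  obtain ⟨w, hw, hwv⟩ := hx
  obtain ⟨w', hw', hwv'⟩ := hx'
  funext i
  have h1 : (w i : 𝒪[K]) = w' i :=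
    Subtype.ext (mul_left_cancel₀ (pow_ne_zero _ unif_ne_zero) ((hw i).symm.trans (hw' i)))
  apply Units.ext
  rw [← hwv, ← hwv', h1]

lemma exists_mem_torusPiece {x : Fin n → K} (hx : ∀ i, x i ≠ 0) (h : ∀ i, 0 ≤ nuK (x i)) :
    ∃ ξ v, x ∈ torusPiece ξ v := by
  choose w hw using fun i => exists_unit_of_nuK_eq (hx i) (Int.toNat_of_nonneg (h i)).symm
  refine ⟨fun i => (nuK (x i)).toNat, fun i => Units.map (IsLocalRing.residue 𝒪[K] : 𝒪[K] →* 𝓀[K]) (w i),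
    w, fun i => ?_, fun i => rfl⟩
  have := hw i
  rwa [zpow_natCast] at this

lemma pairing_natCast (α : Fin n → ℤ) (ξ : Fin n → ℕ) :
    pairing α (fun i => (ξ i : ℝ)) = ((α ⬝ᵥ fun i => (ξ i : ℤ) : ℤ) : ℝ) := by
  simp [pairing, dotProduct]

variable (T : ToricDatum k n r)

/-- The lattice points of `C₀^J`. -/
lemma ToricDatum.mem_coneJ_iff (γ : Fin r → Fin n → ℤ) (J : Finset (Fin r))
    (p : Fin n ⊕ J → ℕ) :
    (fun a => (p a : ℝ)) ∈ T.coneJ γ J ↔ (fun i => (p (Sum.inl i) : ℝ)) ∈ T.cone ∧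
      (∀ i, i ∉ J → 0 ≤ γ i ⬝ᵥ fun i => (p (Sum.inl i) : ℤ)) ∧
      ∀ j : J, max 1 (-(γ j ⬝ᵥ fun i => (p (Sum.inl i) : ℤ))).toNat ≤ p (Sum.inr j) := by
  classical
  have hpair : ∀ i, pairing (γ i) ((fun a => (p a : ℝ)) ∘ Sum.inl) =
      ((γ i ⬝ᵥ fun i => (p (Sum.inl i) : ℤ) : ℤ) : ℝ) := fun i => pairing_natCast _ _
  have hin : ∀ j : J, ∑ x : J, (if (x : Fin r) = (j : Fin r) then (1 : ℝ) else 0) *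
      (p (Sum.inr x) : ℝ) = p (Sum.inr j) := by
    intro j
    rw [Finset.sum_eq_single j]
    · simp
    · intro x _ hx
      rw [if_neg fun h => hx (Subtype.ext h), zero_mul]
    · simp
  have hout : ∀ i, i ∉ J → ∑ x : J, (if (x : Fin r) = i then (1 : ℝ) else 0) *
      (p (Sum.inr x) : ℝ) = 0 := by
    intro i hi
    refine Finset.sum_eq_zero fun x _ => ?_
    rw [if_neg fun h : (x : Fin r) = i => hi (h ▸ x.2), zero_mul]
  constructor
  · rintro ⟨h1, -, h3, h4⟩
    refine ⟨h1, fun i hi => ?_, fun j => ?_⟩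
    · have := h4 i
      rw [hpair, hout i hi, add_zero] at this
      exact_mod_cast this
    · have h5 := h4 j
      rw [hpair, hin] at h5
      have h6 : (0 : ℤ) ≤ (γ j ⬝ᵥ fun i => (p (Sum.inl i) : ℤ)) + p (Sum.inr j) := by
        exact_mod_cast h5
      have h7 : 0 < p (Sum.inr j) := Nat.cast_pos.1 (h3 j)
      omega
  · rintro ⟨h1, h2, h3⟩
    refine ⟨h1, fun i => Nat.cast_nonneg _, fun j => ?_, fun i => ?_⟩
    · have := h3 j
      exact Nat.cast_pos.2 (by omega)
    · rw [hpair]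
      by_cases hi : i ∈ J
      · have h5 := hin ⟨i, hi⟩
        have h6 := h3 ⟨i, hi⟩
        simp only at h5 h6
        rw [h5]
        have h7 : (0 : ℤ) ≤ (γ i ⬝ᵥ fun i => (p (Sum.inl i) : ℤ)) + p (Sum.inr ⟨i, hi⟩) := by omega
        exact_mod_cast h7
      · rw [hout i hi, add_zero]
        exact_mod_cast h2 i hi

/-- Laurent polynomials `f` and `f₀` over the elements of `k` integral at `𝔓_K` which lift the Laurent
polynomials of `T` and their initial forms, and such that the reductions of the initial forms satisfy
the Jacobian condition over the residue field. -/
structure GoodReduction [Algebra k K] (T : ToricDatum k n r)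
    (f f₀ : Fin r → Laurent (integralAt k K) n) : Prop where
  map_eq : ∀ i, AddMonoidAlgebra.mapRingHom _ (integralAt k K).subtype (f i) = T.f i
  map_init_eq : ∀ i, AddMonoidAlgebra.mapRingHom _ (integralAt k K).subtype (f₀ i) = T.init i
  exists_minor : ∀ (J : Finset (Fin r)) (v : Fin n → 𝓀[K]ˣ),
    (∀ j ∈ J, evalHom (reduceHom k K) v (f₀ j) = 0) → ∃ e : J → Fin n,
      (Matrix.of fun a b : J => evalHom (reduceHom k K) v (pderiv (e a) (f₀ b))).det ≠ 0

variable [Algebra k K] {T} {f f₀ : Fin r → Laurent (integralAt k K) n}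

/-- The exponent vector `γ i` of a term of the initial form gives the order at `ξ`. -/
lemma ToricDatum.IsBalanced.order_facts (hbal : T.IsBalanced) {γ : Fin r → Fin n → ℤ}
    (hγ : ∀ i, γ i ∈ supp (T.init i)) {ξ : Fin n → ℕ} (hξ : (fun i => (ξ i : ℝ)) ∈ T.cone)
    (i : Fin r) :
    (∀ α, (T.f i).coeff α ≠ 0 → (γ i ⬝ᵥ fun i => (ξ i : ℤ)) ≤ α ⬝ᵥ fun i => (ξ i : ℤ)) ∧
      (∀ α, (T.init i).coeff α ≠ 0 → (T.init i).coeff α = (T.f i).coeff α) ∧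
      ∀ α, (T.f i).coeff α ≠ 0 → ((T.init i).coeff α ≠ 0 ↔
        (α ⬝ᵥ fun i => (ξ i : ℤ)) = γ i ⬝ᵥ fun i => (ξ i : ℤ)) := by
  classical
  have h := hγ i
  rw [init_eq hbal hξ] at h ⊢
  have h1 := (mem_supp_initForm.1 h).2
  simp only [pairing_natCast, Int.cast_le] at h1
  refine ⟨fun α hα => h1 α (mem_supp.2 hα), fun α hα => ?_, fun α hα => ?_⟩
  · rw [coeff_initForm] at hα ⊢
    split_ifs at hα ⊢ with h2
    · rfl
    · exact absurd rfl hα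
  · rw [← mem_supp, mem_supp_initForm]
    simp only [pairing_natCast, Int.cast_le]
    constructor
    · rintro ⟨-, h2⟩
      exact le_antisymm (h2 _ (mem_supp_initForm.1 h).1) (h1 α (mem_supp.2 hα))
    · intro h2
      rw [h2]
      exact ⟨mem_supp.2 hα, h1⟩

open Classical in
/-- The set of those `j` for which the reduction of the initial form of `f j` vanishes at `v`. -/
def zeroSet (f₀ : Fin r → Laurent (integralAt k K) n) (v : Fin n → 𝓀[K]ˣ) :
    Finset (Fin r) :=
  Finset.univ.filter fun j => evalHom (reduceHom k K) v (f₀ j) = 0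

lemma mem_zeroSet {v : Fin n → 𝓀[K]ˣ} {j : Fin r} :
    j ∈ zeroSet f₀ v ↔ evalHom (reduceHom k K) v (f₀ j) = 0 := by
  simp [zeroSet]

namespace GoodReduction

lemma coeff_eq (h : GoodReduction T f f₀) (i : Fin r) (α : Fin n → ℤ) :
    (((f i).coeff α : integralAt k K) : k) = (T.f i).coeff α := by
  rw [← h.map_eq i]
  rfl

lemma coeff_init_eq (h : GoodReduction T f f₀) (i : Fin r) (α : Fin n → ℤ) :
    (((f₀ i).coeff α : integralAt k K) : k) = (T.init i).coeff α := by
  rw [← h.map_init_eq i]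
  rfl

/-- The rescalings of the `f i` reduce to the reductions of the initial forms. -/
lemma residue_tilt_eq (h : GoodReduction T f f₀) (hbal : T.IsBalanced) {γ : Fin r → Fin n → ℤ}
    (hγ : ∀ i, γ i ∈ supp (T.init i)) {ξ : Fin n → ℕ} (hξ : (fun i => (ξ i : ℝ)) ∈ T.cone)
    (i : Fin r) :
    AddMonoidAlgebra.mapRingHom _ (IsLocalRing.residue 𝒪[K])
        (tilt (f i) (fun i => (ξ i : ℤ)) (γ i ⬝ᵥ fun i => (ξ i : ℤ))) =
      AddMonoidAlgebra.mapRingHom _ (reduceHom k K) (f₀ i) := by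
  obtain ⟨h1, h2, h3⟩ := hbal.order_facts hγ hξ i
  simp only [← h.coeff_eq, ← h.coeff_init_eq, ne_eq, ZeroMemClass.coe_eq_zero, Subtype.ext_iff.symm]
    at h1 h2 h3
  exact residue_tilt h1 h2 h3

lemma residue_evalHom (h : GoodReduction T f f₀) (hbal : T.IsBalanced) {γ : Fin r → Fin n → ℤ}
    (hγ : ∀ i, γ i ∈ supp (T.init i)) {ξ : Fin n → ℕ} (hξ : (fun i => (ξ i : ℝ)) ∈ T.cone)
    {w : Fin n → 𝒪[K]ˣ} {v : Fin n → 𝓀[K]ˣ} (hw : ∀ i, IsLocalRing.residue 𝒪[K] (w i) = v i)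
    (i : Fin r) :
    IsLocalRing.residue 𝒪[K] (evalHom (RingHom.id _) w
      (tilt (f i) (fun i => (ξ i : ℤ)) (γ i ⬝ᵥ fun i => (ξ i : ℤ)))) =
        evalHom (reduceHom k K) v (f₀ i) := by
  have hv : (fun i => Units.map (IsLocalRing.residue 𝒪[K] : 𝒪[K] →* 𝓀[K]) (w i)) = v :=
    funext fun i => Units.ext (hw i)
  rw [map_evalHom, hv]
  have h1 := congrArg (evalHom (RingHom.id 𝓀[K]) v) (h.residue_tilt_eq hbal hγ hξ i)
  rw [evalHom_map, evalHom_map] at h1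
  exact h1

lemma residue_evalHom_pderiv (h : GoodReduction T f f₀) (hbal : T.IsBalanced)
    {γ : Fin r → Fin n → ℤ} (hγ : ∀ i, γ i ∈ supp (T.init i)) {ξ : Fin n → ℕ}
    (hξ : (fun i => (ξ i : ℝ)) ∈ T.cone)
    {w : Fin n → 𝒪[K]ˣ} {v : Fin n → 𝓀[K]ˣ} (hw : ∀ i, IsLocalRing.residue 𝒪[K] (w i) = v i)
    (i : Fin r) (l : Fin n) :
    IsLocalRing.residue 𝒪[K] (evalHom (RingHom.id _) w (pderiv l
      (tilt (f i) (fun i => (ξ i : ℤ)) (γ i ⬝ᵥ fun i => (ξ i : ℤ))))) =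
        evalHom (reduceHom k K) v (pderiv l (f₀ i)) := by
  have hv : (fun i => Units.map (IsLocalRing.residue 𝒪[K] : 𝒪[K] →* 𝓀[K]) (w i)) = v :=
    funext fun i => Units.ext (hw i)
  rw [map_evalHom, hv]
  have h1 := congrArg (fun g => evalHom (RingHom.id 𝓀[K]) v (pderiv l g))
    (h.residue_tilt_eq hbal hγ hξ i)
  simp only [← map_pderiv, evalHom_map] at h1
  exact h1

/-- Membership in the domain of integration in terms of the rescaled Laurent polynomials. -/
lemma mem_points_iff (h : GoodReduction T f f₀) (hbal : T.IsBalanced) {γ : Fin r → Fin n → ℤ}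
    (hγ : ∀ i, γ i ∈ supp (T.init i)) {ξ : Fin n → ℕ} (hξ : (fun i => (ξ i : ℝ)) ∈ T.cone)
    {x : Fin n → K} {w : Fin n → 𝒪[K]ˣ}
    (hx : ∀ i, x i = unif K ^ ξ i * ((w i : 𝒪[K]) : K)) :
    x ∈ T.points K ↔ ∀ i, evalHom (RingHom.id _) w
      (tilt (f i) (fun i => (ξ i : ℤ)) (γ i ⬝ᵥ fun i => (ξ i : ℤ))) ∈
        𝓂[K] ^ (-(γ i ⬝ᵥ fun i => (ξ i : ℤ))).toNat := by
  have hx0 : ∀ i, x i ≠ 0 := fun i => by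
    rw [hx]
    exact mul_ne_zero (pow_ne_zero _ unif_ne_zero) (coe_unit_ne_zero _)
  have hν : (fun i => (nuK (x i) : ℝ)) = fun i => (ξ i : ℝ) := by
    funext i
    rw [hx, nuK_pow_mul_unit, Int.cast_natCast]
  have key : ∀ i, absK (laurentEval (algebraMap k K) x (T.f i)) ≤ 1 ↔ evalHom (RingHom.id _) w
      (tilt (f i) (fun i => (ξ i : ℤ)) (γ i ⬝ᵥ fun i => (ξ i : ℤ))) ∈
        𝓂[K] ^ (-(γ i ⬝ᵥ fun i => (ξ i : ℤ))).toNat := by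
    intro i
    have h1 := (hbal.order_facts hγ hξ i).1
    simp only [← h.coeff_eq, ne_eq, ZeroMemClass.coe_eq_zero] at h1
    rw [absK_le_one_iff, ← h.map_eq, laurentEval_eq_tilt (f i) h1 (w := w) fun i => by
      rw [hx, zpow_natCast], zpow_mul_mem_integer_iff]
  constructor
  · rintro ⟨-, -, h3⟩ i
    exact (key i).1 (h3 i)
  · intro h3
    refine ⟨hx0, ?_, fun i => (key i).2 (h3 i)⟩
    rw [hν]
    exact hξ

/-- A piece of the domain of integration is empty if some `f i` whose initial form does not vanish
there has negative order. -/
lemma points_inter_eq_empty (h : GoodReduction T f f₀) (hbal : T.IsBalanced)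
    {γ : Fin r → Fin n → ℤ} (hγ : ∀ i, γ i ∈ supp (T.init i)) {ξ : Fin n → ℕ}
    (hξ : (fun i => (ξ i : ℝ)) ∈ T.cone) {v : Fin n → 𝓀[K]ˣ} {i : Fin r} (hi : i ∉ zeroSet f₀ v)
    (hneg : (γ i ⬝ᵥ fun i => (ξ i : ℤ)) < 0) : T.points K ∩ torusPiece ξ v = ∅ := by
  rw [Set.eq_empty_iff_forall_notMem]
  rintro x ⟨hx, w, hw, hwv⟩
  have h1 := (h.mem_points_iff hbal hγ hξ hw).1 hx i
  have h2 := Ideal.pow_le_self (I := 𝓂[K])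
    (n := (-(γ i ⬝ᵥ fun i => (ξ i : ℤ))).toNat) (by omega) h1
  rw [← IsLocalRing.residue_eq_zero_iff, h.residue_evalHom hbal hγ hξ hwv] at h2
  exact hi (mem_zeroSet.2 h2)

/-- A non-empty piece of the domain of integration is given by congruences for those `f j` whose
initial form vanishes there. -/
lemma points_inter_eq_residuePiece (h : GoodReduction T f f₀) (hbal : T.IsBalanced)
    {γ : Fin r → Fin n → ℤ} (hγ : ∀ i, γ i ∈ supp (T.init i)) {ξ : Fin n → ℕ}
    (hξ : (fun i => (ξ i : ℝ)) ∈ T.cone) {v : Fin n → 𝓀[K]ˣ}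
    (hnonneg : ∀ i, i ∉ zeroSet f₀ v → 0 ≤ γ i ⬝ᵥ fun i => (ξ i : ℤ))
    {u : Fin n → 𝒪[K]ˣ} (hu : ∀ i, IsLocalRing.residue 𝒪[K] (u i) = v i) :
    T.points K ∩ torusPiece ξ v = residuePiece ξ u
      (fun j : zeroSet f₀ v => tilt (f j) (fun i => (ξ i : ℤ)) (γ j ⬝ᵥ fun i => (ξ i : ℤ)))
      fun j => max 1 (-(γ j ⬝ᵥ fun i => (ξ i : ℤ))).toNat := by
  have hres : ∀ w : Fin n → 𝒪[K]ˣ, (∀ i, IsLocalRing.residue 𝒪[K] (w i) = v i) ↔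
      ∀ i, (w i : 𝒪[K]) - u i ∈ 𝓂[K] := by
    intro w
    refine forall_congr' fun i => ?_
    rw [← hu, ← sub_eq_zero, ← map_sub, IsLocalRing.residue_eq_zero_iff]
  have hle : ∀ (a : ℕ) (y : 𝒪[K]), y ∈ 𝓂[K] → y ∈ 𝓂[K] ^ a → y ∈ 𝓂[K] ^ max 1 a := by
    intro a y h1 h2
    rcases max_choice 1 a with h3 | h3
    · rwa [h3, pow_one]
    · rwa [h3]
  ext x
  constructor
  · rintro ⟨hx, w, hw, hwv⟩
    refine ⟨w, hw, (hres w).1 hwv, fun j => hle _ _ ?_ ((h.mem_points_iff hbal hγ hξ hw).1 hx j)⟩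
    rw [← IsLocalRing.residue_eq_zero_iff, h.residue_evalHom hbal hγ hξ hwv]
    exact mem_zeroSet.1 j.2
  · rintro ⟨w, hw, hwu, hwG⟩
    refine ⟨(h.mem_points_iff hbal hγ hξ hw).2 fun i => ?_, w, hw, (hres w).2 hwu⟩
    by_cases hi : i ∈ zeroSet f₀ v
    · exact Ideal.pow_le_pow_right (le_max_right _ _) (hwG ⟨i, hi⟩)
    · have : (-(γ i ⬝ᵥ fun i => (ξ i : ℤ))).toNat = 0 := by
        have := hnonneg i hi
        omega
      rw [this, pow_zero, Ideal.one_eq_top]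
      exact Submodule.mem_top

lemma points_inter_eq_empty_of_notMem {v : Fin n → 𝓀[K]ˣ} {ξ : Fin n → ℕ}
    (hξ : (fun i => (ξ i : ℝ)) ∉ T.cone) : T.points K ∩ torusPiece ξ v = ∅ := by
  rw [Set.eq_empty_iff_forall_notMem]
  rintro x ⟨⟨-, hx, -⟩, hxp⟩
  have : (fun i => (nuK (x i) : ℝ)) = fun i => (ξ i : ℝ) := by
    funext i
    rw [(nuK_of_mem_torusPiece hxp i).2, Int.cast_natCast]
  rw [this] at hx
  exact hξ hx

/-- The pieces of the domain of integration are open, hence measurable. -/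
lemma isOpen_points_inter (h : GoodReduction T f f₀) (hbal : T.IsBalanced)
    {γ : Fin r → Fin n → ℤ} (hγ : ∀ i, γ i ∈ supp (T.init i)) (ξ : Fin n → ℕ)
    (v : Fin n → 𝓀[K]ˣ) : IsOpen (T.points K ∩ torusPiece ξ v) := by
  by_cases hξ : (fun i => (ξ i : ℝ)) ∈ T.cone
  · by_cases hnonneg : ∀ i, i ∉ zeroSet f₀ v → 0 ≤ γ i ⬝ᵥ fun i => (ξ i : ℤ)
    · obtain ⟨u, hu⟩ := exists_unit_residue_eq v
      rw [h.points_inter_eq_residuePiece hbal hγ hξ hnonneg hu]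
      exact isOpen_residuePiece _ _ _ _
    · push Not at hnonneg
      obtain ⟨i, hi, hneg⟩ := hnonneg
      rw [h.points_inter_eq_empty hbal hγ hξ hi hneg]
      exact isOpen_empty
  · rw [points_inter_eq_empty_of_notMem hξ]
    exact isOpen_empty

variable [MeasurableSpace (Fin n → K)] [BorelSpace (Fin n → K)]

/-- The volume of a non-empty piece of the domain of integration. -/
lemma haarK_points_inter_mul (h : GoodReduction T f f₀) (hbal : T.IsBalanced)
    {γ : Fin r → Fin n → ℤ} (hγ : ∀ i, γ i ∈ supp (T.init i)) {ξ : Fin n → ℕ}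
    (hξ : (fun i => (ξ i : ℝ)) ∈ T.cone) {v : Fin n → 𝓀[K]ˣ}
    (hnonneg : ∀ i, i ∉ zeroSet f₀ v → 0 ≤ γ i ⬝ᵥ fun i => (ξ i : ℤ)) :
    (zeroSet f₀ v).card ≤ n ∧ haarK K n (T.points K ∩ torusPiece ξ v) *
      (qK K : ENNReal) ^ (∑ i, ξ i + (∑ j : zeroSet f₀ v,
        max 1 (-(γ j ⬝ᵥ fun i => (ξ i : ℤ))).toNat + (n - (zeroSet f₀ v).card))) = 1 := by
  classical
  obtain ⟨u, hu⟩ := exists_unit_residue_eq v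
  obtain ⟨e, he⟩ := h.exists_minor (zeroSet f₀ v) v fun j hj => mem_zeroSet.1 hj
  rw [h.points_inter_eq_residuePiece hbal hγ hξ hnonneg hu]
  have hdet : IsUnit (minorAt (fun j : zeroSet f₀ v =>
      tilt (f j) (fun i => (ξ i : ℤ)) (γ j ⬝ᵥ fun i => (ξ i : ℤ))) e u).det := by
    rw [← IsLocalRing.residue_ne_zero_iff_isUnit, RingHom.map_det]
    convert he using 2
    ext a b
    exact h.residue_evalHom_pderiv hbal hγ hξ hu b (e a)
  refine ⟨?_, ?_⟩
  · have := Fintype.card_le_of_injective e (injective_of_isUnit_det hdet)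
    rwa [Fintype.card_coe, Fintype.card_fin] at this
  · have := haarK_residuePiece_mul ξ hdet (fun j => by
      rw [← IsLocalRing.residue_eq_zero_iff, h.residue_evalHom hbal hγ hξ hu]
      exact mem_zeroSet.1 j.2)
      (a := fun j : zeroSet f₀ v => max 1 (-(γ j ⬝ᵥ fun i => (ξ i : ℤ))).toNat)
      fun j => le_max_left _ _
    rwa [Fintype.card_coe] at this

end GoodReduction

end Pieces

/-! ### Summation over the pieces -/

section LocallyConstant

/-- Integration of a function which is constant on the members of a countable partition. -/
lemma integral_iUnion_of_const {X ι : Type*} [MeasurableSpace X] [Countable ι] {μ : Measure X}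
    {P : ι → Set X} (hP : ∀ i, MeasurableSet (P i)) (hdisj : Pairwise (Function.onFun Disjoint P))
    (hfin : ∀ i, μ (P i) ≠ ⊤) {f : X → ℂ} {c : ι → ℂ} (hf : ∀ i, ∀ x ∈ P i, f x = c i) {V : ℂ}
    (hV : HasSum (fun i => c i * (μ.real (P i) : ℂ)) V) :
    IntegrableOn f (⋃ i, P i) μ ∧ ∫ x in ⋃ i, P i, f x ∂μ = V := by
  have hint : ∀ i, IntegrableOn f (P i) μ := fun i =>
    (integrableOn_const (hfin i) (C := c i)).congr_fun (fun x hx => (hf i x hx).symm) (hP i)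
  have hval : ∀ i, ∫ x in P i, f x ∂μ = c i * (μ.real (P i) : ℂ) := fun i => by
    rw [setIntegral_congr_fun (hP i) (hf i), setIntegral_const, Complex.real_smul, mul_comm]
  have hnorm : ∀ i, ∫ x in P i, ‖f x‖ ∂μ = ‖c i * (μ.real (P i) : ℂ)‖ := fun i => by
    rw [setIntegral_congr_fun (hP i) (g := fun _ => ‖c i‖) fun x hx => by simp only [hf i x hx],
      setIntegral_const, norm_mul, Complex.norm_real, Real.norm_of_nonneg measureReal_nonneg,
      smul_eq_mul, mul_comm]
  have hI : IntegrableOn f (⋃ i, P i) μ := by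
    refine integrableOn_iUnion_of_summable_integral_norm hint ?_
    simp only [hnorm]
    exact hV.summable.norm
  refine ⟨hI, ?_⟩
  have := hasSum_integral_iUnion hP hdisj hI
  simp only [hval] at this
  exact this.unique hV

end LocallyConstant

section Summation

variable {k K : Type*} [Field k] [Field K] [ValuativeRel K] {n r m : ℕ}
variable [TopologicalSpace K] [IsNonarchimedeanLocalField K]

variable (K) in
lemma norm_inv_qK_lt_one : ‖(qK K : ℂ)⁻¹‖ < 1 := by
  rw [norm_inv, Complex.norm_natCast]
  exact inv_lt_one_of_one_lt₀ (by exact_mod_cast one_lt_qK)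

variable (K) in
lemma qK_ne_zero : (qK K : ℂ) ≠ 0 := by
  exact_mod_cast (zero_lt_one.trans (one_lt_qK (K := K))).ne'

variable (K) in
lemma qK_sub_one_ne_zero : (qK K : ℂ) - 1 ≠ 0 := by
  rw [sub_ne_zero]
  exact_mod_cast (one_lt_qK (K := K)).ne'

/-- The integrand is constant on points of fixed valuation. -/
lemma integrand_eq (β : Matrix (Fin m) (Fin n) ℕ) (s : Fin m → ℂ) {x : Fin n → K} {ξ : Fin n → ℕ}
    (hx : ∀ i, x i ≠ 0 ∧ nuK (x i) = ξ i) :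
    integrand β s x = ∏ l, ((qK K : ℂ) ^ (-s l)) ^ ∑ i, β l i * ξ i := by
  refine Finset.prod_congr rfl fun l _ => ?_
  have h0 : ∏ i, x i ^ β l i ≠ 0 := Finset.prod_ne_zero_iff.2 fun i _ => pow_ne_zero _ (hx i).1
  have hν : nuK (∏ i, x i ^ β l i) = (∑ i, β l i * ξ i : ℕ) := by
    rw [nuK_prod _ fun i _ => pow_ne_zero _ (hx i).1]
    push_cast
    refine Finset.sum_congr rfl fun i _ => ?_
    rw [nuK_pow (hx i).1, (hx i).2]
  rw [absK, if_neg h0, hν, zpow_neg, zpow_natCast]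
  generalize ∑ i, β l i * ξ i = N
  have hq : (0 : ℝ) ≤ (qK K : ℝ)⁻¹ := by positivity
  have h1 : ((qK K : ℂ)⁻¹) ^ s l = (qK K : ℂ) ^ (-s l) := by
    rw [Complex.cpow_neg, Complex.inv_cpow]
    rw [Complex.natCast_arg]
    exact Real.pi_pos.ne
  rw [← inv_pow, ← h1]
  induction N with
  | zero => simp
  | succ N ih =>
    rw [pow_succ, pow_succ, Complex.ofReal_mul, Complex.mul_cpow_ofReal_nonneg (pow_nonneg hq N) hq,
      ih, Complex.ofReal_inv, Complex.ofReal_natCast]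

variable [Algebra k K] {T : ToricDatum k n r} {f f₀ : Fin r → Laurent (integralAt k K) n}
variable [MeasurableSpace (Fin n → K)] [BorelSpace (Fin n → K)]

namespace GoodReduction

open Classical in
/-- The volume of a piece of the domain of integration as a sum over lattice points. -/
lemma hasSum_volume (h : GoodReduction T f f₀) (hbal : T.IsBalanced)
    {γ : Fin r → Fin n → ℤ} (hγ : ∀ i, γ i ∈ supp (T.init i)) (ξ : Fin n → ℕ)
    (v : Fin n → 𝓀[K]ˣ) :
    HasSum (fun o : zeroSet f₀ v → ℕ =>
        if (fun a => ((Sum.elim ξ o a : ℕ) : ℝ)) ∈ T.coneJ γ (zeroSet f₀ v) then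
          (qK K : ℂ)⁻¹ ^ (∑ i, ξ i + ∑ j, o j) else 0)
      (((haarK K n).real (T.points K ∩ torusPiece ξ v) : ℂ) *
        ((qK K : ℂ) ^ n * (((qK K : ℂ) - 1) ^ (zeroSet f₀ v).card)⁻¹)) := by
  have hq0 := qK_ne_zero K
  have hq1 := qK_sub_one_ne_zero K
  simp only [ToricDatum.mem_coneJ_iff, Sum.elim_inl, Sum.elim_inr]
  by_cases hξ : (fun i => (ξ i : ℝ)) ∈ T.cone
  swap
  · rw [points_inter_eq_empty_of_notMem hξ, measureReal_empty, Complex.ofReal_zero, zero_mul]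
    simp only [hξ, false_and, if_false]
    exact hasSum_zero
  by_cases hnonneg : ∀ i, i ∉ zeroSet f₀ v → 0 ≤ γ i ⬝ᵥ fun i => (ξ i : ℤ)
  swap
  · simp only [hnonneg, false_and, and_false, if_false]
    push Not at hnonneg
    obtain ⟨i, hi, hneg⟩ := hnonneg
    rw [h.points_inter_eq_empty hbal hγ hξ hi hneg, measureReal_empty, Complex.ofReal_zero, zero_mul]
    exact hasSum_zero
  obtain ⟨hcard, hvol⟩ := h.haarK_points_inter_mul hbal hγ hξ hnonneg
  have h1 := (hasSum_pow_sum_of_le (norm_inv_qK_lt_one K) fun j : zeroSet f₀ v =>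
    max 1 (-(γ j ⬝ᵥ fun i => (ξ i : ℤ))).toNat).mul_left ((qK K : ℂ)⁻¹ ^ ∑ i, ξ i)
  have h2 := congrArg ENNReal.toReal hvol
  rw [ENNReal.toReal_mul, ENNReal.toReal_pow, ENNReal.toReal_natCast, ENNReal.toReal_one] at h2
  have h3 : ((haarK K n).real (T.points K ∩ torusPiece ξ v) : ℂ) * (qK K : ℂ) ^ (∑ i, ξ i +
      (∑ j : zeroSet f₀ v, max 1 (-(γ j ⬝ᵥ fun i => (ξ i : ℤ))).toNat +
        (n - (zeroSet f₀ v).card))) = 1 := by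
    exact_mod_cast h2
  have h4 : ((haarK K n).real (T.points K ∩ torusPiece ξ v) : ℂ) *
        ((qK K : ℂ) ^ n * (((qK K : ℂ) - 1) ^ (zeroSet f₀ v).card)⁻¹) =
      (qK K : ℂ)⁻¹ ^ (∑ i, ξ i) *
        ((qK K : ℂ)⁻¹ ^ (∑ j : zeroSet f₀ v, max 1 (-(γ j ⬝ᵥ fun i => (ξ i : ℤ))).toNat) *
          (1 - (qK K : ℂ)⁻¹)⁻¹ ^ Fintype.card (zeroSet f₀ v)) := by
    have h5 : (1 - (qK K : ℂ)⁻¹)⁻¹ = (qK K : ℂ) * ((qK K : ℂ) - 1)⁻¹ := by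
      field_simp
    rw [h5, Fintype.card_coe, eq_div_of_mul_eq (pow_ne_zero _ hq0) h3]
    have h6 : (qK K : ℂ) ^ n =
        (qK K : ℂ) ^ (zeroSet f₀ v).card * (qK K : ℂ) ^ (n - (zeroSet f₀ v).card) := by
      rw [← pow_add, Nat.add_sub_cancel' hcard]
    rw [h6, pow_add, pow_add, mul_pow, inv_pow, inv_pow, inv_pow]
    field_simp
  rw [h4]
  refine h1.congr_fun fun o => ?_
  simp only [hξ, true_and]
  split_ifs with h6 h7 h7
  · rw [pow_add]
  · exact absurd h6.2 h7
  · exact absurd ⟨hnonneg, h7⟩ h6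
  · rw [mul_zero]

/-- The contribution of the points with leading coefficients `v` to the integral. -/
lemma hasSum_pieces (h : GoodReduction T f f₀) (hbal : T.IsBalanced)
    {γ : Fin r → Fin n → ℤ} (hγ : ∀ i, γ i ∈ supp (T.init i)) (v : Fin n → 𝓀[K]ˣ)
    (β : Matrix (Fin m) (Fin n) ℕ) (t : Fin m → ℂ) {V : ℂ}
    (hV : HasSum (fun e : Fin n ⊕ zeroSet f₀ v →₀ ℕ =>
      (latticeSeries (T.coneJ γ (zeroSet f₀ v)) e : ℂ) *
        ∏ a, ((qK K : ℂ)⁻¹ * ∏ l : Fin m, t l ^ matA β (zeroSet f₀ v) a l.succ) ^ e a) V) :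
    HasSum (fun ξ : Fin n → ℕ => (∏ l, t l ^ ∑ i, β l i * ξ i) *
        ((haarK K n).real (T.points K ∩ torusPiece ξ v) : ℂ))
      ((qK K : ℂ) ^ (-(n : ℤ)) * ((qK K : ℂ) - 1) ^ (zeroSet f₀ v).card * V) := by
  classical
  have hq0 := qK_ne_zero K
  have hq1 := qK_sub_one_ne_zero K
  let E : (Fin n → ℕ) × (zeroSet f₀ v → ℕ) ≃ (Fin n ⊕ zeroSet f₀ v →₀ ℕ) :=
    (Equiv.sumArrowEquivProdArrow _ _ _).symm.trans Finsupp.equivFunOnFinite.symm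
  rw [← E.hasSum_iff] at hV
  have hE : ∀ ξ o a, E (ξ, o) a = Sum.elim ξ o a := fun ξ o a => by cases a <;> rfl
  have hterm : ∀ p : (Fin n → ℕ) × (zeroSet f₀ v → ℕ), ((fun e : Fin n ⊕ zeroSet f₀ v →₀ ℕ =>
      (latticeSeries (T.coneJ γ (zeroSet f₀ v)) e : ℂ) *
        ∏ a, ((qK K : ℂ)⁻¹ * ∏ l : Fin m, t l ^ matA β (zeroSet f₀ v) a l.succ) ^ e a) ∘ E) p =
      (∏ l, t l ^ ∑ i, β l i * p.1 i) *
        if (fun a => ((Sum.elim p.1 p.2 a : ℕ) : ℝ)) ∈ T.coneJ γ (zeroSet f₀ v) then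
          (qK K : ℂ)⁻¹ ^ (∑ i, p.1 i + ∑ j, p.2 j) else 0 := by
    rintro ⟨ξ, o⟩
    simp only [Function.comp_apply, hE, latticeSeries]
    have h1 : ∏ a, ((qK K : ℂ)⁻¹ * ∏ l : Fin m, t l ^ matA β (zeroSet f₀ v) a l.succ) ^
        (Sum.elim ξ o a) =
        (∏ l, t l ^ ∑ i, β l i * ξ i) * (qK K : ℂ)⁻¹ ^ (∑ i, ξ i + ∑ j, o j) := by
      rw [Fintype.prod_sum_type]
      simp only [matA, Fin.cons_succ, Sum.elim_inl, Sum.elim_inr, pow_zero, Finset.prod_const_one,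
        mul_one, mul_pow, Finset.prod_mul_distrib, Finset.prod_pow_eq_pow_sum, ← Finset.prod_pow,
        ← pow_mul]
      rw [Finset.prod_comm, pow_add]
      simp only [Finset.prod_pow_eq_pow_sum]
      ring
    rw [h1]
    split_ifs <;> simp
  have hV2 := (hV.congr_fun fun p => (hterm p).symm).prod_fiberwise fun ξ =>
    (h.hasSum_volume hbal hγ ξ v).mul_left (∏ l, t l ^ ∑ i, β l i * ξ i)
  have hV3 := hV2.mul_left ((qK K : ℂ) ^ (-(n : ℤ)) * ((qK K : ℂ) - 1) ^ (zeroSet f₀ v).card)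
  refine hV3.congr_fun fun ξ => ?_
  rw [zpow_neg, zpow_natCast]
  field_simp

/-- The integral as a sum over the points `v` of the torus over the residue field. -/
lemma integral_eq_sum (h : GoodReduction T f f₀) (hbal : T.IsBalanced)
    {γ : Fin r → Fin n → ℤ} (hγ : ∀ i, γ i ∈ supp (T.init i)) [Fintype (Fin n → 𝓀[K]ˣ)]
    (β : Matrix (Fin m) (Fin n) ℕ) (s : Fin m → ℂ) {V : Finset (Fin r) → ℂ}
    (hV : ∀ J : Finset (Fin r), HasSum (fun e : Fin n ⊕ J →₀ ℕ =>
      (latticeSeries (T.coneJ γ J) e : ℂ) * ∏ a, ((qK K : ℂ)⁻¹ *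
        ∏ l : Fin m, ((qK K : ℂ) ^ (-s l)) ^ matA β J a l.succ) ^ e a) (V J)) :
    IntegrableOn (integrand β s) (T.points K) (haarK K n) ∧
      zetaK K T β s = ∑ v : Fin n → 𝓀[K]ˣ, (qK K : ℂ) ^ (-(n : ℤ)) *
        ((qK K : ℂ) - 1) ^ (zeroSet f₀ v).card * V (zeroSet f₀ v) := by
  let P : (Fin n → 𝓀[K]ˣ) → Set (Fin n → K) := fun v => ⋃ ξ, T.points K ∩ torusPiece ξ v
  have hmeas : ∀ v ξ, MeasurableSet (T.points K ∩ torusPiece ξ v) := fun v ξ =>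
    (h.isOpen_points_inter hbal hγ ξ v).measurableSet
  have hfin : ∀ v ξ, haarK K n (T.points K ∩ torusPiece ξ v) ≠ ⊤ := by
    intro v ξ
    by_cases hξ : (fun i => (ξ i : ℝ)) ∈ T.cone
    · by_cases hnonneg : ∀ i, i ∉ zeroSet f₀ v → 0 ≤ γ i ⬝ᵥ fun i => (ξ i : ℤ)
      · intro htop
        have := (h.haarK_points_inter_mul hbal hγ hξ hnonneg).2
        rw [htop, ENNReal.top_mul] at this
        · exact ENNReal.top_ne_one this
        · refine pow_ne_zero _ ?_
          exact_mod_cast (zero_lt_one.trans (one_lt_qK (K := K))).ne'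
      · push Not at hnonneg
        obtain ⟨i, hi, hneg⟩ := hnonneg
        rw [h.points_inter_eq_empty hbal hγ hξ hi hneg, measure_empty]
        exact ENNReal.zero_ne_top
    · rw [points_inter_eq_empty_of_notMem hξ, measure_empty]
      exact ENNReal.zero_ne_top
  have hpiece : ∀ v, IntegrableOn (integrand β s) (P v) (haarK K n) ∧
      ∫ x in P v, integrand β s x ∂(haarK K n) = (qK K : ℂ) ^ (-(n : ℤ)) *
        ((qK K : ℂ) - 1) ^ (zeroSet f₀ v).card * V (zeroSet f₀ v) := by
    intro v
    refine integral_iUnion_of_const (hmeas v) (fun ξ ξ' hne => ?_) (hfin v)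
      (fun ξ x hx => integrand_eq β s fun i => nuK_of_mem_torusPiece hx.2 i)
      (h.hasSum_pieces hbal hγ v β (fun l => (qK K : ℂ) ^ (-s l)) (hV _))
    exact Set.disjoint_left.2 fun x hx hx' => hne (eq_of_mem_torusPiece hx.2 hx'.2).1
  have hunion : T.points K = ⋃ v, P v := by
    ext x
    simp only [P, Set.mem_iUnion]
    constructor
    · intro hx
      obtain ⟨ξ, v, hv⟩ := exists_mem_torusPiece hx.1 fun i => by
        have := T.nonneg _ hx.2.1 i
        exact_mod_cast this
      exact ⟨v, ξ, hx, hv⟩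
    · rintro ⟨v, ξ, hx, -⟩
      exact hx
  have hPmeas : ∀ v, MeasurableSet (P v) := fun v => MeasurableSet.iUnion (hmeas v)
  have hPdisj : Pairwise (Function.onFun Disjoint P) := by
    intro v v' hne
    refine Set.disjoint_left.2 fun x hx hx' => ?_
    obtain ⟨ξ, hξ⟩ := Set.mem_iUnion.1 hx
    obtain ⟨ξ', hξ'⟩ := Set.mem_iUnion.1 hx'
    exact hne (eq_of_mem_torusPiece hξ.2 hξ'.2).2
  constructor
  · rw [hunion]
    exact integrableOn_finite_iUnion.2 fun v => (hpiece v).1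
  · rw [zetaK, hunion, integral_iUnion_fintype hPmeas hPdisj fun v => (hpiece v).1]
    exact Finset.sum_congr rfl fun v _ => (hpiece v).2

end GoodReduction

end Summation

/-! ### Good reduction outside a finite set of primes -/

section GoodPrimes

variable {k : Type*} [Field k] {n r : ℕ}

open Classical in
/-- The non-zero coefficients of a Laurent polynomial. -/
def coeffs {d : ℕ} (f : Laurent k d) : Finset k := f.coeff.support.image f.coeff

lemma coeff_mem_of_coeffs {d : ℕ} {f : Laurent k d} {S : Subring k} (h : ∀ c ∈ coeffs f, c ∈ S)
    (α : Fin d → ℤ) : f.coeff α ∈ S := by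
  classical
  by_cases hα : f.coeff α = 0
  · rw [hα]
    exact zero_mem S
  · exact h _ (Finset.mem_image_of_mem _ (Finsupp.mem_support_iff.2 hα))

/-- For all but finitely many primes, a regular toric datum has good reduction, the `g I j` are
integral, and they compute the numbers of points of the reductions of the initial forms. -/
lemma ToricDatum.IsRegular.exists_finite_primes [NumberField k] {T : ToricDatum k n r}
    (hreg : T.IsRegular) (hne : T.cone.Nonempty) (B : Finset (Fin r) → GL (Fin n) ℤ)
    (g : (I : Finset (Fin r)) → Fin r → Laurent k (T.dimSum I))
    (hB : ∀ I, T.IsSplitting I (B I) (g I)) :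
    ∃ S : Set (Ideal (𝓞 k)), S.Finite ∧ ∀ (K : Type*) [Field K] [ValuativeRel K]
      [TopologicalSpace K] [IsNonarchimedeanLocalField K] [Algebra k K], primeBelow k K ∉ S →
      (∀ I, ∀ j ∈ I, HasReduction K (g I j)) ∧ ∃ f f₀ : Fin r → Laurent (integralAt k K) n,
        GoodReduction T f f₀ ∧ ∀ I : Finset (Fin r),
          Nat.card {v : Fin n → 𝓀[K]ˣ // ∀ j ∈ I, evalHom (reduceHom k K) v (f₀ j) = 0} =
            numPoints K I (g I) * (qK K - 1) ^ (n - T.dimSum I) := by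
  classical
  have hJ : ∀ J : Finset (Fin r), Ideal.span (Set.range
      (Sum.elim (fun j : J => T.init j) (jacobianMinor T.init J))) = ⊤ := fun J =>
    span_jacobianMinor_eq_top _ _ ((hreg.2.resolve_left hne.ne_empty) J)
  choose cert hcert using fun J => exists_finset_minor T.init J (hJ J)
  choose hg0 c α hc hmul using fun I j (hj : j ∈ I) => hB I j hj
  let s : Finset k := (Finset.univ.biUnion fun i => coeffs (T.f i)) ∪
    ((Finset.univ.biUnion fun i => coeffs (T.init i)) ∪
      ((Finset.univ.biUnion fun I : Finset (Fin r) => I.biUnion fun j => coeffs (g I j)) ∪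
        ((Finset.univ.biUnion fun I : Finset (Fin r) => I.attach.biUnion fun j =>
          {c I j j.2, (c I j j.2)⁻¹}) ∪
          Finset.univ.biUnion fun J : Finset (Fin r) => (cert J).biUnion coeffs)))
  obtain ⟨S, hS, hint⟩ := exists_finite_primes_forall_integral s
  refine ⟨S, hS, fun K _ _ _ _ _ hK => ?_⟩
  have hs : ∀ c ∈ s, c ∈ integralAt k K := hint K hK
  have hf : ∀ i α, (T.f i).coeff α ∈ integralAt k K := fun i =>
    coeff_mem_of_coeffs fun c hc => hs c (by
      simp only [s, Finset.mem_union, Finset.mem_biUnion, Finset.mem_univ, true_and]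
      exact Or.inl ⟨i, hc⟩)
  have hf₀ : ∀ i α, (T.init i).coeff α ∈ integralAt k K := fun i =>
    coeff_mem_of_coeffs fun c hc => hs c (by
      simp only [s, Finset.mem_union, Finset.mem_biUnion, Finset.mem_univ, true_and]
      exact Or.inr (Or.inl ⟨i, hc⟩))
  have hg : ∀ I, ∀ j ∈ I, ∀ α, (g I j).coeff α ∈ integralAt k K := fun I j hj =>
    coeff_mem_of_coeffs fun c hc => hs c (by
      simp only [s, Finset.mem_union, Finset.mem_biUnion, Finset.mem_univ, true_and]
      exact Or.inr (Or.inr (Or.inl ⟨I, j, hj, hc⟩)))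
  have hcs : ∀ I j (hj : j ∈ I), c I j hj ∈ integralAt k K ∧ (c I j hj)⁻¹ ∈ integralAt k K := by
    intro I j hj
    constructor <;>
    · refine hs _ ?_
      simp only [s, Finset.mem_union, Finset.mem_biUnion, Finset.mem_univ, true_and]
      exact Or.inr (Or.inr (Or.inr (Or.inl ⟨I, ⟨j, hj⟩, Finset.mem_attach _ _, by simp⟩)))
  have hcertK : ∀ J, ∀ p ∈ cert J, ∀ α, p.coeff α ∈ integralAt k K := fun J p hp =>
    coeff_mem_of_coeffs fun c hc => hs c (by
      simp only [s, Finset.mem_union, Finset.mem_biUnion, Finset.mem_univ, true_and]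
      exact Or.inr (Or.inr (Or.inr (Or.inr ⟨J, p, hp, hc⟩))))
  choose f hfe using fun i => exists_lift_subring _ (hf i)
  choose f₀ hf₀e using fun i => exists_lift_subring _ (hf₀ i)
  have hgl : ∀ I j, ∃ g' : Laurent (integralAt k K) (T.dimSum I),
      j ∈ I → AddMonoidAlgebra.mapRingHom _ (integralAt k K).subtype g' = g I j := by
    intro I j
    by_cases hj : j ∈ I
    · obtain ⟨g', hg'⟩ := exists_lift_subring _ (hg I j hj)
      exact ⟨g', fun _ => hg'⟩
    · exact ⟨0, fun h => absurd h hj⟩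
  choose g' hg' using hgl
  refine ⟨hg, f, f₀, ⟨hfe, hf₀e, fun J v hv => ?_⟩, fun I => ?_⟩
  · exact hcert J (integralAt k K) (hcertK J) f₀ hf₀e (reduceHom k K) v hv
  · have hd : T.dimSum I ≤ n := (Submodule.finrank_le _).trans (by simp)
    rw [numPoints_eq I (g I) (g' I) (hg' I)]
    refine card_zeros_of_splitting hd (integralAt k K) (reduceHom k K) I (B I) f₀ (g' I) ?_
    intro j hj
    refine ⟨⟨_, (hcs I j hj).1⟩, ⟨_, (hcs I j hj).2⟩, α I j hj,
      Subtype.ext (mul_inv_cancel₀ (hc I j hj)), ?_⟩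
    rw [hf₀e, hg' I j hj]
    exact hmul I j hj

end GoodPrimes

/-! ### The explicit formula -/

section Formula

variable {k K : Type*} [Field k] [Field K] [ValuativeRel K] {n r m : ℕ}
variable [TopologicalSpace K] [IsNonarchimedeanLocalField K] [Algebra k K]

/-- Grouping the points of the torus over the residue field according to the functions which vanish
there. -/
lemma sum_zeroSet_eq [Fintype (Fin n → 𝓀[K]ˣ)] (f₀ : Fin r → Laurent (integralAt k K) n)
    (F : Finset (Fin r) → ℂ) :
    ∑ v : Fin n → 𝓀[K]ˣ, F (zeroSet f₀ v) = ∑ J : Finset (Fin r),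
      (∑ I : Finset (Fin r) with J ⊆ I, (-1 : ℂ) ^ (J.card + I.card) *
        (Nat.card {v : Fin n → 𝓀[K]ˣ // ∀ j ∈ I, evalHom (reduceHom k K) v (f₀ j) = 0} : ℂ)) *
        F J := by
  classical
  rw [← Finset.sum_fiberwise_of_maps_to (s := Finset.univ) (t := Finset.univ)
    (g := fun v => zeroSet f₀ v) fun _ _ => Finset.mem_univ _]
  refine Finset.sum_congr rfl fun J _ => ?_
  rw [Finset.sum_congr rfl (g := fun _ => F J) fun v hv => by rw [(Finset.mem_filter.1 hv).2],
    Finset.sum_const, nsmul_eq_mul]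
  congr 1
  rw [card_filter_eq_sum]
  refine Finset.sum_congr rfl fun I _ => ?_
  have hcard : Nat.card {v : Fin n → 𝓀[K]ˣ // I ⊆ zeroSet f₀ v} =
      Nat.card {v : Fin n → 𝓀[K]ˣ // ∀ j ∈ I, evalHom (reduceHom k K) v (f₀ j) = 0} :=
    Nat.card_congr (Equiv.subtypeEquivRight fun v => forall₂_congr fun j _ => mem_zeroSet)
  rw [hcard]

end Formula

end ToricZeta

end


theorem proposition6p2 {k : Type*} [Field k] [NumberField k] {n r : ℕ}
    (T : ToricDatum k n r) (hreg : T.IsRegular) (hne : T.cone.Nonempty) :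
    -- the face `τ` and the splittings defining the `U_I` exist,
    (∃! τ, T.IsConeFace τ) ∧
    (∀ I : Finset (Fin r), ∃ B g, T.IsSplitting I B g) ∧
    -- and for all choices of them
    ∀ (τ : Set (Fin n → ℝ)), T.IsConeFace τ →
    ∀ (B : Finset (Fin r) → GL (Fin n) ℤ)
      (g : (I : Finset (Fin r)) → Fin r → Laurent k (T.dimSum I)),
      (∀ I, T.IsSplitting I (B I) (g I)) →
    ∃ S : Set (Ideal (𝓞 k)), S.Finite ∧
      ∀ (γ : Fin r → Fin n → ℤ), (∀ i, γ i ∈ supp (T.init i)) →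
      ∀ (m : ℕ) (β : Matrix (Fin m) (Fin n) ℕ)
        (K : Type*) [Field K] [ValuativeRel K] [TopologicalSpace K] [IsNonarchimedeanLocalField K]
        [Algebra k K] [MeasurableSpace (Fin n → K)] [BorelSpace (Fin n → K)],
        primeBelow k K ∉ S →
        (∀ I, ∀ j ∈ I, HasReduction K (g I j)) ∧
        ∀ s : Fin m → ℂ, (∀ l, 0 ≤ (s l).re) →
          IntegrableOn (integrand β s) (T.points K) (haarK K n) ∧
          (∀ J, (T.W τ γ β J).IsRegularAt (qPoint K s)) ∧
          zetaK K T β s =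
            ∑ J : Finset (Fin r),
              (∑ I : Finset (Fin r) with J ⊆ I,
                (-1 : ℂ) ^ (J.card + I.card) * (numPoints K I (g I) : ℂ) *
                  ((qK K : ℂ) - 1) ^ ((polyDim τ : ℤ) - (T.dimSum I : ℤ))) *
              (T.W τ γ β J).eval (qPoint K s) := by
  have hinit := hreg.init_ne_zero hne
  refine ⟨hreg.existsUnique_coneFace hne, fun I => T.exists_isSplitting hinit I,
    fun τ _ B g hB => ?_⟩
  obtain ⟨S, hS, hgood⟩ := hreg.exists_finite_primes hne B g hB
  refine ⟨S, hS, fun γ hγ m β K _ _ _ _ _ _ _ hK => ?_⟩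
  obtain ⟨hint, f, f₀, hred, hcard⟩ := hgood K hK
  refine ⟨hint, fun s hs => ?_⟩
  have hq1 := qK_sub_one_ne_zero K
  have hz0 : 1 < ‖qPoint K s 0‖ := by
    rw [qPoint, Fin.cons_zero, Complex.norm_natCast]
    exact_mod_cast one_lt_qK
  have hz : ∀ l : Fin m, ‖qPoint K s l.succ‖ ≤ 1 := by
    intro l
    have hq : 1 < qK K := one_lt_qK
    rw [qPoint, Fin.cons_succ, Complex.norm_natCast_cpow_of_pos (by omega), Complex.neg_re]
    exact Real.rpow_le_one_of_one_le_of_nonpos (by exact_mod_cast hq.le) (by linarith [hs l])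
  choose V hV hW using fun J => T.exists_hasValue_W τ γ β J hz0 hz
  simp only [qPoint, Fin.cons_zero, Fin.cons_succ] at hV
  let : Fintype (Fin n → 𝓀[K]ˣ) := Fintype.ofFinite _
  obtain ⟨hI, hzeta⟩ := hred.integral_eq_sum hreg.1 hγ β s hV
  refine ⟨hI, fun J => (hW J).isRegularAt_and_eval.1, ?_⟩
  -- Both sides are sums over `J` and `I`, and `τ` cancels from the exponents of `q - 1`.
  rw [hzeta, sum_zeroSet_eq f₀ fun J =>
    (qK K : ℂ) ^ (-(n : ℤ)) * ((qK K : ℂ) - 1) ^ J.card * V J]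
  refine Finset.sum_congr rfl fun J _ => ?_
  rw [(hW J).eval_eq, Finset.sum_mul, Finset.sum_mul]
  refine Finset.sum_congr rfl fun I _ => ?_
  have hd : T.dimSum I ≤ n := (Submodule.finrank_le _).trans (by simp)
  have hpow : ((qK K : ℂ) - 1) ^ (n - T.dimSum I) * ((qK K : ℂ) - 1) ^ J.card =
      ((qK K : ℂ) - 1) ^ ((polyDim τ : ℤ) - (T.dimSum I : ℤ)) *
        ((qK K : ℂ) - 1) ^ ((n : ℤ) - (polyDim τ : ℤ) + (J.card : ℤ)) := by
    rw [← zpow_add₀ hq1, ← zpow_natCast, ← zpow_natCast, ← zpow_add₀ hq1]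
    congr 1
    omega
  have hq : ((qK K - 1 : ℕ) : ℂ) = (qK K : ℂ) - 1 := by
    rw [Nat.cast_sub one_lt_qK.le, Nat.cast_one]
  rw [hcard, Nat.cast_mul, Nat.cast_pow, hq]
  simp only [qPoint, Fin.cons_zero]
  linear_combination ((-1 : ℂ) ^ (J.card + I.card) * (numPoints K I (g I) : ℂ) *
    (qK K : ℂ) ^ (-(n : ℤ)) * V J) * hpow
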